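/- **Setting.** A *linkage function* on $\mathbb{R}^k$ is a symmetric nonnegative function $d(A,B)$ of pairs of finite nonempty sets (*clusters*) $A,B\subseteq\mathbb{R}^k$. For a natural number $K$, $d$ is *well-behaved with constants at most $K$* if, for all clusters: 1. (packability) if $r>0$, the clusters of $\mathcal C$ and the cluster $A$ have at most $n$ points, and $d(B,C)\ge r$ for all distinct $B,C\in\mathcal C$, then for all $R\ge r$, $|\{C\in\mathcal C: d(A,C)\le R\}|\le K(\lfloor\log_2 n\rfloor+1)^K\,(2R/r)^{Kk}$; 2. (approximate triangle inequality) $d(A,C)\le K(d(A,B)+d(B,C))$ whenever $|B|\ge\min(|A|,|C|)$; 3. (weight-stability) $d(A\cup B,A)\le\frac{|B|}{|A|+|B|}d(A,B)$ for disjoint $A,B$; 4. (average-reducibility) $d(A\cup B,C)\ge\frac{d(A,C)+d(B,C)}2-d(A,B)$ for disjoint $A,B$ and $|C|\ge|A|+|B|$; 5. (poly-bounded diameter) if $d(\{u\},\{v\})\le\Delta$ for all $u,v\in\mathcal P$, then $d(A,B)\le K(1+\Delta|\mathcal P|)^K$ for all disjoint nonempty $A,B\subseteq\mathcal P$. *$(1+\epsilon)$-approximate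 HAC* on a set $\mathcal P$ of $n$ points begins with the singleton clustering and performs $n-1$ merges; each replaces two distinct clusters $A,B$ of the current clustering $\mathcal C$ with $d(A,B)\le(1+\epsilon)\min_{X\ne Y\in\mathcal C}d(X,Y)$ by $A\cup B$. The *height* of its dendrogram is the largest number of merges that the cluster of a point takes part in. The *bounce-back length* is at most $\ell$ if the following holds for every clustering $\mathcal C$ reachable from the singletons by $(1+\epsilon)$-approximate merges, and every $\theta>0$ such that all linkage values between distinct clusters of $\mathcal C$ are at least $\theta$. Let $A\in\mathcal C$ and let $B_1,\dots,B_l$ be distinct clusters of $\mathcal C\setminus\{A\}$ such that, with $A_i=A\cup B_1\cup\dots\cup B_i$, each $B_{i+1}$ minimizes $d(A_i,\cdot)$ over $\mathcal C\setminus\{A,B_1,\dots,B_i\}$. If $d(A,B_1)<(1+\epsilon)\theta$ and $d(A_i,B_{i+1})<\theta$ for $1\le i<l$, then $l\le\ell$. **Machine model.** Algorithms are programs of a nested-parallel random access machine (loops, conditionals and parallel for-loops; the work of a parallel loop adds up over its branches, the depth is the maximum). The branches of a parallel loop all start from the same memory contents and run independently; when they finish, a cell that several branches changed takes the value given by the first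 of them. Each value of a natural number expression is charged its bit length. Real arithmetic ($+,-,\times$, comparison), forming the union of two cluster handles, and evaluating $d$ have unit cost. The points are accessed only through $d$. The program can merge two active clusters, which updates the set of active clusters and appends the pair to the output; the outputs of parallel branches are appended in the order of the branches. It can also call a nearest neighbours subroutine, which returns the $q$ nearest active clusters to an active cluster (ties broken arbitrarily; all of the others if there are fewer than $q$). A call takes work $\mathsf W_{NN}$ plus the size of the output, and depth the size of the output, besides the cost of an ordinary instruction; a merge is also charged work $\mathsf W_{NN}$. The inputs are $n,k,h,\ell,\epsilon$ and the singleton clusters. **Theorem.** Let $\epsilon>0$ and let $K,\kappa$ be natural numbers. There are a program and natural numbers $c,C$, depending only on $\epsilon,K,\kappa$, such that the following holds for all $k$, all $n\ge2$, all sets $\mathcal P\subseteq\mathbb{R}^k$ of $n$ points, all $d$ on $\mathbb{R}^k$, all natural numbers $h,\ell$ and $\mathsf W_{NN}\ge1$, and all $\delta>0$. Suppose that - $d/\delta$ is well-behaved with constants at most $K$, and $\delta\le d(\{u\},\{v\})\le\delta n^{\kappa}$ for all distinct $u,v\in\mathcal P$ (polynomial aspect ratio; $\delta$ is the unit of scale);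 - every $(1+\epsilon)$-approximate HAC on $\mathcal P$ has a dendrogram of height at most $h$, and the bounce-back length is at most $\ell$; - the subroutine returns the $q=c\,(2\ell)^{ck}\lfloor\log_2 n\rfloor^{c}$ nearest neighbours. Then the program halts, its output is a $(1+\epsilon)$-approximate HAC on $\mathcal P$, and $$\text{work}\le C\,\mathsf W_{NN}\,n\,h\,(2\ell)^{Ck}\lfloor\log_2 n\rfloor^{C}=\tilde O(\mathsf W_{NN}\cdot nh\,\ell^{O(k)}),\qquad \text{depth}\le C\,h\,(2\ell)^{Ck}\lfloor\log_2 n\rfloor^{C}=\tilde O(h\,\ell^{O(k)}),$$ where $\ell^{O(k)}$ is understood to include factors $2^{O(k)}$. -/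

import Mathlib

noncomputable section

namespace HAC

/-! ### Clusters, linkage functions, well-behavedness -/

/-- Points of `ℝ^k`. -/
abbrev Pt (k : ℕ) := EuclideanSpace ℝ (Fin k)

/-- Clusters are finite sets of points (every condition below is imposed on nonempty ones only). -/
abbrev Cluster (k : ℕ) := Finset (Pt k)

/-- A linkage function assigns a "distance" to each pair of clusters. -/
abbrev Linkage (k : ℕ) := Cluster k → Cluster k → ℝ

section WellBehaved

variable {k : ℕ}

/-- Symmetric and nonnegative. -/
def IsLinkage (d : Linkage k) : Prop :=
  ∀ A B : Cluster k, A.Nonempty → B.Nonempty → d A B = d B A ∧ 0 ≤ d A B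

open scoped Classical in
/-- The ball `B_d^𝒞(A, R)`. -/
def ball (d : Linkage k) (𝒞 : Finset (Cluster k)) (A : Cluster k) (R : ℝ) :
    Finset (Cluster k) :=
  𝒞.filter fun C => d A C ≤ R

/-- `α`-packability with `α = K (log n + 1)^K`, where `n` bounds the number of points of the
clusters involved, and with `(R / r)^{O(k)}` read as `(2 R / r)^{K k}`. -/
def Packable (K : ℕ) (d : Linkage k) : Prop :=
  ∀ (n : ℕ) (𝒞 : Finset (Cluster k)) (A : Cluster k) (r R : ℝ),
    (∀ B ∈ 𝒞, B.Nonempty ∧ B.card ≤ n) → A.Nonempty → A.card ≤ n →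
    0 < r → (∀ B ∈ 𝒞, ∀ C ∈ 𝒞, B ≠ C → r ≤ d B C) → r ≤ R →
    ((ball d 𝒞 A R).card : ℝ) ≤
      ((K * (Nat.log 2 n + 1) ^ K : ℕ) : ℝ) * (2 * (R / r)) ^ (K * k)

/-- Approximate triangle inequality, when the middle cluster is not the smallest one. -/
def ApproxTriangle (K : ℕ) (d : Linkage k) : Prop :=
  ∀ A B C : Cluster k, A.Nonempty → B.Nonempty → C.Nonempty →
    min A.card C.card ≤ B.card → d A C ≤ K * (d A B + d B C)

open scoped Classical in
/-- Weight-stability. -/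
def WeightStable (d : Linkage k) : Prop :=
  ∀ A B : Cluster k, A.Nonempty → B.Nonempty → Disjoint A B →
    d (A ∪ B) A ≤ (B.card : ℝ) / (A.card + B.card) * d A B

open scoped Classical in
/-- Average-reducibility. -/
def AverageReducible (d : Linkage k) : Prop :=
  ∀ A B C : Cluster k, A.Nonempty → B.Nonempty → C.Nonempty → Disjoint A B →
    A.card + B.card ≤ C.card →
    (d A C + d B C) / 2 - d A B ≤ d (A ∪ B) C

/-- Poly-bounded diameter. -/
def PolyBoundedDiameter (K : ℕ) (d : Linkage k) : Prop :=
  ∀ (P : Finset (Pt k)) (Δ : ℝ), (∀ u ∈ P, ∀ v ∈ P, d {u} {v} ≤ Δ) →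
    ∀ A B : Cluster k, A ⊆ P → B ⊆ P → A.Nonempty → B.Nonempty → Disjoint A B →
      d A B ≤ K * (1 + Δ * P.card) ^ K

/-- `d` is a well-behaved linkage function, all hidden constants being at most `K`. -/
structure WellBehaved (K : ℕ) (d : Linkage k) : Prop where
  isLinkage : IsLinkage d
  packable : Packable K d
  approxTriangle : ApproxTriangle K d
  weightStable : WeightStable d
  averageReducible : AverageReducible d
  polyBoundedDiameter : PolyBoundedDiameter K d

end WellBehaved

/-! ### Approximate HAC, dendrogram height, bounce-back length -/

/-- A sequence of merges, each being the pair of clusters that are merged. -/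
abbrev Merges (k : ℕ) := List (Cluster k × Cluster k)

section Dendrogram

variable {k : ℕ}

open scoped Classical in
/-- The singleton clustering of the points `p 0, …, p (n-1)`. -/
def singletons {n : ℕ} (p : Fin n → Pt k) : Finset (Cluster k) :=
  Finset.univ.image fun i => ({p i} : Cluster k)

open scoped Classical in
/-- Remove `A` and `B` from `𝒞` and add `A ∪ B`. -/
def mergeIn (𝒞 : Finset (Cluster k)) (A B : Cluster k) : Finset (Cluster k) :=
  insert (A ∪ B) ((𝒞.erase A).erase B)

/-- `(A, B)` is a legal merge of `c`-approximate HAC on the clustering `𝒞`. -/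
def IsApproxMerge (d : Linkage k) (c : ℝ) (𝒞 : Finset (Cluster k)) (A B : Cluster k) : Prop :=
  A ∈ 𝒞 ∧ B ∈ 𝒞 ∧ A ≠ B ∧ ∀ X ∈ 𝒞, ∀ Y ∈ 𝒞, X ≠ Y → d A B ≤ c * d X Y

/-- Every merge of the sequence is a legal `c`-approximate merge when the sequence is performed
from the clustering `𝒞`. -/
def IsApproxMerges (d : Linkage k) (c : ℝ) : Finset (Cluster k) → Merges k → Prop
  | _, [] => True
  | 𝒞, (A, B) :: L => IsApproxMerge d c 𝒞 A B ∧ IsApproxMerges d c (mergeIn 𝒞 A B) L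

/-- The clustering reached from `𝒞` by a sequence of merges. -/
def after : Finset (Cluster k) → Merges k → Finset (Cluster k)
  | 𝒞, [] => 𝒞
  | 𝒞, (A, B) :: L => after (mergeIn 𝒞 A B) L

/-- `L` is a (complete) `c`-approximate HAC of the `n` points `p`: `n - 1` legal merges. -/
def IsApproxHAC (d : Linkage k) (c : ℝ) {n : ℕ} (p : Fin n → Pt k) (L : Merges k) : Prop :=
  IsApproxMerges d c (singletons p) L ∧ L.length + 1 = n

open scoped Classical in
/-- Depth in the dendrogram of the leaf `x`: the proper ancestors of the leaf `{x}` are the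
internal nodes `A ∪ B` (one for each merge `(A, B)`) that contain `x`. -/
def leafDepth (L : Merges k) (x : Pt k) : ℕ :=
  L.countP fun m => x ∈ m.1 ∪ m.2

/-- Height of the dendrogram: the largest depth of a leaf. -/
def dendrogramHeight {n : ℕ} (p : Fin n → Pt k) (L : Merges k) : ℕ :=
  Finset.univ.sup fun i => leafDepth L (p i)

open scoped Classical in
/-- `(B₁, B₂, …)` is (the beginning of) a locally-optimal path of the cluster `A`, where `𝒳` is
the set of the other clusters: each `B_{i+1}` is nearest to `A_i = A ∪ B₁ ∪ … ∪ B_i` among the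
clusters of `𝒳` that have not been used yet. -/
def IsLocallyOptimal (d : Linkage k) :
    Cluster k → Finset (Cluster k) → List (Cluster k) → Prop
  | _, _, [] => True
  | A, 𝒳, B :: π =>
      B ∈ 𝒳 ∧ (∀ X ∈ 𝒳, d A B ≤ d A X) ∧ IsLocallyOptimal d (A ∪ B) (𝒳.erase B) π

open scoped Classical in
/-- All merges along the path have value less than `θ`. -/
def MergesBelow (d : Linkage k) (θ : ℝ) : Cluster k → List (Cluster k) → Prop
  | _, [] => True
  | A, B :: π => d A B < θ ∧ MergesBelow d θ (A ∪ B) π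

open scoped Classical in
/-- `π = (B₁, …, B_l)` is a bounce-back path of `A`, or a beginning of it, with respect to the
clustering `𝒞` and the thresholds `θ` and `(1+ε)θ`: it begins a locally-optimal path,
`d(A, B₁) < (1+ε)θ`, and `d(A_i, B_{i+1}) < θ` for `1 ≤ i < l`. -/
def IsBounceBackPath (d : Linkage k) (ε θ : ℝ) (𝒞 : Finset (Cluster k)) (A : Cluster k)
    (π : List (Cluster k)) : Prop :=
  A ∈ 𝒞 ∧ IsLocallyOptimal d A (𝒞.erase A) π ∧
    match π with
    | [] => True
    | B :: π' => d A B < (1 + ε) * θ ∧ MergesBelow d θ (A ∪ B) π'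

/-- `(1+ε)`-approximate HAC on `p` has bounce-back length at most `ℓ`: from every clustering that
some choice of `(1+ε)`-approximate merges reaches, and for every threshold `θ` that is a lower
bound for its linkage values, all bounce-back paths have length at most `ℓ`. -/
def BounceBackLengthLE (d : Linkage k) (ε : ℝ) {n : ℕ} (p : Fin n → Pt k) (ℓ : ℕ) : Prop :=
  ∀ L : Merges k, IsApproxMerges d (1 + ε) (singletons p) L →
    ∀ θ : ℝ, 0 < θ →
      (∀ X ∈ after (singletons p) L, ∀ Y ∈ after (singletons p) L, X ≠ Y → θ ≤ d X Y) →
      ∀ (A : Cluster k) (π : List (Cluster k)),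
        IsBounceBackPath d ε θ (after (singletons p) L) A π → π.length ≤ ℓ

end Dendrogram

/-! ### The work-depth model

A nested-parallel random access machine.  Natural numbers are charged by their bit length, real
numbers and cluster handles at unit cost.  Memory is organised in arrays, named by numerals. The
program text depends neither on the dimension nor on the input. -/

/-- Natural number expressions; `cell a i` is the entry `i` of the array `a`. -/
inductive NExp where
  | const (m : ℕ)
  | cell (a : ℕ) (i : NExp)
  | add (e f : NExp)
  | sub (e f : NExp)
  | mul (e f : NExp)
  | div (e f : NExp)
  | mod (e f : NExp)

/-- Cluster expressions; `slot i` is the active cluster in slot `i`. -/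
inductive CExp where
  | cell (a : ℕ) (i : NExp)
  | slot (i : NExp)
  | union (A B : CExp)

/-- Real expressions; `link A B` evaluates the linkage function. -/
inductive RExp where
  | ofNat (e : NExp)
  | cell (a : ℕ) (i : NExp)
  | link (A B : CExp)
  | add (x y : RExp)
  | sub (x y : RExp)
  | mul (x y : RExp)

/-- Tests. -/
inductive BExp where
  | ltN (e f : NExp)
  | ltR (x y : RExp)

/-- Programs. -/
inductive Cmd where
  | skip
  /-- `a[i] := e` for the three sorts of memory. -/
  | setN (a : ℕ) (i e : NExp)
  | setR (a : ℕ) (i : NExp) (x : RExp)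
  | setC (a : ℕ) (i : NExp) (A : CExp)
  /-- Nearest neighbours query for the cluster in slot `i`, the answer being put into `a`. -/
  | nn (a : ℕ) (i : NExp)
  /-- Merge the active clusters in the slots `i` and `j`. -/
  | merge (i j : NExp)
  | seq (c c' : Cmd)
  | ite (b : BExp) (c c' : Cmd)
  | loop (b : BExp) (c : Cmd)
  /-- For all `i < e` in parallel, run `c` with `i` in the entry `0` of the array `x`. -/
  | par (x : ℕ) (e : NExp) (c : Cmd)

/-- Memory.  `slot` holds the set of active clusters: slot `i` holds the cluster `slot i`, and is
free if this is empty. -/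
structure Store (k : ℕ) where
  nat : ℕ → ℕ → ℕ
  real : ℕ → ℕ → ℝ
  clus : ℕ → ℕ → Cluster k
  slot : ℕ → Cluster k

/-- What a program has access to: the linkage function and a nearest neighbours subroutine (a
function of the active clusters and of the slot of the query), a call of which takes work `W` plus
the size of its output. -/
structure Env (k : ℕ) where
  link : Linkage k
  near : (ℕ → Cluster k) → ℕ → List ℕ
  W : ℕ

/-- Writing one entry of a family of arrays. -/
def write {β : Type} (f : ℕ → ℕ → β) (a i : ℕ) (v : β) : ℕ → ℕ → β :=
  Function.update f a (Function.update (f a) i v)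

/-- Writing a list `L` into the array `a`: its length, then its entries. -/
def writeList (f : ℕ → ℕ → ℕ) (a : ℕ) (L : List ℕ) : ℕ → ℕ → ℕ :=
  Function.update f a fun t =>
    if t = 0 then L.length else if t ≤ L.length then L.getD (t - 1) 0 else f a t

section Semantics

variable {k : ℕ}

def NExp.eval (s : Store k) : NExp → ℕ
  | .const m => m
  | .cell a i => s.nat a (i.eval s)
  | .add e f => e.eval s + f.eval s
  | .sub e f => e.eval s - f.eval s
  | .mul e f => e.eval s * f.eval s
  | .div e f => e.eval s / f.eval s
  | .mod e f => e.eval s % f.eval s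

/-- Cost of a natural number expression: for each node, one plus the bit length of its value. -/
def NExp.cost (s : Store k) : NExp → ℕ
  | .const m => 1 + m.size
  | .cell a i => i.cost s + 1 + (s.nat a (i.eval s)).size
  | .add e f => e.cost s + f.cost s + 1 + (e.eval s + f.eval s).size
  | .sub e f => e.cost s + f.cost s + 1 + (e.eval s - f.eval s).size
  | .mul e f => e.cost s + f.cost s + 1 + (e.eval s * f.eval s).size
  | .div e f => e.cost s + f.cost s + 1 + (e.eval s / f.eval s).size
  | .mod e f => e.cost s + f.cost s + 1 + (e.eval s % f.eval s).size

open scoped Classical in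
def CExp.eval (s : Store k) : CExp → Cluster k
  | .cell a i => s.clus a (i.eval s)
  | .slot i => s.slot (i.eval s)
  | .union A B => A.eval s ∪ B.eval s

def CExp.cost (s : Store k) : CExp → ℕ
  | .cell _ i => i.cost s + 1
  | .slot i => i.cost s + 1
  | .union A B => A.cost s + B.cost s + 1

def RExp.eval (M : Env k) (s : Store k) : RExp → ℝ
  | .ofNat e => (e.eval s : ℝ)
  | .cell a i => s.real a (i.eval s)
  | .link A B => M.link (A.eval s) (B.eval s)
  | .add x y => x.eval M s + y.eval M s
  | .sub x y => x.eval M s - y.eval M s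
  | .mul x y => x.eval M s * y.eval M s

def RExp.cost (s : Store k) : RExp → ℕ
  | .ofNat e => e.cost s + 1
  | .cell _ i => i.cost s + 1
  | .link A B => A.cost s + B.cost s + 1
  | .add x y => x.cost s + y.cost s + 1
  | .sub x y => x.cost s + y.cost s + 1
  | .mul x y => x.cost s + y.cost s + 1

def BExp.Holds (M : Env k) (s : Store k) : BExp → Prop
  | .ltN e f => e.eval s < f.eval s
  | .ltR x y => x.eval M s < y.eval M s

def BExp.cost (s : Store k) : BExp → ℕ
  | .ltN e f => e.cost s + f.cost s + 1
  | .ltR x y => x.cost s + y.cost s + 1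

open scoped Classical in
/-- Joining parallel branches `0, …, m-1` that have been started from the contents `v` of a memory
cell and end with the contents `v' i`: the first branch that has changed the cell determines it. -/
def joinCell {β : Type} (m : ℕ) (v : β) (v' : ℕ → β) : β :=
  if h : ∃ i, i < m ∧ v' i ≠ v then v' (Nat.find h) else v

def Store.join (m : ℕ) (s : Store k) (s' : ℕ → Store k) : Store k where
  nat a i := joinCell m (s.nat a i) fun b => (s' b).nat a i
  real a i := joinCell m (s.real a i) fun b => (s' b).real a i
  clus a i := joinCell m (s.clus a i) fun b => (s' b).clus a i
  slot i := joinCell m (s.slot i) fun b => (s' b).slot i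

open scoped Classical in
/-- Merging the active clusters in the slots `i` and `j`: their union takes slot `i`, and slot `j`
becomes free. -/
def Store.merge (s : Store k) (i j : ℕ) : Store k :=
  { s with slot := Function.update (Function.update s.slot i (s.slot i ∪ s.slot j)) j ∅ }

/-- `Exec M c s s' L w t`: started in `s`, the program `c` halts in `s'`, having output the sequence
of merges `L`, with work `w` and depth `t`.

A merge updates the active clusters and appends the pair to the output; like a query it is charged
work `W`.  Parallel branches run
independently of each other from the same memory contents; the work is the sum and the depth the
maximum over the branches, and the outputs of the branches are appended in the order of the
branches. -/
inductive Exec (M : Env k) : Cmd → Store k → Store k → Merges k → ℕ → ℕ → Prop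
  | skip (s : Store k) : Exec M .skip s s [] 1 1
  | setN (a : ℕ) (i e : NExp) (s : Store k) :
      Exec M (.setN a i e) s { s with nat := write s.nat a (i.eval s) (e.eval s) } []
        (1 + i.cost s + e.cost s) (1 + i.cost s + e.cost s)
  | setR (a : ℕ) (i : NExp) (x : RExp) (s : Store k) :
      Exec M (.setR a i x) s { s with real := write s.real a (i.eval s) (x.eval M s) } []
        (1 + i.cost s + x.cost s) (1 + i.cost s + x.cost s)
  | setC (a : ℕ) (i : NExp) (A : CExp) (s : Store k) :
      Exec M (.setC a i A) s { s with clus := write s.clus a (i.eval s) (A.eval s) } []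
        (1 + i.cost s + A.cost s) (1 + i.cost s + A.cost s)
  | nn (a : ℕ) (i : NExp) (s : Store k) :
      Exec M (.nn a i) s { s with nat := writeList s.nat a (M.near s.slot (i.eval s)) } []
        (1 + i.cost s + M.W + (M.near s.slot (i.eval s)).length)
        (1 + i.cost s + (M.near s.slot (i.eval s)).length)
  | merge (i j : NExp) (s : Store k) :
      Exec M (.merge i j) s
        (s.merge (i.eval s) (j.eval s))
        [(s.slot (i.eval s), s.slot (j.eval s))]
        (1 + i.cost s + j.cost s + M.W) (1 + i.cost s + j.cost s)
  | seq {c c' : Cmd} {s s' s'' : Store k} {L L' : Merges k} {w w' t t' : ℕ} :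
      Exec M c s s' L w t → Exec M c' s' s'' L' w' t' →
      Exec M (.seq c c') s s'' (L ++ L') (w + w') (t + t')
  | iteTrue {b : BExp} {c c' : Cmd} {s s' : Store k} {L : Merges k} {w t : ℕ} :
      b.Holds M s → Exec M c s s' L w t →
      Exec M (.ite b c c') s s' L (1 + b.cost s + w) (1 + b.cost s + t)
  | iteFalse {b : BExp} {c c' : Cmd} {s s' : Store k} {L : Merges k} {w t : ℕ} :
      ¬ b.Holds M s → Exec M c' s s' L w t →
      Exec M (.ite b c c') s s' L (1 + b.cost s + w) (1 + b.cost s + t)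
  | loopDone {b : BExp} {c : Cmd} {s : Store k} :
      ¬ b.Holds M s → Exec M (.loop b c) s s [] (1 + b.cost s) (1 + b.cost s)
  | loopStep {b : BExp} {c : Cmd} {s s' s'' : Store k} {L L' : Merges k} {w w' t t' : ℕ} :
      b.Holds M s → Exec M c s s' L w t → Exec M (.loop b c) s' s'' L' w' t' →
      Exec M (.loop b c) s s'' (L ++ L') (1 + b.cost s + w + w') (1 + b.cost s + t + t')
  | par {x : ℕ} {e : NExp} {c : Cmd} {s : Store k} {s' : ℕ → Store k} {L : ℕ → Merges k}
      {w t : ℕ → ℕ} :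
      (∀ i < e.eval s,
        Exec M c { s with nat := write s.nat x 0 i } (s' i) (L i) (w i) (t i)) →
      Exec M (.par x e c) s (s.join (e.eval s) s') ((List.range (e.eval s)).flatMap L)
        (1 + e.cost s + ∑ i ∈ Finset.range (e.eval s), (1 + w i))
        (1 + e.cost s + (Finset.range (e.eval s)).sup t)

/-- `L` lists the slots of `q` nearest neighbours (of all other active clusters, if there are fewer
than `q`) of the cluster in slot `i`, in order of their linkage to it, ties being broken
arbitrarily. -/
def IsNearest (d : Linkage k) (q : ℕ) (slot : ℕ → Cluster k) (i : ℕ) (L : List ℕ) : Prop :=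
  L.Nodup ∧ (∀ j ∈ L, j ≠ i ∧ slot j ≠ ∅) ∧
    L.Pairwise (fun j j' => d (slot i) (slot j) ≤ d (slot i) (slot j')) ∧
    (∀ j ∈ L, ∀ j', j' ∉ L → j' ≠ i → slot j' ≠ ∅ →
      d (slot i) (slot j) ≤ d (slot i) (slot j')) ∧
    L.length ≤ q ∧ (L.length < q → ∀ j, j ≠ i → slot j ≠ ∅ → j ∈ L)

/-- The subroutine `near` finds the `q` nearest neighbours of every active cluster. -/
def FindsNearest (d : Linkage k) (q : ℕ) (near : (ℕ → Cluster k) → ℕ → List ℕ) : Prop :=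
  ∀ (slot : ℕ → Cluster k) (i : ℕ), {j | slot j ≠ ∅}.Finite → slot i ≠ ∅ →
    IsNearest d q slot i (near slot i)

/-- The initial memory: the numbers `n, k, h, ℓ` in the array `0`, the real number `ε` in the array
`0` of the real memory, the singleton cluster of the `i`-th point in slot `i`. -/
def initStore {n : ℕ} (p : Fin n → Pt k) (h ℓ : ℕ) (ε : ℝ) : Store k where
  nat a i := if a = 0 then [n, k, h, ℓ].getD i 0 else 0
  real a i := if a = 0 ∧ i = 0 then ε else 0
  clus _ _ := ∅
  slot i := if hi : i < n then {p ⟨i, hi⟩} else ∅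

end Semantics

end HAC

end

/-!
The program works in phases with growing thresholds `θ`. During a phase all linkage values between
clusters are at least `θ`, so a merge of value less than `(1 + ε) θ` is legal; the phase removes all
values below `(1 + ε) θ`, and the next one works with `(1 + ε) θ`.  The first threshold is a lower
bound for the distances of points, and since the aspect ratio of all linkage values is polynomial
(`diameter_le`), logarithmically many phases leave a single cluster (`exists_phases`).

Within a phase, a cluster grows along a bounce-back path: it merges with its nearest neighbour as
long as this is nearer than `(1 + ε) θ` for the first merge and nearer than `θ` for the later ones.
The path has length at most `ℓ` by hypothesis, and when it ends, all values of the grown cluster are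
at least `θ` again.  Weight-stability and the approximate triangle inequality, the latter applied in
the way of a binary tree, keep the growing cluster within distance `ℓ^{O(1)} θ` of where it began
(`Metricish.chain`, `IsPath.dist_acc`).  Hence two paths can interfere only if they begin within
`conflictRadius` of each other, up to one intermediate cluster, and by packability all clusters
within this radius are among the `q` nearest neighbours (`mem_near`, `packing_le`).  So clusters
that are not joined by at most two steps in the lists of neighbours may grow in parallel
(`PassData.independent`), and the outcome is that of a legal sequence of merges (`Reach.stage`).

A pass lets every cluster be considered as the beginning of a path once.  It colours the clusters so
that those joined by at most two steps have different colours, and treats the colours one after the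
other.  The colouring takes no coordination: slot `i` gets the least modulus `m` that separates `i`
from its neighbours and their neighbours, together with the residue of `i`; if two slots have the
same colour and one were near the other, they would be congruent modulo a modulus that separates
them.  The modulus is polynomial in `q` and `log n` (`exists_modulus`).

A cluster that is changed by a pass then contains a point that has taken part in one merge more than
was guaranteed before, and two clusters that are not changed are not close.  So after `t` passes of
a phase every pair of clusters of value less than `(1 + ε) θ` contains a point that has taken part
in `t` merges (`CloseDeep`, `PassInv.closeDeep`).  As the legal merges performed so far extend to an
approximate HAC, whose dendrogram has height at most `h`, there are no such pairs after `h + 1`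
passes (`runs_phase`).

The resources are bounded by a program logic with total correctness, work and depth (`Runs`).  The
program uses the following arrays.  Natural numbers: `0` inputs, `1` the number `q`, `2` the smaller
one of `h` and `n`, `3` a bound for the moduli, `4`, `5` and `8` counters of phases, passes and
colours, `6` marks of the free slots, `7` colours, `10` index of the parallel branch, above that
local variables.  Real numbers: `0` the input `ε`, `1` the threshold, `2` the scale `n ^ κ`, by
which thresholds are multiplied because there is no division, `3` the next threshold, `4` the
current threshold of a path.
-/

noncomputable section

namespace HAC

/-! ### A program logic with work and depth -/

section Logic

variable {k : ℕ} {M : Env k}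

/-- Total correctness with resource bounds: from `s` the program `c` halts with work at most `w` and
depth at most `t`, and its final memory and its output satisfy `Q`. -/
def Runs (M : Env k) (c : Cmd) (s : Store k) (w t : ℕ) (Q : Store k → Merges k → Prop) : Prop :=
  ∃ s' L w' t', Exec M c s s' L w' t' ∧ w' ≤ w ∧ t' ≤ t ∧ Q s' L

theorem Runs.mono {c : Cmd} {s : Store k} {w t w' t' : ℕ} {Q Q' : Store k → Merges k → Prop}
    (h : Runs M c s w t Q) (hw : w ≤ w') (ht : t ≤ t') (hQ : ∀ s' L, Q s' L → Q' s' L) :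
    Runs M c s w' t' Q' := by
  obtain ⟨s', L, w₁, t₁, he, h1, h2, h3⟩ := h
  exact ⟨s', L, w₁, t₁, he, h1.trans hw, h2.trans ht, hQ _ _ h3⟩

theorem Runs.skip {s : Store k} {w t : ℕ} {Q : Store k → Merges k → Prop}
    (hw : 1 ≤ w) (ht : 1 ≤ t) (hQ : Q s []) : Runs M .skip s w t Q :=
  ⟨s, [], 1, 1, .skip s, hw, ht, hQ⟩

theorem Runs.setN {a : ℕ} {i e : NExp} {s : Store k} {w t : ℕ} {Q : Store k → Merges k → Prop}
    (hw : 1 + i.cost s + e.cost s ≤ w) (ht : 1 + i.cost s + e.cost s ≤ t)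
    (hQ : Q { s with nat := write s.nat a (i.eval s) (e.eval s) } []) :
    Runs M (.setN a i e) s w t Q :=
  ⟨_, [], _, _, .setN a i e s, hw, ht, hQ⟩

theorem Runs.setR {a : ℕ} {i : NExp} {x : RExp} {s : Store k} {w t : ℕ}
    {Q : Store k → Merges k → Prop}
    (hw : 1 + i.cost s + x.cost s ≤ w) (ht : 1 + i.cost s + x.cost s ≤ t)
    (hQ : Q { s with real := write s.real a (i.eval s) (x.eval M s) } []) :
    Runs M (.setR a i x) s w t Q :=
  ⟨_, [], _, _, .setR a i x s, hw, ht, hQ⟩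

theorem Runs.nn {a : ℕ} {i : NExp} {s : Store k} {w t : ℕ} {Q : Store k → Merges k → Prop}
    (hw : 1 + i.cost s + M.W + (M.near s.slot (i.eval s)).length ≤ w)
    (ht : 1 + i.cost s + (M.near s.slot (i.eval s)).length ≤ t)
    (hQ : Q { s with nat := writeList s.nat a (M.near s.slot (i.eval s)) } []) :
    Runs M (.nn a i) s w t Q :=
  ⟨_, [], _, _, .nn a i s, hw, ht, hQ⟩

theorem Runs.merge {i j : NExp} {s : Store k} {w t : ℕ} {Q : Store k → Merges k → Prop}
    (hw : 1 + i.cost s + j.cost s + M.W ≤ w) (ht : 1 + i.cost s + j.cost s ≤ t)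
    (hQ : Q (s.merge (i.eval s) (j.eval s)) [(s.slot (i.eval s), s.slot (j.eval s))]) :
    Runs M (.merge i j) s w t Q :=
  ⟨_, _, _, _, .merge i j s, hw, ht, hQ⟩

theorem Runs.seq {c c' : Cmd} {s : Store k} {w t w' t' : ℕ} {Q : Store k → Merges k → Prop}
    (h : Runs M c s w t fun s' L => Runs M c' s' w' t' fun s'' L' => Q s'' (L ++ L')) :
    Runs M (.seq c c') s (w + w') (t + t') Q := by
  obtain ⟨s', L, w₁, t₁, he, h1, h2, s'', L', w₂, t₂, he', h3, h4, hq⟩ := h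
  exact ⟨s'', L ++ L', _, _, .seq he he', by omega, by omega, hq⟩

theorem Runs.ite {b : BExp} {c c' : Cmd} {s : Store k} {cb w t : ℕ}
    {Q : Store k → Merges k → Prop} (hb : 1 + b.cost s ≤ cb)
    (h : b.Holds M s → Runs M c s w t Q) (h' : ¬ b.Holds M s → Runs M c' s w t Q) :
    Runs M (.ite b c c') s (cb + w) (cb + t) Q := by
  by_cases hh : b.Holds M s
  · obtain ⟨s', L, w₁, t₁, he, h1, h2, hq⟩ := h hh
    exact ⟨s', L, _, _, .iteTrue hh he, by omega, by omega, hq⟩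
  · obtain ⟨s', L, w₁, t₁, he, h1, h2, hq⟩ := h' hh
    exact ⟨s', L, _, _, .iteFalse hh he, by omega, by omega, hq⟩

/-- Loops with an invariant `I`, indexed by the number of iterations performed and referring to the
output so far; `N` bounds the number of iterations. -/
theorem Runs.loop {b : BExp} {c : Cmd} {N cb w t : ℕ} {Q : Store k → Merges k → Prop}
    (I : ℕ → Store k → Merges k → Prop) {s : Store k} (h0 : I 0 s [])
    (hcost : ∀ j s L, I j s L → 1 + b.cost s ≤ cb)
    (hbody : ∀ j s L, I j s L → b.Holds M s →
      j < N ∧ Runs M c s w t fun s' L' => I (j + 1) s' (L ++ L'))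
    (hend : ∀ j s L, I j s L → ¬ b.Holds M s → Q s L) :
    Runs M (.loop b c) s (N * (cb + w) + cb) (N * (cb + t) + cb) Q := by
  have key : ∀ r j s L, r + j = N → I j s L →
      Runs M (.loop b c) s (r * (cb + w) + cb) (r * (cb + t) + cb) fun s' L' => Q s' (L ++ L') := by
    intro r
    induction r with
    | zero =>
      intro j s L hj hI
      have hn : ¬ b.Holds M s := fun hh => by have := (hbody j s L hI hh).1; omega
      refine ⟨s, [], _, _, .loopDone hn, ?_, ?_, ?_⟩
      · have := hcost j s L hI; omega
      · have := hcost j s L hI; omega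
      · simpa using hend j s L hI hn
    | succ r ih =>
      intro j s L hj hI
      have hc := hcost j s L hI
      by_cases hh : b.Holds M s
      · obtain ⟨_, s', L', w₁, t₁, he, h1, h2, hI'⟩ := hbody j s L hI hh
        obtain ⟨s'', L'', w₂, t₂, he', h3, h4, hq⟩ := ih (j + 1) s' (L ++ L') (by omega) hI'
        refine ⟨s'', L' ++ L'', _, _, .loopStep hh he he', ?_, ?_, by simpa using hq⟩
        · rw [add_mul]; omega
        · rw [add_mul]; omega
      · refine ⟨s, [], _, _, .loopDone hh, ?_, ?_, ?_⟩
        · exact hc.trans (Nat.le_add_left _ _)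
        · exact hc.trans (Nat.le_add_left _ _)
        · simpa using hend j s L hI hh
  simpa using key N 0 s [] (by omega) h0

theorem Runs.par {x : ℕ} {e : NExp} {c : Cmd} {s : Store k} {ce w t : ℕ}
    {Q : Store k → Merges k → Prop} (R : ℕ → Store k → Merges k → Prop)
    (hce : 1 + e.cost s ≤ ce)
    (hc : ∀ i < e.eval s, Runs M c { s with nat := write s.nat x 0 i } w t (R i))
    (hQ : ∀ (s' : ℕ → Store k) (L : ℕ → Merges k), (∀ i < e.eval s, R i (s' i) (L i)) →
      Q (s.join (e.eval s) s') ((List.range (e.eval s)).flatMap L)) :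
    Runs M (.par x e c) s (ce + e.eval s * (1 + w)) (ce + t) Q := by
  have hc' : ∀ i, ∃ s' L w' t', i < e.eval s →
      Exec M c { s with nat := write s.nat x 0 i } s' L w' t' ∧ w' ≤ w ∧ t' ≤ t ∧ R i s' L := by
    intro i
    by_cases hi : i < e.eval s
    · obtain ⟨s', L, w', t', h⟩ := hc i hi
      exact ⟨s', L, w', t', fun _ => h⟩
    · exact ⟨s, [], 0, 0, fun h => absurd h hi⟩
  choose s' L w' t' h using hc'
  refine ⟨_, _, _, _, .par (s' := s') (L := L) (w := w') (t := t') fun i hi => (h i hi).1, ?_, ?_,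
    hQ s' L fun i hi => (h i hi).2.2.2⟩
  · have : ∑ i ∈ Finset.range (e.eval s), (1 + w' i) ≤ ∑ i ∈ Finset.range (e.eval s), (1 + w) :=
      Finset.sum_le_sum fun i hi => Nat.add_le_add_left (h i (Finset.mem_range.1 hi)).2.1 _
    rw [Finset.sum_const, Finset.card_range, smul_eq_mul] at this
    omega
  · have : (Finset.range (e.eval s)).sup t' ≤ t :=
      Finset.sup_le fun i hi => (h i (Finset.mem_range.1 hi)).2.2.1
    omega

/-- The entry `0` of an array, used as a variable. -/
abbrev var (a : ℕ) : NExp := .cell a (.const 0)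

/-- `for a < e do c`. -/
def forLoop (a : ℕ) (e : NExp) (c : Cmd) : Cmd :=
  .seq (.setN a (.const 0) (.const 0))
    (.loop (.ltN (var a) e) (.seq c (.setN a (.const 0) (.add (var a) (.const 1)))))

/-- Rule for `forLoop`: `cu` bounds the cost of the elementary steps that handle the counter. -/
theorem Runs.forLoop {a : ℕ} {e : NExp} {c : Cmd} {N cu w t : ℕ} {Q : Store k → Merges k → Prop}
    (I : ℕ → Store k → Merges k → Prop) {s : Store k}
    (h0 : I 0 { s with nat := write s.nat a 0 0 } [])
    (hcu : ∀ j ≤ N, 20 + 5 * j.size ≤ cu)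
    (hI : ∀ j ≤ N, ∀ s L, I j s L → s.nat a 0 = j ∧ e.eval s = N ∧ e.cost s + 10 + 2 * j.size ≤ cu)
    (hbody : ∀ j s L, j < N → I j s L → Runs M c s w t fun s' L' => s'.nat a 0 = j ∧
      I (j + 1) { s' with nat := write s'.nat a 0 (j + 1) } (L ++ L'))
    (hend : ∀ s L, I N s L → Q s L) :
    Runs M (forLoop a e c) s (N * (2 * cu + w) + 2 * cu) (N * (2 * cu + t) + 2 * cu) Q := by
  unfold HAC.forLoop
  have hcu0 := hcu 0 (Nat.zero_le _)
  refine Runs.mono (w := cu + (N * (cu + (w + cu)) + cu)) (t := cu + (N * (cu + (t + cu)) + cu))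
    (Runs.seq ?_) ?_ ?_ fun _ _ h => h
  · refine Runs.setN ?_ ?_ ?_
    · simp [NExp.cost]; omega
    · simp [NExp.cost]; omega
    · refine Runs.loop (fun j s L => I j s L ∧ j ≤ N) ⟨h0, Nat.zero_le _⟩ ?_ ?_ ?_
      · rintro j s L ⟨h, hj⟩
        obtain ⟨h1, h2, h3⟩ := hI j hj s L h
        simp [BExp.cost, NExp.cost, NExp.eval, h1]; omega
      · rintro j s L ⟨h, hj⟩ hb
        obtain ⟨h1, h2, h3⟩ := hI j hj s L h
        have hjN : j < N := by simpa [BExp.Holds, NExp.eval, h1, h2] using hb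
        refine ⟨hjN, Runs.seq ((hbody j s L hjN h).mono le_rfl le_rfl ?_)⟩
        rintro s' L' ⟨h4, h5⟩
        have c1 := hcu j hj
        have c2 := hcu (j + 1) hjN
        have e1 : Nat.size 1 = 1 := by simp
        refine Runs.setN ?_ ?_ ?_
        · simp [NExp.cost, NExp.eval, h4, e1]; omega
        · simp [NExp.cost, NExp.eval, h4, e1]; omega
        · simpa [NExp.eval, h4] using ⟨h5, hjN⟩
      · rintro j s L ⟨h, hj⟩ hb
        obtain ⟨h1, h2, h3⟩ := hI j hj s L h
        have : j = N := le_antisymm hj (by simpa [BExp.Holds, NExp.eval, h1, h2] using hb)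
        exact hend s L (this ▸ h)
  · nlinarith
  · nlinarith

theorem joinCell_of_forall {β : Type} {m : ℕ} {v : β} {v' : ℕ → β} (h : ∀ i < m, v' i = v) :
    joinCell m v v' = v := by
  unfold joinCell
  rw [dif_neg]
  rintro ⟨i, hi, hn⟩
  exact hn (h i hi)

open scoped Classical in
theorem joinCell_of_unique {β : Type} {m : ℕ} {v : β} {v' : ℕ → β} {b : ℕ} (hb : b < m)
    (h : ∀ i < m, i ≠ b → v' i = v) : joinCell m v v' = v' b := by
  by_cases hv : v' b = v
  · rw [hv]
    exact joinCell_of_forall fun i hi => if hib : i = b then hib ▸ hv else h i hi hib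
  · unfold joinCell
    have hex : ∃ i, i < m ∧ v' i ≠ v := ⟨b, hb, hv⟩
    rw [dif_pos hex]
    have := Nat.find_spec hex
    by_contra hne
    exact this.2 (h _ this.1 fun he => hne (congrArg v' he))

open scoped Classical in
theorem joinCell_congr {β : Type} {m : ℕ} {v : β} {v' w' : ℕ → β} (h : ∀ i < m, v' i = w' i) :
    joinCell m v v' = joinCell m v w' := by
  unfold joinCell
  have hiff : ∀ i, (i < m ∧ v' i ≠ v) ↔ (i < m ∧ w' i ≠ v) := fun i =>
    and_congr_right fun hi => by rw [h i hi]
  by_cases hex : ∃ i, i < m ∧ v' i ≠ v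
  · have hex' : ∃ i, i < m ∧ w' i ≠ v := by simpa only [hiff] using hex
    rw [dif_pos hex, dif_pos hex', h _ (Nat.find_spec hex).1, Nat.find_congr' fun {i} => hiff i]
  · rw [dif_neg hex, dif_neg (by simpa only [hiff] using hex)]

open scoped Classical in
theorem joinCell_mem {β : Type} (m : ℕ) (v : β) (v' : ℕ → β) :
    joinCell m v v' = v ∨ ∃ i < m, joinCell m v v' = v' i := by
  unfold joinCell
  split_ifs with hex
  · exact .inr ⟨_, (Nat.find_spec hex).1, rfl⟩
  · exact .inl rfl

end Logic

open scoped Classical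

section Paths

variable {k : ℕ}

/-! ### Distances along a bounce-back path -/

/-- The properties of a linkage function that the analysis of one phase uses.  In contrast to
well-behavedness they do not depend on the unit of scale. -/
structure Metricish (K : ℕ) (d : Linkage k) : Prop where
  symm : ∀ A B : Cluster k, A.Nonempty → B.Nonempty → d A B = d B A
  nonneg : ∀ A B : Cluster k, A.Nonempty → B.Nonempty → 0 ≤ d A B
  tri : ∀ A B C : Cluster k, A.Nonempty → B.Nonempty → C.Nonempty →
    min A.card C.card ≤ B.card → d A C ≤ K * (d A B + d B C)
  stable : ∀ A B : Cluster k, A.Nonempty → B.Nonempty → Disjoint A B → d (A ∪ B) A ≤ d A B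
  pack : Packable K d

theorem WellBehaved.metricish {K : ℕ} {d : Linkage k} {δ : ℝ} (hδ : 0 < δ)
    (h : WellBehaved K fun A B => d A B / δ) : Metricish K d where
  symm A B hA hB := by
    have := (h.isLinkage A B hA hB).1
    field_simp at this
    exact this
  nonneg A B hA hB := by
    have : 0 ≤ d A B / δ := (h.isLinkage A B hA hB).2
    rwa [le_div_iff₀ hδ, zero_mul] at this
  tri A B C hA hB hC hm := by
    have := h.approxTriangle A B C hA hB hC hm
    rw [← add_div, ← mul_div_assoc, div_le_div_iff_of_pos_right hδ] at this
    exact this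
  stable A B hA hB hd := by
    have h1 := h.weightStable A B hA hB hd
    rw [← mul_div_assoc, div_le_div_iff_of_pos_right hδ] at h1
    have h2 : 0 ≤ d A B := by
      have : 0 ≤ d A B / δ := (h.isLinkage A B hA hB).2
      rwa [le_div_iff₀ hδ, zero_mul] at this
    refine h1.trans (mul_le_of_le_one_left h2 ?_)
    apply div_le_one_of_le₀ <;> [simp; positivity]
  pack n 𝒞 A r R h1 h2 h3 h4 h5 h6 := by
    have := h.packable n 𝒞 A (r / δ) (R / δ) h1 h2 h3 (by positivity)
      (fun B hB C hC hne => by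
        have := h5 B hB C hC hne
        gcongr) (by gcongr)
    rw [div_div_div_cancel_right₀ hδ.ne'] at this
    have hb : ball (fun A B => d A B / δ) 𝒞 A (R / δ) = ball d 𝒞 A R := by
      ext C
      simp [ball, div_le_div_iff_of_pos_right hδ]
    rwa [hb] at this

/-- The cluster of slot `i` after the clusters of the slots `π` have been merged into it. -/
def acc (σ : ℕ → Cluster k) (i : ℕ) (π : List ℕ) : Cluster k :=
  (π.map σ).foldl (· ∪ ·) (σ i)

@[simp] theorem acc_nil (σ : ℕ → Cluster k) (i : ℕ) : acc σ i [] = σ i := rfl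

theorem acc_snoc (σ : ℕ → Cluster k) (i : ℕ) (π : List ℕ) (b : ℕ) :
    acc σ i (π ++ [b]) = acc σ i π ∪ σ b := by
  simp [acc]

theorem acc_take_succ (σ : ℕ → Cluster k) (i : ℕ) (π : List ℕ) {t : ℕ} (ht : t < π.length) :
    acc σ i (π.take (t + 1)) = acc σ i (π.take t) ∪ σ π[t] := by
  rw [List.take_succ_eq_append_getElem ht, acc_snoc]

theorem mem_acc {σ : ℕ → Cluster k} {i : ℕ} {π : List ℕ} {x : Pt k} :
    x ∈ acc σ i π ↔ x ∈ σ i ∨ ∃ b ∈ π, x ∈ σ b := by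
  induction π using List.reverseRecOn with
  | nil => simp
  | append_singleton π b ih =>
    rw [acc_snoc, Finset.mem_union, ih]
    simp only [List.mem_append, List.mem_singleton]
    constructor
    · rintro ((h | ⟨b', h, h'⟩) | h)
      · exact .inl h
      · exact .inr ⟨b', .inl h, h'⟩
      · exact .inr ⟨b, .inr rfl, h⟩
    · rintro (h | ⟨b', h | rfl, h'⟩)
      · exact .inl (.inl h)
      · exact .inl (.inr ⟨b', h, h'⟩)
      · exact .inr h'

theorem subset_acc (σ : ℕ → Cluster k) (i : ℕ) (π : List ℕ) : σ i ⊆ acc σ i π :=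
  fun _ hx => mem_acc.2 (.inl hx)

/-- Distances between the stages of a growing cluster.  Combining stages in the way of a binary
tree loses a factor `2K` only a logarithmic number of times; the middle stage is never the smallest
cluster. -/
theorem Metricish.chain {K : ℕ} {d : Linkage k} (hd : Metricish K d) (hK : 1 ≤ K)
    {A B : ℕ → Cluster k} {l : ℕ} {D : ℝ} (hA : (A 0).Nonempty) (hB : ∀ t < l, (B t).Nonempty)
    (hdisj : ∀ t < l, Disjoint (A t) (B t)) (hstep : ∀ t < l, A (t + 1) = A t ∪ B t)
    (hD : ∀ t < l, d (A t) (B t) ≤ D) :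
    ∀ r s m, 1 ≤ m → m ≤ 2 ^ r → s + m ≤ l → d (A s) (A (s + m)) ≤ (2 * K : ℝ) ^ r * D := by
  have hmono : ∀ t m, t + m ≤ l → A t ⊆ A (t + m) := by
    intro t m
    induction m with
    | zero => intro _; simp
    | succ m ih =>
      intro h
      rw [← add_assoc, hstep (t + m) (by omega)]
      exact (ih (by omega)).trans Finset.subset_union_left
  have hne : ∀ t ≤ l, (A t).Nonempty := fun t ht => by
    have := hmono 0 t (by omega)
    rw [zero_add] at this
    exact hA.mono this
  have hK' : (1 : ℝ) ≤ K := by exact_mod_cast hK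
  intro r
  induction r with
  | zero =>
    intro s m h1 h2 h3
    obtain rfl : m = 1 := by simp at h2; omega
    rw [hstep s (by omega), hd.symm _ _ (hne s (by omega))
      ((hne s (by omega)).mono Finset.subset_union_left)]
    have := hD s (by omega)
    have := hd.stable _ _ (hne s (by omega)) (hB s (by omega)) (hdisj s (by omega))
    simpa using by linarith
  | succ r ih =>
    intro s m h1 h2 h3
    have hD0 : 0 ≤ D := (hd.nonneg _ _ (hne s (by omega)) (hB s (by omega))).trans (hD s (by omega))
    have hp : 0 ≤ (2 * K : ℝ) ^ r * D := by positivity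
    by_cases hm : m ≤ 2 ^ r
    · refine (ih s m h1 hm h3).trans ?_
      rw [pow_succ]
      nlinarith
    · obtain ⟨m', rfl⟩ : ∃ m', m = 2 ^ r + m' := ⟨m - 2 ^ r, by omega⟩
      have h2r : 1 ≤ 2 ^ r := Nat.one_le_two_pow
      have e1 := ih s (2 ^ r) h2r le_rfl (by omega)
      have e2 := ih (s + 2 ^ r) m' (by omega) (by rw [pow_succ] at h2; omega) (by omega)
      have e3 := hd.tri (A s) (A (s + 2 ^ r)) (A (s + (2 ^ r + m'))) (hne _ (by omega))
        (hne _ (by omega)) (hne _ (by omega))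
        ((min_le_left _ _).trans (Finset.card_le_card (hmono _ _ (by omega))))
      rw [add_assoc] at e2
      rw [pow_succ]
      nlinarith

/-- The number `r` of levels of the binary tree in `Metricish.chain`, for a path of length `l`, and
the resulting loss. -/
theorem exists_pow_le {K ℓ l : ℕ} (hl : l ≤ ℓ) (hℓ : 1 ≤ ℓ) :
    ∃ r, l ≤ 2 ^ r ∧ (2 * K : ℝ) ^ r ≤ (2 * ℓ : ℝ) ^ (2 * K) := by
  refine ⟨Nat.log 2 ℓ + 1, hl.trans (Nat.lt_pow_succ_log_self one_lt_two ℓ).le, ?_⟩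
  have h1 : 2 ^ (Nat.log 2 ℓ + 1) ≤ 2 * ℓ := by
    have := Nat.pow_log_le_self 2 (x := ℓ) (by omega)
    rw [pow_succ]; omega
  have h2 : (2 * K) ^ (Nat.log 2 ℓ + 1) ≤ (2 * ℓ) ^ (2 * K) := calc
    (2 * K) ^ (Nat.log 2 ℓ + 1) ≤ (2 ^ (2 * K)) ^ (Nat.log 2 ℓ + 1) :=
      Nat.pow_le_pow_left Nat.lt_two_pow_self.le _
    _ = (2 ^ (Nat.log 2 ℓ + 1)) ^ (2 * K) := by rw [← pow_mul, ← pow_mul, mul_comm]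
    _ ≤ _ := Nat.pow_le_pow_left h1 _
  exact_mod_cast h2

/-- Slots hold pairwise disjoint clusters, and the slots from `n` on are free. -/
structure Slots (n : ℕ) (σ : ℕ → Cluster k) : Prop where
  disj : ∀ i j, i ≠ j → Disjoint (σ i) (σ j)
  free : ∀ i, n ≤ i → σ i = ∅

theorem Slots.inj {n : ℕ} {σ : ℕ → Cluster k} (h : Slots n σ) {i j : ℕ} (hi : σ i ≠ ∅)
    (he : σ i = σ j) : i = j := by
  by_contra hne
  have := h.disj i j hne
  rw [← he, disjoint_self] at this
  exact hi this

theorem Slots.lt {n : ℕ} {σ : ℕ → Cluster k} (h : Slots n σ) {j : ℕ} (hj : σ j ≠ ∅) : j < n := by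
  by_contra hh
  exact hj (h.free j (by omega))

theorem Slots.finite {n : ℕ} {σ : ℕ → Cluster k} (h : Slots n σ) : {j | σ j ≠ ∅}.Finite :=
  (Set.finite_lt_nat n).subset fun _ hj => h.lt hj

/-- The path of slots `π` describes how the cluster in slot `i` grows: each slot of the path holds a
nearest cluster among those not used yet, the first one is nearer than `θ₁`, the other ones are
nearer than `θ`. -/
structure IsPath (d : Linkage k) (θ₁ θ : ℝ) (σ : ℕ → Cluster k) (i : ℕ) (π : List ℕ) : Prop where
  nodup : π.Nodup
  mem : ∀ b ∈ π, b ≠ i ∧ σ b ≠ ∅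
  near : ∀ t (ht : t < π.length), ∀ j, j ≠ i → j ∉ π.take t → σ j ≠ ∅ →
    d (acc σ i (π.take t)) (σ π[t]) ≤ d (acc σ i (π.take t)) (σ j)
  below : ∀ t (ht : t < π.length),
    d (acc σ i (π.take t)) (σ π[t]) < if t = 0 then θ₁ else θ

theorem IsPath.nil (d : Linkage k) (θ₁ θ : ℝ) (σ : ℕ → Cluster k) (i : ℕ) :
    IsPath d θ₁ θ σ i [] where
  nodup := by simp
  mem := by simp
  near t ht := by simp at ht
  below t ht := by simp at ht

theorem IsPath.snoc {d : Linkage k} {θ₁ θ : ℝ} {σ : ℕ → Cluster k} {i b : ℕ} {π : List ℕ}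
    (h : IsPath d θ₁ θ σ i π) (hb : b ∉ π) (hbi : b ≠ i) (hσ : σ b ≠ ∅)
    (hnear : ∀ j, j ≠ i → j ∉ π → σ j ≠ ∅ → d (acc σ i π) (σ b) ≤ d (acc σ i π) (σ j))
    (hbelow : d (acc σ i π) (σ b) < if π.length = 0 then θ₁ else θ) :
    IsPath d θ₁ θ σ i (π ++ [b]) where
  nodup := by
    rw [List.nodup_append]
    refine ⟨h.nodup, by simp, ?_⟩
    rintro x hx y hy rfl
    simp only [List.mem_singleton] at hy
    exact hb (hy ▸ hx)
  mem c hc := by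
    rcases List.mem_append.1 hc with hc | hc
    · exact h.mem c hc
    · rw [List.mem_singleton.1 hc]; exact ⟨hbi, hσ⟩
  near t ht j h1 h2 h3 := by
    by_cases htl : t < π.length
    · rw [List.take_append_of_le_length htl.le] at h2 ⊢
      rw [List.getElem_append_left htl]
      exact h.near t htl j h1 h2 h3
    · obtain rfl : t = π.length := by simp at ht; omega
      simp only [List.take_left'] at h2 ⊢
      simpa using hnear j h1 h2 h3
  below t ht := by
    by_cases htl : t < π.length
    · rw [List.take_append_of_le_length htl.le, List.getElem_append_left htl]
      exact h.below t htl
    · obtain rfl : t = π.length := by simp at ht; omega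
      simpa using hbelow

theorem IsPath.not_mem_take {d : Linkage k} {θ₁ θ : ℝ} {σ : ℕ → Cluster k} {i : ℕ} {π : List ℕ}
    (h : IsPath d θ₁ θ σ i π) {t : ℕ} (ht : t < π.length) : π[t] ∉ π.take t := by
  intro hm
  obtain ⟨j, hj, hje⟩ := List.mem_take_iff_getElem.1 hm
  have := (List.Nodup.getElem_inj_iff h.nodup).1 hje
  omega

theorem IsPath.disjoint_acc {d : Linkage k} {θ₁ θ : ℝ} {σ : ℕ → Cluster k} {i n : ℕ} {π : List ℕ}
    (h : IsPath d θ₁ θ σ i π) (hs : Slots n σ) {t : ℕ} (ht : t < π.length) :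
    Disjoint (acc σ i (π.take t)) (σ π[t]) := by
  rw [Finset.disjoint_left]
  intro x hx hx'
  rcases mem_acc.1 hx with h1 | ⟨b, hb, h1⟩
  · exact Finset.disjoint_left.1 (hs.disj i π[t] (h.mem _ (List.getElem_mem ht)).1.symm) h1 hx'
  · refine Finset.disjoint_left.1 (hs.disj b π[t] ?_) h1 hx'
    rintro rfl
    exact h.not_mem_take ht hb

section Radii

variable {K ℓ n E : ℕ} {d : Linkage k} {θ₁ θ : ℝ} {σ : ℕ → Cluster k} {i : ℕ} {π : List ℕ}

/-- A bound for the distances from a cluster to the later stages of its bounce-back path. -/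
def pathRadius (K E ℓ : ℕ) (θ : ℝ) : ℝ := (2 * ℓ : ℝ) ^ (2 * K) * (E * θ)

theorem le_pathRadius (hℓ : 1 ≤ ℓ) (hθ : 0 ≤ θ) : E * θ ≤ pathRadius K E ℓ θ := by
  refine le_mul_of_one_le_left (by positivity) (one_le_pow₀ ?_)
  have : (1 : ℝ) ≤ ℓ := by exact_mod_cast hℓ
  linarith

variable (hd : Metricish K d) (hK : 1 ≤ K) (hs : Slots n σ) (h : IsPath d θ₁ θ σ i π)
  (hi : σ i ≠ ∅) (hθ : 0 ≤ θ) (hE : 1 ≤ E) (hθ₁ : θ₁ ≤ E * θ) (hl : π.length ≤ ℓ) (hℓ : 1 ≤ ℓ)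

include h hθ hE hθ₁ in
theorem IsPath.below' {t : ℕ} (ht : t < π.length) :
    d (acc σ i (π.take t)) (σ π[t]) ≤ E * θ := by
  refine (h.below t ht).le.trans ?_
  have : (1 : ℝ) ≤ E := by exact_mod_cast hE
  split_ifs
  · exact hθ₁
  · nlinarith

include hd hK hs h hi hθ hE hθ₁ hl hℓ in
theorem IsPath.dist_acc {t : ℕ} (ht : t ≤ π.length) :
    acc σ i (π.take t) = σ i ∨ d (σ i) (acc σ i (π.take t)) ≤ pathRadius K E ℓ θ := by
  rcases Nat.eq_zero_or_pos t with rfl | htp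
  · simp
  right
  obtain ⟨r, hr, hr'⟩ := exists_pow_le (ht.trans hl) hℓ
  have := hd.chain hK (A := fun t => acc σ i (π.take t)) (B := fun t => σ (π.getD t 0))
    (l := π.length) (D := E * θ) (by simpa [Finset.nonempty_iff_ne_empty] using hi)
    (fun t ht => by
      rw [Finset.nonempty_iff_ne_empty, List.getD_eq_getElem _ _ ht]
      exact (h.mem _ (List.getElem_mem ht)).2)
    (fun t ht => by
      rw [List.getD_eq_getElem _ _ ht]
      exact h.disjoint_acc hs ht)
    (fun t ht => by
      rw [List.getD_eq_getElem _ _ ht]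
      exact acc_take_succ σ i π ht)
    (fun t ht => by
      rw [List.getD_eq_getElem _ _ ht]
      exact h.below' hθ hE hθ₁ ht) r 0 t htp hr (by omega)
  simp only [List.take_zero, acc_nil, zero_add] at this
  exact this.trans (mul_le_mul_of_nonneg_right hr' (by positivity))

include hd hK hs h hi hθ hE hθ₁ hl hℓ in
theorem IsPath.dist_mem {b : ℕ} (hb : b ∈ π) : d (σ i) (σ b) ≤ 2 * K * pathRadius K E ℓ θ := by
  obtain ⟨t, ht, rfl⟩ := List.getElem_of_mem hb
  have hbn : (σ π[t]).Nonempty := Finset.nonempty_iff_ne_empty.2 (h.mem _ hb).2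
  have hin : (σ i).Nonempty := Finset.nonempty_iff_ne_empty.2 hi
  have hE' := le_pathRadius (K := K) (E := E) hℓ hθ
  have hK' : (1 : ℝ) ≤ K := by exact_mod_cast hK
  have hP : 0 ≤ pathRadius K E ℓ θ := (by positivity : (0 : ℝ) ≤ E * θ).trans hE'
  have hat : (acc σ i (π.take t)).Nonempty := hin.mono (subset_acc _ _ _)
  have h1 : d (acc σ i (π.take (t + 1))) (σ π[t]) ≤ E * θ := by
    rw [acc_take_succ σ i π ht, Finset.union_comm]
    refine (hd.stable _ _ hbn hat (h.disjoint_acc hs ht).symm).trans ?_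
    rw [hd.symm _ _ hbn hat]
    exact h.below' hθ hE hθ₁ ht
  rcases h.dist_acc hd hK hs hi hθ hE hθ₁ hl hℓ (t := t + 1) ht with h2 | h2
  · rw [h2] at h1
    nlinarith
  · have := hd.tri (σ i) (acc σ i (π.take (t + 1))) (σ π[t]) hin (hin.mono (subset_acc _ _ _)) hbn
      ((min_le_left _ _).trans (Finset.card_le_card (subset_acc _ _ _)))
    nlinarith

/-- If later stages `A'`, `B'` of the clusters `A`, `B` are close, then so are `A` and `B`. -/
theorem Metricish.dist_of_stages {P : ℝ} (hd : Metricish K d) (hK : 1 ≤ K) {A A' B B' : Cluster k}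
    (hA : A.Nonempty) (hB : B.Nonempty) (hAA : A ⊆ A') (hBB : B ⊆ B') (hP : 0 ≤ P)
    (h1 : A' = A ∨ d A A' ≤ P) (h2 : B' = B ∨ d B B' ≤ P) {D : ℝ} (hD : 0 ≤ D)
    (h3 : d A' B' ≤ D) : d A B ≤ K * (K * (P + D) + P) := by
  have hK' : (1 : ℝ) ≤ K := by exact_mod_cast hK
  have h4 : d A B' ≤ K * (P + D) := by
    rcases h1 with rfl | h1
    · nlinarith
    · have := hd.tri A A' B' hA (hA.mono hAA) (hB.mono hBB)
        ((min_le_left _ _).trans (Finset.card_le_card hAA))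
      nlinarith
  have h5 : 0 ≤ (K : ℝ) * (P + D) := by positivity
  rcases h2 with rfl | h2
  · nlinarith
  · have := hd.tri A B' B hA (hB.mono hBB) hB
      ((min_le_right _ _).trans (Finset.card_le_card hBB))
    rw [hd.symm B' B (hB.mono hBB) hB] at this
    nlinarith

end Radii

end Paths

section Reachability

variable {k n : ℕ} {d : Linkage k} {c : ℝ} {p : Fin n → Pt k}

/-! ### Clusterings held in slots -/

/-- The clustering that the first `n` slots hold. -/
def cl (n : ℕ) (σ : ℕ → Cluster k) : Finset (Cluster k) := ((Finset.range n).image σ).erase ∅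

theorem Slots.mem_cl {σ : ℕ → Cluster k} (h : Slots n σ) {X : Cluster k} :
    X ∈ cl n σ ↔ ∃ j, σ j = X ∧ σ j ≠ ∅ := by
  simp only [cl, Finset.mem_erase, Finset.mem_image, Finset.mem_range]
  constructor
  · rintro ⟨h1, j, _, rfl⟩
    exact ⟨j, rfl, h1⟩
  · rintro ⟨j, rfl, h1⟩
    refine ⟨h1, j, ?_, rfl⟩
    by_contra hj
    exact h1 (h.free j (by omega))

/-- The slots after the cluster of slot `j` has been merged into slot `i`. -/
def mergeSlots (σ : ℕ → Cluster k) (i j : ℕ) : ℕ → Cluster k :=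
  Function.update (Function.update σ i (σ i ∪ σ j)) j ∅

theorem mergeSlots_apply {σ : ℕ → Cluster k} {i j : ℕ} (a : ℕ) :
    mergeSlots σ i j a = if a = j then ∅ else if a = i then σ i ∪ σ j else σ a := by
  simp only [mergeSlots, Function.update_apply]

theorem Slots.merge {σ : ℕ → Cluster k} (h : Slots n σ) {i j : ℕ} (hi : σ i ≠ ∅) :
    Slots n (mergeSlots σ i j) where
  disj a b hab := by
    simp only [mergeSlots_apply]
    split_ifs with h1 h2 h3 h4 h5 h6
    · simp
    · simp
    · simp
    · simp
    · exact absurd (h4.trans h6.symm) hab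
    · exact Finset.disjoint_union_left.2
        ⟨h.disj i b (fun he => h6 he.symm), h.disj j b (fun he => h5 he.symm)⟩
    · simp
    · exact Finset.disjoint_union_right.2 ⟨h.disj a i h4, h.disj a j h1⟩
    · exact h.disj a b hab
  free a ha := by
    have : a ≠ i := fun he => hi (h.free i (he ▸ ha))
    simp [mergeSlots_apply, this, h.free a ha]

theorem Slots.cl_merge {σ : ℕ → Cluster k} (h : Slots n σ) {i j : ℕ} (hij : i ≠ j) (hi : σ i ≠ ∅) :
    cl n (mergeSlots σ i j) = mergeIn (cl n σ) (σ i) (σ j) := by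
  ext X
  rw [(h.merge hi).mem_cl]
  simp only [mergeIn, Finset.mem_insert, Finset.mem_erase, h.mem_cl, mergeSlots_apply]
  constructor
  · rintro ⟨a, rfl, ha⟩
    split_ifs at ha ⊢ with h1 h2
    · simp at ha
    · exact .inl rfl
    · exact .inr ⟨fun he => h1 (h.inj ha he), fun he => h2 (h.inj ha he), a, rfl, ha⟩
  · rintro (rfl | ⟨h1, h2, a, rfl, ha⟩)
    · refine ⟨i, by simp [hij], ?_⟩
      simp only [hij, if_false, if_true]
      exact fun he => hi (Finset.union_eq_empty.1 he).1
    · have haj : a ≠ j := fun he => h1 (he ▸ rfl)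
      have hai : a ≠ i := fun he => h2 (he ▸ rfl)
      exact ⟨a, by simp [haj, hai], by simpa [haj, hai] using ha⟩

theorem Slots.card_cl_merge {σ : ℕ → Cluster k} (h : Slots n σ) {i j : ℕ} (hij : i ≠ j)
    (hi : σ i ≠ ∅) (hj : σ j ≠ ∅) : (cl n (mergeSlots σ i j)).card + 1 = (cl n σ).card := by
  have hne : σ i ≠ σ j := fun he => hij (h.inj hi he)
  have hiC : σ i ∈ cl n σ := h.mem_cl.2 ⟨i, rfl, hi⟩
  have hjC : σ j ∈ (cl n σ).erase (σ i) := Finset.mem_erase.2 ⟨hne.symm, h.mem_cl.2 ⟨j, rfl, hj⟩⟩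
  rw [h.cl_merge hij hi, mergeIn, Finset.card_insert_of_notMem, Finset.card_erase_add_one hjC,
    Finset.card_erase_of_mem hiC]
  · have := Finset.card_pos.2 ⟨_, hiC⟩
    omega
  · simp only [Finset.mem_erase, h.mem_cl]
    rintro ⟨-, -, a, ha, -⟩
    obtain ⟨x, hx⟩ := Finset.nonempty_iff_ne_empty.2 hi
    obtain ⟨y, hy⟩ := Finset.nonempty_iff_ne_empty.2 hj
    have hai : a = i := by
      by_contra hne
      exact Finset.disjoint_left.1 (h.disj a i hne) (ha ▸ Finset.mem_union_left _ hx) hx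
    have haj : a = j := by
      by_contra hne
      exact Finset.disjoint_left.1 (h.disj a j hne) (ha ▸ Finset.mem_union_right _ hy) hy
    exact hij (hai ▸ haj)

/-! ### Reachable clusterings -/

theorem isApproxMerges_append {𝒞 : Finset (Cluster k)} {L L' : Merges k} :
    IsApproxMerges d c 𝒞 (L ++ L') ↔
      IsApproxMerges d c 𝒞 L ∧ IsApproxMerges d c (after 𝒞 L) L' := by
  induction L generalizing 𝒞 with
  | nil => simp [IsApproxMerges, after]
  | cons m L ih => obtain ⟨A, B⟩ := m; simp [IsApproxMerges, after, ih, and_assoc]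

theorem after_append {𝒞 : Finset (Cluster k)} {L L' : Merges k} :
    after 𝒞 (L ++ L') = after (after 𝒞 L) L' := by
  induction L generalizing 𝒞 with
  | nil => simp [after]
  | cons m L ih => obtain ⟨A, B⟩ := m; simp [after, ih]

theorem leafDepth_append (L L' : Merges k) (x : Pt k) :
    leafDepth (L ++ L') x = leafDepth L x + leafDepth L' x := by
  simp [leafDepth, List.countP_append]

/-- The legal merges `L` lead from the singletons to the clustering in the slots `σ`. -/
structure Reach (d : Linkage k) (c : ℝ) (p : Fin n → Pt k) (L : Merges k)
    (σ : ℕ → Cluster k) : Prop where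
  legal : IsApproxMerges d c (singletons p) L
  after_eq : after (singletons p) L = cl n σ
  slots : Slots n σ
  sub : ∀ j, σ j ⊆ Finset.univ.image p
  card : L.length + (cl n σ).card = n

theorem Reach.merge {L : Merges k} {σ : ℕ → Cluster k} (h : Reach d c p L σ) {i j : ℕ}
    (hij : i ≠ j) (hi : σ i ≠ ∅) (hj : σ j ≠ ∅)
    (hmin : ∀ a b, a ≠ b → σ a ≠ ∅ → σ b ≠ ∅ → d (σ i) (σ j) ≤ c * d (σ a) (σ b)) :
    Reach d c p (L ++ [(σ i, σ j)]) (mergeSlots σ i j) where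
  legal := by
    rw [isApproxMerges_append, h.after_eq]
    refine ⟨h.legal, ⟨h.slots.mem_cl.2 ⟨i, rfl, hi⟩, h.slots.mem_cl.2 ⟨j, rfl, hj⟩,
      fun he => hij (h.slots.inj hi he), ?_⟩, trivial⟩
    intro X hX Y hY hne
    obtain ⟨a, rfl, ha⟩ := h.slots.mem_cl.1 hX
    obtain ⟨b, rfl, hb⟩ := h.slots.mem_cl.1 hY
    exact hmin a b (fun he => hne (he ▸ rfl)) ha hb
  after_eq := by
    rw [after_append, h.after_eq, h.slots.cl_merge hij hi]
    rfl
  slots := h.slots.merge hi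
  sub a := by
    rw [mergeSlots_apply]
    split_ifs
    · simp
    · exact Finset.union_subset (h.sub i) (h.sub j)
    · exact h.sub a
  card := by
    have := h.slots.card_cl_merge hij hi hj
    have := h.card
    simp only [List.length_append, List.length_singleton]
    omega

/-- The singleton clusters in the first `n` slots. -/
def initSlots (p : Fin n → Pt k) (i : ℕ) : Cluster k := if hi : i < n then {p ⟨i, hi⟩} else ∅

theorem Reach.init (d : Linkage k) (c : ℝ) (hp : Function.Injective p) :
    Reach d c p [] (initSlots p) := by
  have hs : Slots n (initSlots p) := by
    constructor
    · intro i j hij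
      unfold initSlots
      split_ifs <;> simp
      exact fun he => hij (by simpa using hp he)
    · intro i hi
      simp [initSlots, not_lt.2 hi]
  have hcl : singletons p = cl n (initSlots p) := by
    ext X
    rw [hs.mem_cl]
    simp only [singletons, Finset.mem_image, Finset.mem_univ, true_and]
    constructor
    · rintro ⟨i, rfl⟩
      exact ⟨i, by simp [initSlots], by simp [initSlots]⟩
    · rintro ⟨j, rfl, hj⟩
      by_cases h : j < n
      · exact ⟨⟨j, h⟩, by simp [initSlots, h]⟩
      · simp [initSlots, h] at hj
  refine ⟨trivial, hcl, hs, ?_, ?_⟩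
  · intro j
    unfold initSlots
    split_ifs <;> simp
  · rw [← hcl, singletons, Finset.card_image_of_injective]
    · simp
    · intro i j hij
      exact hp (by simpa using hij)

/-- Any sequence of legal merges can be completed. -/
theorem Reach.exists_hac {K : ℕ} (hd : Metricish K d) (hc : 1 ≤ c) (hn : 1 ≤ n) {L : Merges k}
    {σ : ℕ → Cluster k} (h : Reach d c p L σ) : ∃ L', IsApproxHAC d c p (L ++ L') := by
  induction hm : (cl n σ).card using Nat.strong_induction_on generalizing L σ with
  | _ m ih =>
    subst hm
    let S : Finset (ℕ × ℕ) := (Finset.range n ×ˢ Finset.range n).filter fun a =>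
      a.1 ≠ a.2 ∧ σ a.1 ≠ ∅ ∧ σ a.2 ≠ ∅
    by_cases hS : S.Nonempty
    · obtain ⟨⟨i, j⟩, hmem, hmin⟩ := S.exists_min_image (fun a => d (σ a.1) (σ a.2)) hS
      obtain ⟨-, hij, hi, hj⟩ := Finset.mem_filter.1 hmem
      have hstep := h.merge hij hi hj (by
        intro a b hab ha hb
        have han : a < n := by
          by_contra hh
          exact ha (h.slots.free a (by omega))
        have hbn : b < n := by
          by_contra hh
          exact hb (h.slots.free b (by omega))
        have := hmin (a, b) (Finset.mem_filter.2 ⟨by simp [han, hbn], hab, ha, hb⟩)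
        have h0 := hd.nonneg (σ a) (σ b) (Finset.nonempty_iff_ne_empty.2 ha)
          (Finset.nonempty_iff_ne_empty.2 hb)
        simp only at this
        nlinarith)
      have := h.slots.card_cl_merge hij hi hj
      obtain ⟨L', hL'⟩ := ih _ (by omega) hstep rfl
      exact ⟨[(σ i, σ j)] ++ L', by rwa [← List.append_assoc]⟩
    · refine ⟨[], by simpa using h.legal, ?_⟩
      have h1 : (cl n σ).card ≤ 1 := by
        rw [Finset.card_le_one]
        intro X hX Y hY
        obtain ⟨a, rfl, ha⟩ := h.slots.mem_cl.1 hX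
        obtain ⟨b, rfl, hb⟩ := h.slots.mem_cl.1 hY
        by_contra hne
        refine hS ⟨(a, b), Finset.mem_filter.2 ⟨?_, fun he => hne (congrArg σ he), ha, hb⟩⟩
        simp only [Finset.mem_product, Finset.mem_range]
        constructor
        · by_contra hh
          exact ha (h.slots.free a (by omega))
        · by_contra hh
          exact hb (h.slots.free b (by omega))
      have h2 : 0 < (cl n σ).card := by
        have key : ∀ (L : Merges k) (𝒞 : Finset (Cluster k)), 𝒞.Nonempty → (after 𝒞 L).Nonempty := by
          intro L
          induction L with
          | nil => exact fun _ h => h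
          | cons m L ih => obtain ⟨A, B⟩ := m; exact fun _ _ => ih _ (Finset.insert_nonempty _ _)
        rw [Finset.card_pos, ← h.after_eq]
        exact key _ _ ⟨_, Finset.mem_image_of_mem _ (Finset.mem_univ ⟨0, hn⟩)⟩
      have := h.card
      simp only [List.append_nil]
      omega

theorem Reach.leafDepth_le {K h : ℕ} (hd : Metricish K d) (hc : 1 ≤ c) (hn : 1 ≤ n)
    (hh : ∀ L, IsApproxHAC d c p L → dendrogramHeight p L ≤ h) {L : Merges k}
    {σ : ℕ → Cluster k} (hr : Reach d c p L σ) {j : ℕ} {x : Pt k} (hx : x ∈ σ j) :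
    leafDepth L x ≤ min h n := by
  refine le_min ?_ ?_
  · obtain ⟨L', hL'⟩ := hr.exists_hac hd hc hn
    obtain ⟨i, -, rfl⟩ := Finset.mem_image.1 (hr.sub j hx)
    have h1 : leafDepth (L ++ L') (p i) ≤ dendrogramHeight p (L ++ L') :=
      Finset.le_sup (f := fun i => leafDepth (L ++ L') (p i)) (Finset.mem_univ i)
    rw [leafDepth_append] at h1
    have := hh _ hL'
    omega
  · have h1 : leafDepth L x ≤ L.length := List.countP_le_length
    have := hr.card
    omega

/-- Every two clusters are at distance at least `θ`. -/
def Sep (d : Linkage k) (θ : ℝ) (σ : ℕ → Cluster k) : Prop :=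
  ∀ i j, i ≠ j → σ i ≠ ∅ → σ j ≠ ∅ → θ ≤ d (σ i) (σ j)

/-! ### Paths as bounce-back paths -/

theorem isLocallyOptimal_of_take (Bs : List (Cluster k)) (A : Cluster k) (𝒳 : Finset (Cluster k))
    (hnd : Bs.Nodup) (hmem : ∀ B ∈ Bs, B ∈ 𝒳)
    (hnear : ∀ t (ht : t < Bs.length), ∀ X ∈ 𝒳, X ∉ Bs.take t →
      d ((Bs.take t).foldl (· ∪ ·) A) Bs[t] ≤ d ((Bs.take t).foldl (· ∪ ·) A) X) :
    IsLocallyOptimal d A 𝒳 Bs := by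
  induction Bs generalizing A 𝒳 with
  | nil => trivial
  | cons B Bs ih =>
    rw [List.nodup_cons] at hnd
    refine ⟨hmem B (by simp), fun X hX => hnear 0 (by simp) X hX (by simp),
      ih _ _ hnd.2 ?_ ?_⟩
    · intro B' hB'
      exact Finset.mem_erase.2 ⟨fun he => hnd.1 (he ▸ hB'), hmem B' (by simp [hB'])⟩
    · intro t ht X hX hXt
      obtain ⟨h1, h2⟩ := Finset.mem_erase.1 hX
      exact hnear (t + 1) (by simpa using ht) X h2 (by simp [h1, hXt])

theorem mergesBelow_of_take {θ : ℝ} (Bs : List (Cluster k)) (A : Cluster k)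
    (h : ∀ t (ht : t < Bs.length), d ((Bs.take t).foldl (· ∪ ·) A) Bs[t] < θ) :
    MergesBelow d θ A Bs := by
  induction Bs generalizing A with
  | nil => trivial
  | cons B Bs ih =>
    exact ⟨h 0 (by simp), ih _ fun t ht => h (t + 1) (by simpa using ht)⟩

theorem IsPath.isBounceBackPath {ε θ : ℝ} {σ : ℕ → Cluster k} {i : ℕ} {π : List ℕ}
    (h : IsPath d ((1 + ε) * θ) θ σ i π) (hs : Slots n σ) (hi : σ i ≠ ∅) :
    IsBounceBackPath d ε θ (cl n σ) (σ i) (π.map σ) := by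
  have hinj : ∀ {a b}, σ a ≠ ∅ → σ a = σ b → a = b := fun ha he => hs.inj ha he
  refine ⟨hs.mem_cl.2 ⟨i, rfl, hi⟩, isLocallyOptimal_of_take _ _ _ ?_ ?_ ?_, ?_⟩
  · exact List.Nodup.map_on (fun a ha b _ he => hinj (h.mem a ha).2 he) h.nodup
  · intro B hB
    obtain ⟨b, hb, rfl⟩ := List.mem_map.1 hB
    exact Finset.mem_erase.2 ⟨fun he => (h.mem b hb).1 (hinj (h.mem b hb).2 he),
      hs.mem_cl.2 ⟨b, rfl, (h.mem b hb).2⟩⟩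
  · intro t ht X hX hXt
    obtain ⟨h1, h2⟩ := Finset.mem_erase.1 hX
    obtain ⟨j, rfl, hj⟩ := hs.mem_cl.1 h2
    rw [List.length_map] at ht
    have := h.near t ht j (fun he => h1 (he ▸ rfl)) (fun hm => hXt (by
      rw [← List.map_take]; exact List.mem_map_of_mem hm)) hj
    simpa [acc, List.map_take] using this
  · cases π with
    | nil => trivial
    | cons b π =>
      refine ⟨h.below 0 (by simp), mergesBelow_of_take _ _ ?_⟩
      intro t ht
      rw [List.length_map] at ht
      have := h.below (t + 1) (by simpa using ht)
      rw [acc, List.map_take] at this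
      rw [List.getElem_map]
      exact this

theorem IsPath.length_le {ε θ : ℝ} {ℓ : ℕ} {σ : ℕ → Cluster k} {i : ℕ} {π : List ℕ}
    {L : Merges k} (hℓ : BounceBackLengthLE d ε p ℓ) (hr : Reach d (1 + ε) p L σ) (hθ : 0 < θ)
    (hsep : Sep d θ σ) (h : IsPath d ((1 + ε) * θ) θ σ i π) (hi : σ i ≠ ∅) : π.length ≤ ℓ := by
  have := hℓ L hr.legal θ hθ (by
    rw [hr.after_eq]
    intro X hX Y hY hne
    obtain ⟨a, rfl, ha⟩ := hr.slots.mem_cl.1 hX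
    obtain ⟨b, rfl, hb⟩ := hr.slots.mem_cl.1 hY
    exact hsep a b (fun he => hne (he ▸ rfl)) ha hb) (σ i) (π.map σ)
    (by rw [hr.after_eq]; exact h.isBounceBackPath hr.slots hi)
  simpa using this

/-! ### Performing a path -/

/-- The slots after the clusters of the slots `π` have been merged into slot `i`. -/
def applyPath (σ : ℕ → Cluster k) (i : ℕ) (π : List ℕ) : ℕ → Cluster k := fun j =>
  if j = i then acc σ i π else if j ∈ π then ∅ else σ j

/-- The merges of a path, in order. -/
def pathMerges (σ : ℕ → Cluster k) (i : ℕ) (π : List ℕ) : Merges k :=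
  (List.range π.length).map fun t => (acc σ i (π.take t), σ (π.getD t 0))

@[simp] theorem applyPath_nil (σ : ℕ → Cluster k) (i : ℕ) : applyPath σ i [] = σ := by
  ext1 j
  by_cases h : j = i <;> simp [applyPath, h]

@[simp] theorem pathMerges_nil (σ : ℕ → Cluster k) (i : ℕ) : pathMerges σ i [] = [] := rfl

theorem applyPath_snoc {σ : ℕ → Cluster k} {i b : ℕ} {π : List ℕ} (hb : b ∉ π) (hbi : b ≠ i) :
    applyPath σ i (π ++ [b]) = mergeSlots (applyPath σ i π) i b := by
  ext1 j
  simp only [mergeSlots_apply, applyPath, acc_snoc, List.mem_append, List.mem_singleton]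
  by_cases h1 : j = b
  · subst h1; simp [hbi]
  · by_cases h2 : j = i <;> simp [h1, h2, hb, hbi, hbi.symm]

theorem pathMerges_snoc (σ : ℕ → Cluster k) (i b : ℕ) (π : List ℕ) :
    pathMerges σ i (π ++ [b]) = pathMerges σ i π ++ [(acc σ i π, σ b)] := by
  simp only [pathMerges, List.length_append, List.length_singleton, List.range_succ, List.map_append,
    List.map_cons, List.map_nil]
  congr 1
  · apply List.map_congr_left
    intro t ht
    have ht := List.mem_range.1 ht
    rw [List.take_append_of_le_length ht.le, List.getD_append _ _ _ _ ht]
  · simp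

theorem acc_congr {σ τ : ℕ → Cluster k} {i : ℕ} {π : List ℕ} (hi : τ i = σ i)
    (h : ∀ j ∈ π, τ j = σ j) : acc τ i π = acc σ i π := by
  rw [acc, acc, hi, List.map_congr_left h]

end Reachability

section Stage

variable {k n : ℕ} {d : Linkage k} {c : ℝ} {p : Fin n → Pt k}

/-! ### Non-interfering paths -/

/-- The path `π` of slot `b`, found in the clustering `σ`, is a legal sequence of merges also in the
clustering `τ`, which differs from `σ` by merges that do not interfere with the path. -/
theorem Reach.path {K : ℕ} {θ₁ θ : ℝ} {L : Merges k} {σ τ : ℕ → Cluster k} {b : ℕ} {π : List ℕ}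
    (hd : Metricish K d) (hc : 1 ≤ c) (hθ : 0 < θ) (hθ₁ : θ₁ ≤ c * θ)
    (hr : Reach d c p L τ) (hsep : Sep d θ τ) (hp : IsPath d θ₁ θ σ b π) (hb : τ b = σ b)
    (hσb : σ b ≠ ∅) (hπ : ∀ j ∈ π, τ j = σ j)
    (hother : ∀ j, j ≠ b → j ∉ π → τ j ≠ ∅ → τ j = σ j ∨
      ∀ t ≤ π.length, θ ≤ d (acc σ b (π.take t)) (τ j)) :
    ∀ t ≤ π.length,
      Reach d c p (L ++ pathMerges σ b (π.take t)) (applyPath τ b (π.take t)) := by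
  intro t
  induction t with
  | zero => intro _; simpa using hr
  | succ t ih =>
    intro ht
    have ih := ih (by omega)
    have hmem := hp.mem π[t] (List.getElem_mem ht)
    have hnt := hp.not_mem_take ht
    have hacc : acc τ b (π.take t) = acc σ b (π.take t) :=
      acc_congr hb fun j hj => hπ j (List.mem_of_mem_take hj)
    have hτt : τ π[t] = σ π[t] := hπ _ (List.getElem_mem ht)
    have e1 : applyPath τ b (π.take t) b = acc σ b (π.take t) := by simp [applyPath, hacc]
    have e2 : applyPath τ b (π.take t) π[t] = σ π[t] := by
      simp [applyPath, hmem.1, hnt, hτt]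
    have hane : acc σ b (π.take t) ≠ ∅ := by
      rw [← Finset.nonempty_iff_ne_empty] at hσb ⊢
      exact hσb.mono (subset_acc _ _ _)
    have hbelow := hp.below t ht
    have hlt : d (acc σ b (π.take t)) (σ π[t]) ≤ c * θ := by
      refine hbelow.le.trans ?_
      split_ifs
      · exact hθ₁
      · nlinarith
    -- The pairs that involve the growing cluster.
    have hown : ∀ a, a ≠ b → applyPath τ b (π.take t) a ≠ ∅ →
        d (acc σ b (π.take t)) (σ π[t]) ≤
          c * d (acc σ b (π.take t)) (applyPath τ b (π.take t) a) := by
      intro a hab ha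
      have hat : a ∉ π.take t := by
        intro h
        simp [applyPath, hab, h] at ha
      have hτa : applyPath τ b (π.take t) a = τ a := by simp [applyPath, hab, hat]
      rw [hτa] at ha ⊢
      have hfar : θ ≤ d (acc σ b (π.take t)) (τ a) →
          d (acc σ b (π.take t)) (σ π[t]) ≤ c * d (acc σ b (π.take t)) (τ a) := fun h => by
        nlinarith
      have hnear : τ a = σ a → d (acc σ b (π.take t)) (σ π[t]) ≤
          c * d (acc σ b (π.take t)) (τ a) := fun h => by
        have h1 := hp.near t ht a hab hat (h ▸ ha)
        rw [← h] at h1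
        have h0 := hd.nonneg _ _ (Finset.nonempty_iff_ne_empty.2 hane)
          (Finset.nonempty_iff_ne_empty.2 ha)
        nlinarith
      by_cases haπ : a ∈ π
      · exact hnear (hπ a haπ)
      · rcases hother a hab haπ ha with h | h
        · exact hnear h
        · exact hfar (h t (by omega))
    have hstep := ih.merge (i := b) (j := π[t]) hmem.1.symm (by rwa [e1]) (by rw [e2]; exact hmem.2)
      (by
        intro a a' haa ha ha'
        rw [e1, e2]
        by_cases h1 : a = b
        · subst h1
          rw [e1]
          exact hown a' (fun h => haa h.symm) ha'
        · by_cases h2 : a' = b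
          · subst h2
            rw [hd.symm _ _ (Finset.nonempty_iff_ne_empty.2 ha)
              (Finset.nonempty_iff_ne_empty.2 ha'), e1]
            exact hown a h1 ha
          · have key : ∀ a, a ≠ b → applyPath τ b (π.take t) a ≠ ∅ →
                applyPath τ b (π.take t) a = τ a := by
              intro a hab ha
              by_cases h : a ∈ π.take t
              · simp [applyPath, hab, h] at ha
              · simp [applyPath, hab, h]
            have k1 := key a h1 ha
            have k2 := key a' h2 ha'
            rw [k1] at ha ⊢
            rw [k2] at ha' ⊢
            have := hsep a a' haa ha ha'
            nlinarith)
    rw [e1, e2, List.append_assoc, ← pathMerges_snoc, ← applyPath_snoc hnt hmem.1,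
      ← List.take_succ_eq_append_getElem ht] at hstep
    exact hstep

theorem Sep.path {K : ℕ} {θ₁ θ : ℝ} {σ τ : ℕ → Cluster k} {b : ℕ} {π : List ℕ}
    (hd : Metricish K d) (hsep : Sep d θ τ) (hp : IsPath d θ₁ θ σ b π) (hb : τ b = σ b)
    (hσb : σ b ≠ ∅) (hπ : ∀ j ∈ π, τ j = σ j)
    (hother : ∀ j, j ≠ b → j ∉ π → τ j ≠ ∅ → τ j = σ j ∨
      ∀ t ≤ π.length, θ ≤ d (acc σ b (π.take t)) (τ j))
    (hend : ∀ j, j ≠ b → j ∉ π → σ j ≠ ∅ → θ ≤ d (acc σ b π) (σ j)) :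
    Sep d θ (applyPath τ b π) := by
  have hacc : acc τ b π = acc σ b π := acc_congr hb hπ
  have e1 : applyPath τ b π b = acc σ b π := by simp [applyPath, hacc]
  have hane : acc σ b π ≠ ∅ := by
    rw [← Finset.nonempty_iff_ne_empty] at hσb ⊢
    exact hσb.mono (subset_acc _ _ _)
  have key : ∀ a, a ≠ b → applyPath τ b π a ≠ ∅ → a ∉ π ∧ applyPath τ b π a = τ a := by
    intro a hab ha
    by_cases h : a ∈ π
    · simp [applyPath, hab, h] at ha
    · simp [applyPath, hab, h]
  have hown : ∀ a, a ≠ b → applyPath τ b π a ≠ ∅ → θ ≤ d (acc σ b π) (applyPath τ b π a) := by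
    intro a hab ha
    obtain ⟨h1, h2⟩ := key a hab ha
    rw [h2] at ha ⊢
    rcases hother a hab h1 ha with h | h
    · rw [h] at ha ⊢
      exact hend a hab h1 ha
    · simpa using h π.length le_rfl
  intro a a' haa ha ha'
  by_cases h1 : a = b
  · subst h1
    rw [e1]
    exact hown a' (fun h => haa h.symm) ha'
  · by_cases h2 : a' = b
    · subst h2
      rw [hd.symm _ _ (Finset.nonempty_iff_ne_empty.2 ha) (Finset.nonempty_iff_ne_empty.2 ha'), e1]
      exact hown a h1 ha
    · obtain ⟨-, k1⟩ := key a h1 ha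
      obtain ⟨-, k2⟩ := key a' h2 ha'
      rw [k1] at ha ⊢
      rw [k2] at ha' ⊢
      exact hsep a a' haa ha ha'

/-- The path of slot `b` involves slot `j`. -/
def Touches (π : ℕ → List ℕ) (b j : ℕ) : Prop := π b ≠ [] ∧ (j = b ∨ j ∈ π b)

theorem applyPath_of_not_touches {σ : ℕ → Cluster k} {π : ℕ → List ℕ} {b j : ℕ}
    (h : ¬ Touches π b j) : applyPath σ b (π b) j = σ j := by
  by_cases h0 : π b = []
  · simp [h0]
  · have : ¬ (j = b ∨ j ∈ π b) := fun h' => h ⟨h0, h'⟩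
    rw [not_or] at this
    simp [applyPath, this.1, this.2]

/-- Paths that can be performed in parallel: no slot belongs to two of them, and the clusters that
grow along them stay far from each other. -/
structure Independent (d : Linkage k) (θ : ℝ) (σ : ℕ → Cluster k) (π : ℕ → List ℕ) : Prop where
  touch : ∀ b b' j, Touches π b j → Touches π b' j → b = b'
  far : ∀ b b', b ≠ b' → π b ≠ [] → π b' ≠ [] → ∀ t ≤ (π b).length, ∀ t' ≤ (π b').length,
    θ ≤ d (acc σ b ((π b).take t)) (acc σ b' ((π b').take t'))

/-- The slots after the paths of the slots below `m` have been performed in parallel. -/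
def joinSlots (σ : ℕ → Cluster k) (π : ℕ → List ℕ) (m : ℕ) : ℕ → Cluster k := fun j =>
  joinCell m (σ j) fun b => applyPath σ b (π b) j

theorem joinSlots_of_touches {σ : ℕ → Cluster k} {π : ℕ → List ℕ} {θ : ℝ}
    (h : Independent d θ σ π) {m b j : ℕ} (hb : b < m) (ht : Touches π b j) :
    joinSlots σ π m j = applyPath σ b (π b) j :=
  joinCell_of_unique hb fun _ _ hne =>
    applyPath_of_not_touches fun ht' => hne (h.touch _ _ _ ht' ht)

theorem joinSlots_of_not_touches {σ : ℕ → Cluster k} {π : ℕ → List ℕ} {m j : ℕ}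
    (h : ∀ b < m, ¬ Touches π b j) : joinSlots σ π m j = σ j :=
  joinCell_of_forall fun b hb => applyPath_of_not_touches (h b hb)

theorem joinSlots_succ {σ : ℕ → Cluster k} {π : ℕ → List ℕ} {θ : ℝ}
    (h : Independent d θ σ π) (m : ℕ) :
    joinSlots σ π (m + 1) = applyPath (joinSlots σ π m) m (π m) := by
  ext1 j
  by_cases htm : Touches π m j
  · rw [joinSlots_of_touches h (Nat.lt_succ_self m) htm]
    have key : ∀ i, Touches π m i → joinSlots σ π m i = σ i := fun i hi =>
      joinSlots_of_not_touches fun b hb hb' => by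
        have := h.touch _ _ _ hb' hi; omega
    have h1 : acc (joinSlots σ π m) m (π m) = acc σ m (π m) :=
      acc_congr (key m ⟨htm.1, .inl rfl⟩) fun i hi => key i ⟨htm.1, .inr hi⟩
    simp only [applyPath, h1, key j htm]
  · rw [applyPath_of_not_touches htm]
    by_cases he : ∃ b < m, Touches π b j
    · obtain ⟨b, hb, hbt⟩ := he
      rw [joinSlots_of_touches h (by omega) hbt, joinSlots_of_touches h hb hbt]
    · push Not at he
      rw [joinSlots_of_not_touches he, joinSlots_of_not_touches]
      intro b hb
      rcases Nat.lt_succ_iff_lt_or_eq.1 hb with hb | rfl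
      · exact he b hb
      · exact htm

/-- Independent paths may be performed in parallel: the outcome is that of performing them one after
the other, which is a legal sequence of merges. -/
theorem Reach.stage {K : ℕ} {θ₁ θ : ℝ} {L : Merges k} {σ : ℕ → Cluster k} {π : ℕ → List ℕ}
    (hd : Metricish K d) (hc : 1 ≤ c) (hθ : 0 < θ) (hθ₁ : θ₁ ≤ c * θ)
    (hr : Reach d c p L σ) (hsep : Sep d θ σ) (hind : Independent d θ σ π)
    (hpath : ∀ b, π b ≠ [] → σ b ≠ ∅ ∧ IsPath d θ₁ θ σ b (π b) ∧
      ∀ j, j ≠ b → j ∉ π b → σ j ≠ ∅ → θ ≤ d (acc σ b (π b)) (σ j)) (m : ℕ) :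
    Reach d c p (L ++ (List.range m).flatMap fun b => pathMerges σ b (π b)) (joinSlots σ π m) ∧
      Sep d θ (joinSlots σ π m) := by
  induction m with
  | zero =>
    have : joinSlots σ π 0 = σ := by
      ext1 j
      exact joinSlots_of_not_touches (by simp)
    simpa [this] using ⟨hr, hsep⟩
  | succ m ih =>
    obtain ⟨ihr, ihs⟩ := ih
    rw [joinSlots_succ hind, List.range_succ, List.flatMap_append, ← List.append_assoc]
    by_cases hm : π m = []
    · simpa [hm] using ⟨ihr, ihs⟩
    · obtain ⟨h1, h2, h3⟩ := hpath m hm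
      have key : ∀ i, Touches π m i → joinSlots σ π m i = σ i := fun i hi =>
        joinSlots_of_not_touches fun b hb hb' => by
          have := hind.touch _ _ _ hb' hi; omega
      have hb := key m ⟨hm, .inl rfl⟩
      have hπ : ∀ j ∈ π m, joinSlots σ π m j = σ j := fun j hj => key j ⟨hm, .inr hj⟩
      have hother : ∀ j, j ≠ m → j ∉ π m → joinSlots σ π m j ≠ ∅ → joinSlots σ π m j = σ j ∨
          ∀ t ≤ (π m).length, θ ≤ d (acc σ m ((π m).take t)) (joinSlots σ π m j) := by
        intro j hjm hjπ hj
        by_cases he : ∃ b < m, Touches π b j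
        · obtain ⟨b, hbm, hbt⟩ := he
          rw [joinSlots_of_touches hind hbm hbt] at hj ⊢
          by_cases hjb : j = b
          · subst hjb
            right
            intro t ht
            have := hind.far m j (by omega) hm hbt.1 t ht _ le_rfl
            simpa [applyPath] using this
          · have := hbt.2.resolve_left hjb
            simp [applyPath, hjb, this] at hj
        · push Not at he
          exact .inl (joinSlots_of_not_touches he)
      have r1 := ihr.path hd hc hθ hθ₁ ihs h2 hb h1 hπ hother (π m).length le_rfl
      have r2 := ihs.path hd h2 hb h1 hπ hother h3
      simp only [List.take_length] at r1
      exact ⟨by simpa using r1, r2⟩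

end Stage

section Passes

variable {k n : ℕ} {d : Linkage k} {p : Fin n → Pt k}

/-! ### Neighbour lists and packability -/

/-- By packability, `q` nearest neighbours include all the clusters within a given radius. -/
theorem mem_near {K q : ℕ} {near : (ℕ → Cluster k) → ℕ → List ℕ} {σ : ℕ → Cluster k} {θ R : ℝ}
    (hd : Metricish K d) (hnear : FindsNearest d q near) (hs : Slots n σ)
    (hcard : ∀ j, (σ j).card ≤ n) (hsep : Sep d θ σ) (hθ : 0 < θ) (hR : θ ≤ R)
    (hq : ((K * (Nat.log 2 n + 1) ^ K : ℕ) : ℝ) * (2 * (R / θ)) ^ (K * k) ≤ q) {i j : ℕ}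
    (hij : i ≠ j) (hi : σ i ≠ ∅) (hj : σ j ≠ ∅) (hdist : d (σ i) (σ j) ≤ R) : j ∈ near σ i := by
  obtain ⟨hnd, hmem, -, hle, hlen, hall⟩ := hnear σ i hs.finite hi
  by_contra hjL
  have hl : (near σ i).length = q := by
    refine le_antisymm hlen (not_lt.1 fun h => hjL (hall h j hij.symm hj))
  have hsub : (insert j (near σ i).toFinset).image σ ⊆ ball d (cl n σ) (σ i) R := by
    intro X hX
    obtain ⟨a, ha, rfl⟩ := Finset.mem_image.1 hX
    rw [Finset.mem_insert, List.mem_toFinset] at ha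
    refine Finset.mem_filter.2 ⟨hs.mem_cl.2 ⟨a, rfl, ?_⟩, ?_⟩
    · rcases ha with rfl | ha
      · exact hj
      · exact (hmem a ha).2
    · rcases ha with rfl | ha
      · exact hdist
      · exact (hle a ha j hjL hij.symm hj).trans hdist
  have hc : ((insert j (near σ i).toFinset).image σ).card = q + 1 := by
    rw [Finset.card_image_of_injOn, Finset.card_insert_of_notMem (by simpa using hjL),
      List.toFinset_card_of_nodup hnd, hl]
    intro a ha b hb he
    refine hs.inj ?_ he
    simp only [Finset.coe_insert, List.coe_toFinset, Set.mem_insert_iff, Set.mem_ofPred_eq] at ha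
    rcases ha with rfl | ha
    · exact hj
    · exact (hmem a ha).2
  have h1 := hd.pack n (cl n σ) (σ i) θ R
    (fun B hB => by
      obtain ⟨a, rfl, ha⟩ := hs.mem_cl.1 hB
      exact ⟨Finset.nonempty_iff_ne_empty.2 ha, hcard a⟩)
    (Finset.nonempty_iff_ne_empty.2 hi) (hcard i) hθ
    (fun B hB C hC hne => by
      obtain ⟨a, rfl, ha⟩ := hs.mem_cl.1 hB
      obtain ⟨b, rfl, hb⟩ := hs.mem_cl.1 hC
      exact hsep a b (fun he => hne (congrArg σ he)) ha hb) hR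
  have h2 := (hc ▸ Finset.card_le_card hsub : q + 1 ≤ (ball d (cl n σ) (σ i) R).card)
  have h3 : ((q + 1 : ℕ) : ℝ) ≤ q := (Nat.cast_le.2 h2).trans (h1.trans hq)
  have : q + 1 ≤ q := by exact_mod_cast h3
  omega

/-- The radius within which clusters may interfere: the triangle inequality is used at most twice,
for three distances of at most `pathRadius`. -/
def conflictRadius (K E ℓ : ℕ) (θ : ℝ) : ℝ := 3 * K ^ 2 * pathRadius K E ℓ θ

/-- Slot `b'` is in the list of neighbours of slot `b` or of one of its neighbours. -/
def TwoHop (near : ℕ → List ℕ) (b b' : ℕ) : Prop := ∃ j ∈ b :: near b, b' ∈ near j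

/-- Lists of `c (2ℓ)^(ck) ⌊log₂ n⌋^c` neighbours are long enough for the conflict radius. -/
theorem packing_le {K E : ℕ} :
    ∃ c₀ : ℕ, 1 ≤ c₀ ∧ ∀ c, c₀ ≤ c → ∀ k n ℓ : ℕ, 1 ≤ k → 2 ≤ n → 1 ≤ ℓ →
      K * (Nat.log 2 n + 1) ^ K * (2 * (3 * K ^ 2 * ((2 * ℓ) ^ (2 * K) * E))) ^ (K * k) ≤
        c * (2 * ℓ) ^ (c * k) * Nat.log 2 n ^ c := by
  refine ⟨K * 2 ^ K + (6 * K ^ 2 * E + 2 * K) * K + K + 1, by omega, ?_⟩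
  intro c hc k n ℓ hk hn hℓ
  have hlog : 1 ≤ Nat.log 2 n := Nat.log_pos one_lt_two hn
  have h1 : (Nat.log 2 n + 1) ^ K ≤ 2 ^ K * Nat.log 2 n ^ c := calc
    (Nat.log 2 n + 1) ^ K ≤ (2 * Nat.log 2 n) ^ K := Nat.pow_le_pow_left (by omega) _
    _ = 2 ^ K * Nat.log 2 n ^ K := mul_pow _ _ _
    _ ≤ _ := Nat.mul_le_mul_left _ (Nat.pow_le_pow_right hlog (by omega))
  have h2 : 6 * K ^ 2 * E ≤ (2 * ℓ) ^ (6 * K ^ 2 * E) :=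
    Nat.lt_two_pow_self.le.trans (Nat.pow_le_pow_left (by omega) _)
  have h3 : (2 * (3 * K ^ 2 * ((2 * ℓ) ^ (2 * K) * E))) ^ (K * k) ≤ (2 * ℓ) ^ (c * k) := calc
    (2 * (3 * K ^ 2 * ((2 * ℓ) ^ (2 * K) * E))) ^ (K * k)
      = (6 * K ^ 2 * E * (2 * ℓ) ^ (2 * K)) ^ (K * k) := by ring
    _ ≤ ((2 * ℓ) ^ (6 * K ^ 2 * E) * (2 * ℓ) ^ (2 * K)) ^ (K * k) :=
      Nat.pow_le_pow_left (Nat.mul_le_mul_right _ h2) _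
    _ = (2 * ℓ) ^ ((6 * K ^ 2 * E + 2 * K) * K * k) := by
      rw [← pow_add, ← pow_mul]; ring_nf
    _ ≤ _ := Nat.pow_le_pow_right (by omega) (Nat.mul_le_mul_right _ (by omega))
  calc _ ≤ K * (2 ^ K * Nat.log 2 n ^ c) * (2 * ℓ) ^ (c * k) := by gcongr
    _ = K * 2 ^ K * (2 * ℓ) ^ (c * k) * Nat.log 2 n ^ c := by ring
    _ ≤ _ := by gcongr; omega

/-! ### Passes -/

/-- The data that are fixed during a pass: the threshold `θ`, the clustering `σ₀` at its beginning
and a colouring `col₀` of the clusters, in which interfering clusters have different colours. -/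
structure PassData (d : Linkage k) (near : (ℕ → Cluster k) → ℕ → List ℕ) (K E ℓ : ℕ) (θ : ℝ)
    (σ₀ : ℕ → Cluster k) (col₀ : ℕ → ℕ) : Prop where
  close : ∀ i j, i ≠ j → σ₀ i ≠ ∅ → σ₀ j ≠ ∅ → d (σ₀ i) (σ₀ j) ≤ conflictRadius K E ℓ θ →
    j ∈ near σ₀ i
  proper : ∀ b b', b ≠ b' → σ₀ b ≠ ∅ → σ₀ b' ≠ ∅ → col₀ b = col₀ b' → ¬ TwoHop (near σ₀) b b'

/-- Initiators of the same colour have independent paths. -/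
theorem PassData.independent {near : (ℕ → Cluster k) → ℕ → List ℕ} {K E ℓ : ℕ} {θ θ₁ : ℝ}
    {σ₀ σ : ℕ → Cluster k} {col₀ : ℕ → ℕ} {π : ℕ → List ℕ} {z : ℕ} (hd : Metricish K d)
    (hK : 1 ≤ K) (hE : 1 ≤ E) (hℓ : 1 ≤ ℓ) (hθ : 0 < θ) (hθ₁ : θ₁ ≤ E * θ)
    (h : PassData d near K E ℓ θ σ₀ col₀) (hs : Slots n σ)
    (hev : ∀ j, σ j ≠ ∅ → σ₀ j ⊆ σ j ∧ σ₀ j ≠ ∅ ∧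
      (σ j = σ₀ j ∨ d (σ₀ j) (σ j) ≤ pathRadius K E ℓ θ))
    (hπ : ∀ b, π b ≠ [] → σ b = σ₀ b ∧ σ b ≠ ∅ ∧ col₀ b = z ∧ IsPath d θ₁ θ σ b (π b) ∧
      (π b).length ≤ ℓ) : Independent d θ σ π := by
  have hP0 := le_pathRadius (K := K) (E := E) hℓ hθ.le
  have hE' : (1 : ℝ) ≤ E := by exact_mod_cast hE
  have hK' : (1 : ℝ) ≤ K := by exact_mod_cast hK
  have hK2 : (K : ℝ) ≤ K ^ 2 := by nlinarith
  have hPθ : θ ≤ pathRadius K E ℓ θ := by nlinarith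
  have hP : 0 ≤ pathRadius K E ℓ θ := hθ.le.trans hPθ
  have hR1 : 2 * K * pathRadius K E ℓ θ ≤ conflictRadius K E ℓ θ := by
    unfold conflictRadius
    nlinarith
  have hne : ∀ {X : Cluster k}, X ≠ ∅ → X.Nonempty := Finset.nonempty_iff_ne_empty.2
  have hnear1 : ∀ b b', b ≠ b' → π b ≠ [] → π b' ≠ [] → b' ∉ near σ₀ b := by
    intro b b' hbb hb hb' hm
    obtain ⟨h1, h2, h3, -, -⟩ := hπ b hb
    obtain ⟨h1', h2', h3', -, -⟩ := hπ b' hb'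
    exact h.proper b b' hbb (h1 ▸ h2) (h1' ▸ h2') (h3.trans h3'.symm) ⟨b, by simp, hm⟩
  have hdirect : ∀ b b', b ≠ b' → π b ≠ [] → π b' ≠ [] →
      ¬ d (σ b) (σ b') ≤ conflictRadius K E ℓ θ := by
    intro b b' hbb hb hb' hle
    obtain ⟨h1, h2, -⟩ := hπ b hb
    obtain ⟨h1', h2', -⟩ := hπ b' hb'
    rw [h1] at h2 hle
    rw [h1'] at h2' hle
    exact hnear1 b b' hbb hb hb' (h.close b b' hbb h2 h2' hle)
  constructor
  · rintro b b' j ⟨hb, hj⟩ ⟨hb', hj'⟩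
    by_contra hbb
    obtain ⟨h1, h2, h3, h4, h5⟩ := hπ b hb
    obtain ⟨h1', h2', h3', h4', h5'⟩ := hπ b' hb'
    rcases hj with rfl | hj
    · rcases hj' with rfl | hj'
      · exact hbb rfl
      · have := h4'.dist_mem hd hK hs h2' hθ.le hE hθ₁ h5' hℓ hj'
        exact hdirect b' j (fun he => hbb he.symm) hb' hb (this.trans hR1)
    · rcases hj' with rfl | hj'
      · have := h4.dist_mem hd hK hs h2 hθ.le hE hθ₁ h5 hℓ hj
        exact hdirect b j hbb hb hb' (this.trans hR1)
      · -- A cluster that both paths use descends from a cluster of `σ₀` close to both initiators.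
        have hjm := (h4.mem j hj)
        have hjm' := (h4'.mem j hj')
        obtain ⟨hsub, hne0, hcl⟩ := hev j hjm.2
        have key : ∀ b, σ b = σ₀ b → σ b ≠ ∅ → IsPath d θ₁ θ σ b (π b) → (π b).length ≤ ℓ →
            j ∈ π b → d (σ₀ b) (σ₀ j) ≤ conflictRadius K E ℓ θ := by
          intro b h1 h2 h4 h5 hj
          have e1 := h4.dist_mem hd hK hs h2 hθ.le hE hθ₁ h5 hℓ hj
          rcases hcl with hcl | hcl
          · rw [← hcl, ← h1]
            exact e1.trans hR1
          · have e2 := hd.tri (σ b) (σ j) (σ₀ j) (hne h2) (hne hjm.2) (hne hne0)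
              ((min_le_right _ _).trans (Finset.card_le_card hsub))
            rw [hd.symm (σ j) (σ₀ j) (hne hjm.2) (hne hne0)] at e2
            rw [← h1]
            unfold conflictRadius
            nlinarith
        have k1 := h.close b j hjm.1.symm (h1 ▸ h2) hne0 (key b h1 h2 h4 h5 hj)
        have k2 := h.close j b' hjm'.1 hne0 (h1' ▸ h2') (by
          rw [hd.symm _ _ (hne hne0) (hne (h1' ▸ h2'))]
          exact key b' h1' h2' h4' h5' hj')
        exact h.proper b b' hbb (h1 ▸ h2) (h1' ▸ h2') (h3.trans h3'.symm)
          ⟨j, List.mem_cons_of_mem _ k1, k2⟩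
  · intro b b' hbb hb hb' t ht t' ht'
    by_contra hlt
    obtain ⟨h1, h2, h3, h4, h5⟩ := hπ b hb
    obtain ⟨h1', h2', h3', h4', h5'⟩ := hπ b' hb'
    have := hd.dist_of_stages hK (hne h2) (hne h2') (subset_acc σ b _) (subset_acc σ b' _) hP
      (h4.dist_acc hd hK hs h2 hθ.le hE hθ₁ h5 hℓ ht)
      (h4'.dist_acc hd hK hs h2' hθ.le hE hθ₁ h5' hℓ ht') hP ((not_le.1 hlt).le.trans hPθ)
    refine hdirect b b' hbb hb hb' (this.trans ?_)
    unfold conflictRadius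
    nlinarith

/-- The state of the computation between two stages.  `dead` marks the slots that are free. -/
structure StateInv (d : Linkage k) (ε θ : ℝ) (p : Fin n → Pt k) (σ : ℕ → Cluster k) (dead : ℕ → ℕ)
    (L : Merges k) : Prop where
  reach : Reach d (1 + ε) p L σ
  sep : Sep d θ σ
  dead_iff : ∀ j < n, dead j = 0 ↔ σ j ≠ ∅

/-- Of every two clusters at distance less than `θ₁`, one contains a point that took part in `t`
merges. -/
def CloseDeep (d : Linkage k) (θ₁ : ℝ) (t : ℕ) (σ : ℕ → Cluster k) (L : Merges k) : Prop :=
  ∀ i j, i ≠ j → σ i ≠ ∅ → σ j ≠ ∅ → d (σ i) (σ j) < θ₁ → ∃ x ∈ σ i ∪ σ j, t ≤ leafDepth L x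

/-- The invariant of a pass after the colours up to `z` have been treated.  The colour of a slot is
set to `0` as soon as its cluster changes.  A changed cluster contains a point that took part in
`t + 1` merges (`changed`), and is still close to the cluster that the slot held at the beginning
(`evolve`).  Two unchanged clusters that are close have colours still to be treated (`todo`). -/
structure PassInv (d : Linkage k) (ε θ : ℝ) (p : Fin n → Pt k) (P : ℝ) (t : ℕ)
    (σ₀ : ℕ → Cluster k) (col₀ : ℕ → ℕ) (z : ℕ) (σ : ℕ → Cluster k) (dead col : ℕ → ℕ)
    (L : Merges k) : Prop extends StateInv d ε θ p σ dead L where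
  unchanged : ∀ j < n, col j ≠ 0 → col j = col₀ j ∧ σ j = σ₀ j ∧ σ j ≠ ∅
  changed : ∀ j < n, col j = 0 → σ j ≠ ∅ → ∃ x ∈ σ j, t + 1 ≤ leafDepth L x
  evolve : ∀ j, σ j ≠ ∅ → σ₀ j ⊆ σ j ∧ σ₀ j ≠ ∅ ∧ (σ j = σ₀ j ∨ d (σ₀ j) (σ j) ≤ P)
  deep : CloseDeep d ((1 + ε) * θ) t σ₀ L
  todo : ∀ i < n, ∀ j < n, i ≠ j → col i ≠ 0 → col j ≠ 0 → d (σ i) (σ j) < (1 + ε) * θ → z < col i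

theorem CloseDeep.append {θ₁ : ℝ} {t : ℕ} {σ : ℕ → Cluster k} {L : Merges k}
    (h : CloseDeep d θ₁ t σ L) (L' : Merges k) : CloseDeep d θ₁ t σ (L ++ L') := by
  intro i j hij hi hj hlt
  obtain ⟨x, hx, h1⟩ := h i j hij hi hj hlt
  exact ⟨x, hx, by rw [leafDepth_append]; omega⟩

/-- When all colours have been treated, the next pass may begin. -/
theorem PassInv.closeDeep {ε θ P : ℝ} {t z : ℕ} {σ₀ σ : ℕ → Cluster k} {col₀ dead col : ℕ → ℕ}
    {L : Merges k} (h : PassInv d ε θ p P t σ₀ col₀ z σ dead col L)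
    (hz : ∀ j < n, col₀ j ≤ z) : CloseDeep d ((1 + ε) * θ) (t + 1) σ L := by
  intro i j hij hi hj hlt
  have hin := h.reach.slots.lt hi
  have hjn := h.reach.slots.lt hj
  by_cases hci : col i = 0
  · obtain ⟨x, hx, h1⟩ := h.changed i hin hci hi
    exact ⟨x, Finset.mem_union_left _ hx, h1⟩
  by_cases hcj : col j = 0
  · obtain ⟨x, hx, h1⟩ := h.changed j hjn hcj hj
    exact ⟨x, Finset.mem_union_right _ hx, h1⟩
  have h1 := h.todo i hin j hjn hij hci hcj hlt
  have h2 := (h.unchanged i hin hci).1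
  have := hz i hin
  omega

theorem one_le_leafDepth_pathMerges {σ : ℕ → Cluster k} {b : ℕ} {π : List ℕ} {a : ℕ} {x : Pt k}
    (hx : x ∈ σ b ∨ x ∈ σ a) : 1 ≤ leafDepth (pathMerges σ b (a :: π)) x := by
  unfold leafDepth
  rw [Nat.one_le_iff_ne_zero, ← Nat.pos_iff_ne_zero, List.countP_pos_iff]
  refine ⟨(σ b, σ a), ?_, by simpa using hx⟩
  refine List.mem_map.2 ⟨0, by simp, by simp⟩

theorem leafDepth_le_flatMap {f : ℕ → Merges k} {m b : ℕ} (hb : b < m) (x : Pt k) :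
    leafDepth (f b) x ≤ leafDepth ((List.range m).flatMap f) x := by
  induction m with
  | zero => omega
  | succ m ih =>
    rw [List.range_succ, List.flatMap_append, leafDepth_append]
    rcases Nat.lt_succ_iff_lt_or_eq.1 hb with hb | rfl
    · have := ih hb; omega
    · simp

/-- One stage: the initiators of colour `z + 1` perform their paths in parallel. -/
theorem PassInv.stage {near : (ℕ → Cluster k) → ℕ → List ℕ} {K E ℓ : ℕ} {ε θ : ℝ} {t z : ℕ}
    {σ₀ σ : ℕ → Cluster k} {col₀ dead col : ℕ → ℕ} {L : Merges k} {π : ℕ → List ℕ}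
    (hd : Metricish K d) (hK : 1 ≤ K) (hε : 0 < ε) (hεE : 1 + ε ≤ E) (hℓ : 1 ≤ ℓ) (hθ : 0 < θ)
    (hbb : BounceBackLengthLE d ε p ℓ) (h0 : PassData d near K E ℓ θ σ₀ col₀)
    (h : PassInv d ε θ p (pathRadius K E ℓ θ) t σ₀ col₀ z σ dead col L)
    (hπn : ∀ b, π b ≠ [] → b < n)
    (hπ : ∀ b, π b ≠ [] → col b = z + 1 ∧ IsPath d ((1 + ε) * θ) θ σ b (π b) ∧
      ∀ j, j ≠ b → j ∉ π b → σ j ≠ ∅ → θ ≤ d (acc σ b (π b)) (σ j))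
    (hnil : ∀ b < n, col b = z + 1 → π b = [] →
      ∀ j, j ≠ b → σ j ≠ ∅ → (1 + ε) * θ ≤ d (σ b) (σ j)) :
    PassInv d ε θ p (pathRadius K E ℓ θ) t σ₀ col₀ (z + 1) (joinSlots σ π n)
      (fun j => joinCell n (dead j) fun b => if j ∈ π b then 1 else dead j)
      (fun j => joinCell n (col j) fun b => if Touches π b j then 0 else col j)
      (L ++ (List.range n).flatMap fun b => pathMerges σ b (π b)) := by
  have hE : 1 ≤ E := by
    have : (1 : ℝ) ≤ E := by linarith
    exact_mod_cast this
  have hθ₁ : (1 + ε) * θ ≤ E * θ := mul_le_mul_of_nonneg_right hεE hθ.le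
  have hs := h.reach.slots
  have hπ' : ∀ b, π b ≠ [] → σ b = σ₀ b ∧ σ b ≠ ∅ ∧ col₀ b = z + 1 ∧
      IsPath d ((1 + ε) * θ) θ σ b (π b) ∧ (π b).length ≤ ℓ := by
    intro b hb
    obtain ⟨h1, h2, -⟩ := hπ b hb
    obtain ⟨h3, h4, h5⟩ := h.unchanged b (hπn b hb) (by omega)
    exact ⟨h4, h5, by omega, h2, h2.length_le hbb h.reach hθ h.sep h5⟩
  have hind := h0.independent hd hK hE hℓ hθ hθ₁ hs h.evolve hπ'
  obtain ⟨hr, hsep⟩ := h.reach.stage hd (by linarith) hθ le_rfl h.sep hind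
    (fun b hb => ⟨(hπ' b hb).2.1, (hπ b hb).2.1, (hπ b hb).2.2⟩) n
  -- Each slot belongs to the path of at most one branch, which determines its contents.
  have hcase : ∀ j, (∃ b < n, Touches π b j ∧ joinSlots σ π n j = applyPath σ b (π b) j ∧
        (joinCell n (dead j) fun b => if j ∈ π b then 1 else dead j) =
          (if j ∈ π b then 1 else dead j) ∧
        (joinCell n (col j) fun b => if Touches π b j then 0 else col j) = 0) ∨
      (joinSlots σ π n j = σ j ∧
        (joinCell n (dead j) fun b => if j ∈ π b then 1 else dead j) = dead j ∧
        (joinCell n (col j) fun b => if Touches π b j then 0 else col j) = col j ∧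
        ∀ b < n, ¬ Touches π b j) := by
    intro j
    have hmt : ∀ b, j ∈ π b → Touches π b j := fun b hb => ⟨List.ne_nil_of_mem hb, .inr hb⟩
    by_cases he : ∃ b < n, Touches π b j
    · obtain ⟨b, hb, hbt⟩ := he
      refine .inl ⟨b, hb, hbt, joinSlots_of_touches hind hb hbt, ?_, ?_⟩
      · refine joinCell_of_unique hb fun i _ hib => if_neg fun hm => hib ?_
        exact hind.touch _ _ _ (hmt i hm) hbt
      · rw [joinCell_of_unique hb fun i _ hib => if_neg fun hm => hib (hind.touch _ _ _ hm hbt),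
          if_pos hbt]
    · push Not at he
      refine .inr ⟨joinSlots_of_not_touches he, ?_, ?_, he⟩
      · exact joinCell_of_forall fun b hb => if_neg fun hm => he b hb (hmt b hm)
      · exact joinCell_of_forall fun b hb => if_neg (he b hb)
  have hnotself : ∀ b, b ∉ π b := fun b hb =>
    ((hπ b (List.ne_nil_of_mem hb)).2.1.mem b hb).1 rfl
  have happ : ∀ b j, Touches π b j → applyPath σ b (π b) j ≠ ∅ →
      j = b ∧ applyPath σ b (π b) j = acc σ b (π b) := by
    rintro b j ⟨_, rfl | hj⟩ hne
    · simp [applyPath]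
    · have hjb : j ≠ b := fun he => hnotself b (he ▸ hj)
      simp [applyPath, hjb, hj] at hne
  refine ⟨⟨hr, hsep, ?_⟩, ?_, ?_, ?_, h.deep.append _, ?_⟩
  · intro j hj
    rcases hcase j with ⟨b, hb, hbt, e1, e2, -⟩ | ⟨e1, e2, -, -⟩
    · rw [e1, e2]
      by_cases hjb : j = b
      · subst hjb
        have := (hπ' j hbt.1).2.1
        rw [if_neg (hnotself j), h.dead_iff j hj]
        simp only [applyPath, if_true]
        rw [← Finset.nonempty_iff_ne_empty, ← Finset.nonempty_iff_ne_empty] at *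
        exact ⟨fun h => h.mono (subset_acc _ _ _), fun _ => this⟩
      · have := hbt.2.resolve_left hjb
        simp [applyPath, hjb, this]
    · rw [e1, e2]
      exact h.dead_iff j hj
  · intro j hj hcj
    rcases hcase j with ⟨b, hb, hbt, e1, e2, e3⟩ | ⟨e1, e2, e3, -⟩
    · exact absurd e3 hcj
    · simp only [e3] at hcj ⊢
      rw [e1]
      exact h.unchanged j hj hcj
  · intro j hj hcj hne
    rcases hcase j with ⟨b, hb, hbt, e1, e2, e3⟩ | ⟨e1, e2, e3, -⟩
    · rw [e1] at hne ⊢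
      obtain ⟨rfl, h2⟩ := happ b j hbt hne
      rw [h2]
      obtain ⟨a, π', hπe⟩ := List.exists_cons_of_ne_nil hbt.1
      have hp := (hπ j hbt.1).2.1
      have ha : a ∈ π j := by simp [hπe]
      have hcolj : col j ≠ 0 := by have := (hπ j hbt.1).1; omega
      have hσa := hp.mem a ha
      have han := hs.lt hσa.2
      have hdeep : ∃ x, (x ∈ σ j ∨ x ∈ σ a) ∧ t ≤ leafDepth L x := by
        by_cases hca : col a = 0
        · obtain ⟨x, hx, hxd⟩ := h.changed a han hca hσa.2
          exact ⟨x, .inr hx, by omega⟩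
        · have u1 := h.unchanged j hj hcolj
          have u2 := h.unchanged a han hca
          have hlt := hp.below 0 (by simp [hπe])
          have hlt : d (σ j) (σ a) < (1 + ε) * θ := by simpa [hπe] using hlt
          obtain ⟨x, hx, hxd⟩ := h.deep j a hσa.1.symm (u1.2.1 ▸ u1.2.2) (u2.2.1 ▸ u2.2.2)
            (by rwa [← u1.2.1, ← u2.2.1])
          rw [← u1.2.1, ← u2.2.1, Finset.mem_union] at hx
          exact ⟨x, hx, hxd⟩
      obtain ⟨x, hx, hxd⟩ := hdeep
      refine ⟨x, mem_acc.2 (hx.imp_right fun hx => ⟨a, ha, hx⟩), ?_⟩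
      have l1 := one_le_leafDepth_pathMerges (π := π') hx
      rw [← hπe] at l1
      have l2 := leafDepth_le_flatMap (f := fun b => pathMerges σ b (π b)) hb x
      rw [leafDepth_append]
      omega
    · simp only [e3] at hcj
      rw [e1] at hne ⊢
      obtain ⟨x, hx, hxd⟩ := h.changed j hj hcj hne
      exact ⟨x, hx, by rw [leafDepth_append]; omega⟩
  · intro j hne
    rcases hcase j with ⟨b, hb, hbt, e1, -⟩ | ⟨e1, -⟩
    · rw [e1] at hne ⊢
      obtain ⟨rfl, h2⟩ := happ b j hbt hne
      obtain ⟨u1, u2, u3, u4, u5⟩ := hπ' j hbt.1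
      rw [h2, ← u1]
      refine ⟨subset_acc _ _ _, u2, ?_⟩
      simpa using u4.dist_acc hd hK hs u2 hθ.le hE hθ₁ u5 hℓ le_rfl
    · rw [e1] at hne ⊢
      exact h.evolve j hne
  · intro i hi j hj hij hci hcj hlt
    rcases hcase i with ⟨b, hb, hbt, e1, e2, e3⟩ | ⟨e1, e2, e3, hni⟩
    · exact absurd e3 hci
    rcases hcase j with ⟨b, hb, hbt, f1, f2, f3⟩ | ⟨f1, f2, f3, -⟩
    · exact absurd f3 hcj
    simp only [e3] at hci ⊢
    simp only [f3] at hcj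
    rw [e1, f1] at hlt
    have hz := h.todo i hi j hj hij hci hcj hlt
    refine lt_of_le_of_ne hz fun he => ?_
    have hnili : π i = [] := by
      by_contra hh
      exact hni i hi ⟨hh, .inl rfl⟩
    have := hnil i hi he.symm hnili j hij.symm (h.unchanged j hj hcj).2.2
    linarith

end Passes

section Colours

/-! ### Colours from moduli -/

/-- A number divisible by every positive number below `2 N + 1` is divisible by the central binomial
coefficient of `N`. -/
theorem centralBinom_dvd {N X : ℕ} (hX : X ≠ 0) (h : ∀ m, 1 ≤ m → m < 2 * N + 1 → m ∣ X) :
    Nat.centralBinom N ∣ X := by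
  rw [← Nat.factorization_prime_le_iff_dvd (Nat.centralBinom_ne_zero N) hX]
  intro q hq
  rw [← hq.pow_dvd_iff_le_factorization hX]
  rcases Nat.eq_zero_or_pos N with rfl | hN
  · simp
  refine h _ (Nat.pos_of_ne_zero (pow_ne_zero _ hq.ne_zero)) ?_
  have := Nat.pow_factorization_choose_le (p := q) (n := 2 * N) (k := N) (by omega)
  exact Nat.lt_succ_of_le this

/-- Few numbers below `n` can be separated from a given one by a small modulus.  Otherwise the
product of their differences from that number would be divisible by all the small moduli, hence by
a central binomial coefficient, which exceeds it. -/
theorem exists_modulus {n s i : ℕ} (S : Finset ℕ) (hS : S.card ≤ s) (hi : i < n)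
    (hSn : ∀ j ∈ S, j < n ∧ j ≠ i) :
    ∃ m, 1 ≤ m ∧ m < 2 * ((Nat.log 2 n + 1) * s + 4) + 1 ∧ ∀ j ∈ S, j % m ≠ i % m := by
  by_contra! hcon
  set N := (Nat.log 2 n + 1) * s + 4 with hN
  set X := ∏ j ∈ S, (Nat.dist j i) with hX
  have hX0 : X ≠ 0 := Finset.prod_ne_zero_iff.2 fun j hj h =>
    (hSn j hj).2 (Nat.eq_of_dist_eq_zero h)
  have hdvd : Nat.centralBinom N ∣ X := by
    refine centralBinom_dvd hX0 fun m h1 h2 => ?_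
    obtain ⟨j, hj, hmod⟩ := hcon m h1 h2
    refine dvd_trans ?_ (Finset.dvd_prod_of_mem _ hj)
    rcases le_total j i with h | h
    · rw [Nat.dist_eq_sub_of_le h]
      exact (Nat.modEq_iff_dvd' h).1 hmod
    · rw [Nat.dist_comm, Nat.dist_eq_sub_of_le h]
      exact (Nat.modEq_iff_dvd' h).1 hmod.symm
  have hXle : X ≤ 2 ^ ((Nat.log 2 n + 1) * s) := by
    have h1 : X ≤ n ^ S.card := by
      refine Finset.prod_le_pow_card _ _ _ fun j hj => ?_
      have := (hSn j hj).1
      unfold Nat.dist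
      omega
    have h2 : n ≤ 2 ^ (Nat.log 2 n + 1) := (Nat.lt_pow_succ_log_self one_lt_two n).le
    calc X ≤ n ^ S.card := h1
      _ ≤ n ^ s := Nat.pow_le_pow_right (by omega) hS
      _ ≤ _ := by rw [pow_mul]; exact Nat.pow_le_pow_left h2 _
  have h4 := Nat.four_pow_lt_mul_centralBinom N (by omega)
  have h5 := Nat.le_of_dvd (Nat.pos_of_ne_zero hX0) hdvd
  have h6 : 4 ^ N < 2 ^ N * 2 ^ N := calc
    4 ^ N < N * Nat.centralBinom N := h4
    _ ≤ 2 ^ N * 2 ^ ((Nat.log 2 n + 1) * s) :=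
      Nat.mul_le_mul Nat.lt_two_pow_self.le (h5.trans hXle)
    _ ≤ _ := Nat.mul_le_mul_left _ (Nat.pow_le_pow_right (by omega) (by omega))
  rw [← mul_pow] at h6
  norm_num at h6

end Colours

section Colouring

variable {k : ℕ} {env : Env k}

/-! ### The program that colours the clusters -/

/-- `if e = f then c`. -/
def ifEq (e f : NExp) (c : Cmd) : Cmd := .ite (.ltN e f) .skip (.ite (.ltN f e) .skip c)

/-- `if e ≠ f then c`. -/
def ifNe (e f : NExp) (c : Cmd) : Cmd := .ite (.ltN e f) c (.ite (.ltN f e) c .skip)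

theorem Runs.ifEq {e f : NExp} {c : Cmd} {s : Store k} {u w t : ℕ} {Q : Store k → Merges k → Prop}
    (hu : e.cost s + f.cost s + 2 ≤ u) (hw : 1 ≤ w) (ht : 1 ≤ t)
    (h : e.eval s = f.eval s → Runs env c s w t Q) (h' : e.eval s ≠ f.eval s → Q s []) :
    Runs env (ifEq e f c) s (u + (u + w)) (u + (u + t)) Q := by
  refine Runs.ite (by simp only [BExp.cost]; omega) (fun hb => ?_) fun hb => ?_
  · simp only [BExp.Holds] at hb
    exact Runs.skip (by omega) (by omega) (h' (by omega))
  · refine Runs.ite (by simp only [BExp.cost]; omega) (fun hb' => ?_) fun hb' => ?_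
    · simp only [BExp.Holds] at hb hb'
      exact Runs.skip (by omega) (by omega) (h' (by omega))
    · simp only [BExp.Holds] at hb hb'
      exact h (by omega)

theorem Runs.ifNe {e f : NExp} {c : Cmd} {s : Store k} {u w t : ℕ} {Q : Store k → Merges k → Prop}
    (hu : e.cost s + f.cost s + 2 ≤ u) (hw : 1 ≤ w) (ht : 1 ≤ t)
    (h : e.eval s ≠ f.eval s → Runs env c s w t Q) (h' : e.eval s = f.eval s → Q s []) :
    Runs env (ifNe e f c) s (u + (u + w)) (u + (u + t)) Q := by
  refine Runs.ite (by simp only [BExp.cost]; omega) (fun hb => ?_) fun hb => ?_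
  · simp only [BExp.Holds] at hb
    exact (h (by omega)).mono (by omega) (by omega) fun _ _ h => h
  · refine Runs.ite (by simp only [BExp.cost]; omega) (fun hb' => ?_) fun hb' => ?_
    · simp only [BExp.Holds] at hb hb'
      exact h (by omega)
    · simp only [BExp.Holds] at hb hb'
      exact Runs.skip (by omega) (by omega) (h' (by omega))

theorem write_apply {β : Type} (f : ℕ → ℕ → β) (a i : ℕ) (v : β) (b j : ℕ) :
    write f a i v b j = if b = a ∧ j = i then v else f b j := by
  unfold write
  by_cases h : b = a
  · subst h
    by_cases h' : j = i <;> simp [h']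
  · simp [h]

theorem write_of_ne {β : Type} (f : ℕ → ℕ → β) {a b : ℕ} (i : ℕ) (v : β) (h : b ≠ a) :
    write f a i v b = f b := by
  simp [write, h]

theorem writeList_of_ne (f : ℕ → ℕ → ℕ) {a b : ℕ} (L : List ℕ) (h : b ≠ a) :
    writeList f a L b = f b := by
  simp [writeList, h]

theorem writeList_zero (f : ℕ → ℕ → ℕ) (a : ℕ) (L : List ℕ) : writeList f a L a 0 = L.length := by
  simp [writeList]

theorem writeList_succ (f : ℕ → ℕ → ℕ) (a : ℕ) (L : List ℕ) {t : ℕ} (ht : t < L.length) :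
    writeList f a L a (t + 1) = L.getD t 0 := by
  simp only [writeList, Function.update_self]
  rw [if_neg (by omega), if_pos (by omega)]
  rfl

/-- The slot `b` is congruent to the slot in the variable `10` modulo the variable `13` and different
from it, for the current entry `b` of the list in the array `15`; in this case the variable `17` is
set. -/
def testEntry : Cmd :=
  ifEq (.mod (.cell 15 (.add (var 16) (.const 1))) (var 13)) (.mod (var 10) (var 13))
    (ifNe (.cell 15 (.add (var 16) (.const 1))) (var 10) (.setN 17 (.const 0) (.const 1)))

/-- `testEntry` for all the neighbours of the current entry of the list in the array `11`. -/
def testList : Cmd :=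
  .seq (.nn 15 (.cell 11 (var 14))) (forLoop 16 (var 15) testEntry)

/-- Find the least modulus that separates the slot in the variable `10` from its neighbours and their
neighbours, and colour it by the modulus and the residue.  The array `6` marks the free slots. -/
def colourSlot : Cmd :=
  .ite (.ltN (.cell 6 (var 10)) (.const 1))
    (.seq (.nn 11 (var 10))
      (.seq (.setN 12 (.const 0) (var 11))
        (.seq (.setN 11 (.const 0) (var 10))
          (.seq (.setN 13 (.const 0) (.const 0))
            (.seq (.setN 17 (.const 0) (.const 1))
              (.seq
                (.loop (.ltN (.const 0) (var 17))
                  (.seq (.setN 13 (.const 0) (.add (var 13) (.const 1)))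
                    (.seq (.setN 17 (.const 0) (.const 0))
                      (forLoop 14 (.add (var 12) (.const 1)) testList))))
                (.setN 7 (var 10)
                  (.add (.mul (var 13) (var 3)) (.mod (var 10) (var 13))))))))))
    (.setN 7 (var 10) (.const 0))

/-- The parameter `u` bounds the cost of every elementary step, as long as the numbers that occur
are at most `V`. -/
structure UnitCost (V u : ℕ) : Prop where
  size_le : ∀ v ≤ V, 50 * v.size + 200 ≤ u

theorem runs_testEntry {V u n m i j : ℕ} {s : Store k} (hu : UnitCost V u) (hV : n + 1 ≤ V)
    (hj : j ≤ n) (hi : i < n) (hm : m ≤ V) (h10 : s.nat 10 0 = i) (h13 : s.nat 13 0 = m)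
    (h16 : s.nat 16 0 = j) (hb : s.nat 15 (j + 1) < n) :
    Runs env testEntry s (5 * u) (5 * u) fun s' L => L = [] ∧ s'.slot = s.slot ∧ s'.real = s.real ∧
      (∀ b, b ≠ 17 → s'.nat b = s.nat b) ∧ s'.nat 17 0 =
        if s.nat 15 (j + 1) % m = i % m ∧ s.nat 15 (j + 1) ≠ i then 1 else s.nat 17 0 := by
  have c1 := hu.size_le j (by omega)
  have c2 := hu.size_le (j + 1) (by omega)
  have c3 := hu.size_le (s.nat 15 (j + 1)) (by omega)
  have c4 := hu.size_le (s.nat 15 (j + 1) % m) ((Nat.mod_le _ _).trans (by omega))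
  have c5 := hu.size_le i (by omega)
  have c6 := hu.size_le (i % m) ((Nat.mod_le _ _).trans (by omega))
  have c7 := hu.size_le m hm
  have e1 : Nat.size 1 = 1 := by simp
  have e0 : Nat.size 0 = 0 := by simp
  refine Runs.mono (w := u + (u + (u + (u + u)))) (t := u + (u + (u + (u + u))))
    (Runs.ifEq ?_ ?_ ?_ (fun he => Runs.ifNe ?_ ?_ ?_ (fun hne => Runs.setN ?_ ?_ ?_) fun hne => ?_)
    fun he => ?_) (by omega) (by omega) fun _ _ h => h
  all_goals first | omega | skip
  all_goals try simp only [NExp.cost, NExp.eval, h10, h13, h16, e0, e1]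
  all_goals first | omega | skip
  all_goals simp only [NExp.eval, h10, h13, h16] at he
  rotate_right
  · simp [he]
  · simp only [NExp.eval, h10, h16] at hne
    refine ⟨trivial, trivial, trivial, fun b hb => write_of_ne _ _ _ hb, ?_⟩
    simp [write_apply, he, hne]
  · simp only [NExp.eval, h10, h16] at hne
    simp [hne]

theorem runs_testList {V u n q m i a : ℕ} {s : Store k} {σ : ℕ → Cluster k} (hu : UnitCost V u)
    (hV : n + 1 ≤ V) (hqn : (env.near σ a).length ≤ n) (hq : (env.near σ a).length ≤ q)
    (hn : ∀ b ∈ env.near σ a, b < n) (hi : i < n) (hm : m ≤ V) (ha : a < n) (hσ : s.slot = σ)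
    (h10 : s.nat 10 0 = i) (h13 : s.nat 13 0 = m) (h14V : s.nat 14 0 ≤ V)
    (h11 : s.nat 11 (s.nat 14 0) = a) (h17 : s.nat 17 0 ≤ 1) :
    Runs env testList s (u + env.W + q + (q * (7 * u) + 2 * u)) (u + q + (q * (7 * u) + 2 * u))
      fun s' L => L = [] ∧ s'.slot = σ ∧ s'.real = s.real ∧
      (∀ b < 15, s'.nat b = s.nat b) ∧ s'.nat 17 0 ≤ 1 ∧ (s'.nat 17 0 = 0 ↔
        s.nat 17 0 = 0 ∧ ∀ b ∈ env.near σ a, b % m = i % m → b = i) := by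
  have c1 := hu.size_le _ h14V
  have c2 := hu.size_le a (by omega)
  have e0 : Nat.size 0 = 0 := by simp
  unfold testList
  refine Runs.seq (Runs.nn ?_ ?_ ?_)
  · simp only [NExp.cost, NExp.eval, h11, hσ, e0]; omega
  · simp only [NExp.cost, NExp.eval, h11, hσ, e0]; omega
  simp only [NExp.eval, h11, hσ, List.nil_append]
  set l := env.near σ a with hl
  have hgetD : ∀ t, t < l.length → l.getD t 0 ∈ l := fun t ht => by
    rw [List.getD_eq_getElem _ _ ht]; exact List.getElem_mem ht
  refine Runs.mono (w := l.length * (2 * u + 5 * u) + 2 * u)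
    (t := l.length * (2 * u + 5 * u) + 2 * u)
    (Runs.forLoop (N := l.length) (fun j s' L => L = [] ∧ s'.slot = σ ∧ s'.real = s.real ∧
      (∀ b < 15, s'.nat b = s.nat b) ∧ s'.nat 16 0 = j ∧ s'.nat 15 0 = l.length ∧
      (∀ t < l.length, s'.nat 15 (t + 1) = l.getD t 0) ∧ s'.nat 17 0 ≤ 1 ∧ (s'.nat 17 0 = 0 ↔
        s.nat 17 0 = 0 ∧ ∀ t < j, t < l.length → l.getD t 0 % m = i % m → l.getD t 0 = i))
      ?_ ?_ ?_ ?_ ?_) ?_ ?_ fun _ _ h => h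
  · dsimp only
    refine ⟨rfl, rfl, rfl, fun b hb => ?_, ?_, ?_, ?_, ?_, ?_⟩
    · rw [write_of_ne _ _ _ (by omega), writeList_of_ne _ _ (by omega)]
    · simp [write_apply]
    · simp [write_apply, writeList_zero]
    · intro t ht
      rw [write_of_ne _ _ _ (by omega), writeList_succ _ _ _ ht]
    · rwa [write_of_ne _ _ _ (by omega), writeList_of_ne _ _ (by omega)]
    · rw [write_of_ne _ _ _ (by omega), writeList_of_ne _ _ (by omega)]
      simp
  · intro j hj
    have := hu.size_le j (by omega)
    omega
  · rintro j hj s' L ⟨-, -, -, -, h6, h7, -, -, -⟩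
    refine ⟨h6, h7, ?_⟩
    simp only [NExp.cost, NExp.eval, h7, e0]
    have := hu.size_le l.length (by omega)
    have := hu.size_le j (by omega)
    omega
  · rintro j s' L hj ⟨rfl, h2, h3, h4, h5, h6, h7, h9, h8⟩
    refine (runs_testEntry hu hV (hj.le.trans hqn) hi hm ((congrFun (h4 10 (by omega)) 0).trans h10)
      ((congrFun (h4 13 (by omega)) 0).trans h13) h5 ?_).mono le_rfl le_rfl ?_
    · rw [h7 j hj]
      exact hn _ (hgetD j hj)
    · rintro s'' L' ⟨rfl, g2, g3, g4, g5⟩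
      refine ⟨by rw [g4 16 (by omega), h5], rfl, g2.trans h2, g3.trans h3, fun b hb => ?_, ?_, ?_,
        ?_, ?_, ?_⟩
      · simp only
        rw [write_of_ne _ _ _ (by omega), g4 b (by omega), h4 b hb]
      · simp [write_apply]
      · simp only
        rw [write_of_ne _ _ _ (by omega), g4 15 (by omega), h6]
      · intro t ht
        simp only
        rw [write_of_ne _ _ _ (by omega), g4 15 (by omega), h7 t ht]
      · simp only
        rw [write_of_ne _ _ _ (by omega), g5]
        split_ifs
        exacts [le_rfl, h9]
      · simp only
        rw [write_of_ne _ _ _ (by omega), g5, h7 j hj]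
        split_ifs with hc
        · simp only [false_iff, not_and]
          intro _ hall
          exact hc.2 (hall j (by omega) hj hc.1)
        · rw [h8]
          refine and_congr_right fun _ => ⟨fun hall t ht htl hmod => ?_, fun hall t ht => hall t (by omega)⟩
          rcases Nat.lt_succ_iff_lt_or_eq.1 ht with ht | rfl
          · exact hall t ht htl hmod
          · by_contra hne
            exact hc ⟨hmod, hne⟩
  · rintro s' L ⟨rfl, h2, h3, h4, h5, h6, h7, h9, h8⟩
    refine ⟨rfl, h2, h3, h4, h9, h8.trans (and_congr_right fun _ => ⟨fun hall b hb => ?_, fun hall t _ ht =>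
      hall _ (hgetD t ht)⟩)⟩
    obtain ⟨t, ht, rfl⟩ := List.getElem_of_mem hb
    have := hall t ht ht
    rwa [List.getD_eq_getElem _ _ ht] at this
  · gcongr; omega
  · gcongr; omega

/-- The lists that the subroutine returns consist of at most `q` other active slots. -/
structure NearOK (near : (ℕ → Cluster k) → ℕ → List ℕ) (n q : ℕ) (σ : ℕ → Cluster k) : Prop where
  le_q : ∀ a, σ a ≠ ∅ → (near σ a).length ≤ q
  le_n : ∀ a, σ a ≠ ∅ → (near σ a).length ≤ n
  mem : ∀ a, σ a ≠ ∅ → ∀ b ∈ near σ a, b < n ∧ b ≠ a ∧ σ b ≠ ∅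

theorem FindsNearest.nearOK {d : Linkage k} {near : (ℕ → Cluster k) → ℕ → List ℕ} {n q : ℕ}
    {σ : ℕ → Cluster k} (h : FindsNearest d q near) (hs : Slots n σ) : NearOK near n q σ where
  le_q a ha := (h σ a hs.finite ha).2.2.2.2.1
  le_n a ha := by
    obtain ⟨h1, h2, -⟩ := h σ a hs.finite ha
    have : (near σ a).toFinset ⊆ Finset.range n := fun b hb =>
      Finset.mem_range.2 (hs.lt (h2 b (List.mem_toFinset.1 hb)).2)
    simpa [List.toFinset_card_of_nodup h1] using Finset.card_le_card this
  mem a ha b hb := by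
    obtain ⟨-, h2, -⟩ := h σ a hs.finite ha
    exact ⟨hs.lt (h2 b hb).2, (h2 b hb).1, (h2 b hb).2⟩

/-- The modulus `m` separates the slot `i` from its neighbours and their neighbours. -/
def Separates (near : ℕ → List ℕ) (i m : ℕ) : Prop := ∀ b, TwoHop near i b → b % m = i % m → b = i

theorem exists_separates {near : (ℕ → Cluster k) → ℕ → List ℕ} {n q : ℕ} {σ : ℕ → Cluster k}
    (h : NearOK near n q σ) {i : ℕ} (hi : i < n) (hσ : σ i ≠ ∅) :
    ∃ m, 1 ≤ m ∧ m < 2 * ((Nat.log 2 n + 1) * ((q + 1) * q) + 4) + 1 ∧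
      Separates (near σ) i m := by
  set S : Finset ℕ := ((i :: near σ i).toFinset.biUnion fun j => (near σ j).toFinset).erase i with hS
  have hne : ∀ j ∈ i :: near σ i, σ j ≠ ∅ := by
    intro j hj
    rcases List.mem_cons.1 hj with rfl | hj
    · exact hσ
    · exact (h.mem i hσ j hj).2.2
  have hcard : S.card ≤ (q + 1) * q := by
    refine Finset.card_erase_le.trans ((Finset.card_biUnion_le_card_mul _ _ q fun j hj => ?_).trans ?_)
    · exact (List.toFinset_card_le _).trans (h.le_q j (hne j (List.mem_toFinset.1 hj)))
    · refine Nat.mul_le_mul_right _ ((List.toFinset_card_le _).trans ?_)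
      simpa using h.le_q i hσ
  obtain ⟨m, h1, h2, h3⟩ := exists_modulus S hcard hi (by
    intro j hj
    obtain ⟨hji, hj⟩ := Finset.mem_erase.1 hj
    obtain ⟨a, ha, hj⟩ := Finset.mem_biUnion.1 hj
    exact ⟨(h.mem a (hne a (List.mem_toFinset.1 ha)) j (List.mem_toFinset.1 hj)).1, hji⟩)
  refine ⟨m, h1, h2, fun b hb hmod => ?_⟩
  by_contra hbi
  obtain ⟨j, hj, hbj⟩ := hb
  exact h3 b (Finset.mem_erase.2 ⟨hbi, Finset.mem_biUnion.2
    ⟨j, List.mem_toFinset.2 hj, List.mem_toFinset.2 hbj⟩⟩) hmod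

/-- One round of `colourSlot`: the variable `17` tells whether the modulus `m` fails. -/
theorem runs_testModulus {V u n q m i : ℕ} {s : Store k} {σ : ℕ → Cluster k} (hu : UnitCost V u)
    (hV : n + 1 ≤ V) (hnear : NearOK env.near n q σ) (hi : i < n) (hσi : σ i ≠ ∅) (hm : m ≤ V)
    (hσ : s.slot = σ) (h10 : s.nat 10 0 = i) (h12 : s.nat 12 0 = (env.near σ i).length)
    (h13 : s.nat 13 0 = m) (h17 : s.nat 17 0 = 0)
    (h11 : ∀ t < (i :: env.near σ i).length, s.nat 11 t = (i :: env.near σ i).getD t 0) :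
    Runs env (forLoop 14 (.add (var 12) (.const 1)) testList) s
      ((q + 1) * (2 * u + (u + env.W + q + (q * (7 * u) + 2 * u))) + 2 * u)
      ((q + 1) * (2 * u + (u + q + (q * (7 * u) + 2 * u))) + 2 * u)
      fun s' L => L = [] ∧ s'.slot = σ ∧ s'.real = s.real ∧ (∀ b < 14, s'.nat b = s.nat b) ∧
        s'.nat 17 0 ≤ 1 ∧ (s'.nat 17 0 = 0 ↔ Separates (env.near σ) i m) := by
  set l := i :: env.near σ i with hl
  have e0 : Nat.size 0 = 0 := by simp
  have e1 : Nat.size 1 = 1 := by simp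
  have hlen : (env.near σ i).length + 1 = l.length := by simp [hl]
  have hlq : l.length ≤ q + 1 := by rw [← hlen]; exact Nat.succ_le_succ (hnear.le_q i hσi)
  have hln : l.length ≤ n + 1 := by rw [← hlen]; exact Nat.succ_le_succ (hnear.le_n i hσi)
  have hgetD : ∀ t, t < l.length → l.getD t 0 ∈ l := fun t ht => by
    rw [List.getD_eq_getElem _ _ ht]; exact List.getElem_mem ht
  have hne : ∀ j ∈ l, j < n ∧ σ j ≠ ∅ := by
    intro j hj
    rcases List.mem_cons.1 hj with rfl | hj
    · exact ⟨hi, hσi⟩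
    · exact ⟨(hnear.mem i hσi j hj).1, (hnear.mem i hσi j hj).2.2⟩
  refine Runs.mono (Runs.forLoop (N := l.length) (cu := u) (fun j s' L => L = [] ∧ s'.slot = σ ∧
    s'.real = s.real ∧ (∀ b < 14, s'.nat b = s.nat b) ∧ s'.nat 14 0 = j ∧ s'.nat 17 0 ≤ 1 ∧
    (s'.nat 17 0 = 0 ↔ ∀ t < j, t < l.length → ∀ b ∈ env.near σ (l.getD t 0),
      b % m = i % m → b = i)) ?_ ?_ ?_ ?_ ?_) (Nat.add_le_add_right (Nat.mul_le_mul_right _ hlq) _)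
    (Nat.add_le_add_right (Nat.mul_le_mul_right _ hlq) _) fun _ _ h => h
  · dsimp only
    refine ⟨rfl, hσ, rfl, fun b hb => write_of_ne _ _ _ (by omega), by simp [write_apply], ?_, ?_⟩
    · rw [write_of_ne _ _ _ (by omega), h17]; omega
    · rw [write_of_ne _ _ _ (by omega), h17]; simp
  · intro j hj
    have := hu.size_le j (by omega)
    omega
  · rintro j hj s' L ⟨-, -, -, h4, h5, -, -⟩
    have h12' : s'.nat 12 0 = l.length - 1 := by rw [h4 12 (by omega), h12]; omega
    refine ⟨h5, by simp only [NExp.eval, h12']; omega, ?_⟩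
    have h6 : l.length - 1 + 1 = l.length := by omega
    simp only [NExp.cost, NExp.eval, h12', e0, e1, h6]
    have c1 := hu.size_le j (by omega)
    have c2 := hu.size_le l.length (by omega)
    have c3 := hu.size_le (l.length - 1) (by omega)
    omega
  · rintro j s' L hj ⟨rfl, h2, h3, h4, h5, h6, h7⟩
    have hjm := hne _ (hgetD j hj)
    refine (runs_testList hu hV (hnear.le_n _ hjm.2) (hnear.le_q _ hjm.2)
      (fun b hb => (hnear.mem _ hjm.2 b hb).1) hi hm hjm.1 h2 (by rw [h4 10 (by omega), h10])
      (by rw [h4 13 (by omega), h13]) (by omega) (by rw [h5, h4 11 (by omega), h11 j hj])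
      h6).mono le_rfl le_rfl ?_
    rintro s'' L' ⟨rfl, g2, g3, g4, g5, g6⟩
    refine ⟨by rw [g4 14 (by omega), h5], rfl, g2, g3.trans h3, fun b hb => ?_, by simp [write_apply],
      ?_, ?_⟩
    · dsimp only
      rw [write_of_ne _ _ _ (by omega), g4 b (by omega), h4 b hb]
    · dsimp only
      rwa [write_of_ne _ _ _ (by omega)]
    · dsimp only
      rw [write_of_ne _ _ _ (by omega), g6, h7]
      constructor
      · rintro ⟨k1, k2⟩ t ht htl
        rcases Nat.lt_succ_iff_lt_or_eq.1 ht with ht | rfl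
        · exact k1 t ht htl
        · exact k2
      · exact fun hall => ⟨fun t ht => hall t (by omega), hall j (by omega) hj⟩
  · rintro s' L ⟨rfl, h2, h3, h4, h5, h6, h7⟩
    refine ⟨rfl, h2, h3, h4, h6, h7.trans ⟨?_, ?_⟩⟩
    · rintro hall b ⟨a, ha, hb⟩
      obtain ⟨t, ht, rfl⟩ := List.getElem_of_mem ha
      have := hall t ht ht
      rw [List.getD_eq_getElem _ _ ht] at this
      exact this b hb
    · intro hsep t _ ht b hb
      exact hsep b ⟨_, hgetD t ht, hb⟩

theorem runs_colourSlot {V u n q Q i : ℕ} {s : Store k} {σ : ℕ → Cluster k} (hu : UnitCost V u)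
    (hV : n + 1 ≤ V) (hnear : NearOK env.near n q σ) (hi : i < n) (hσ : s.slot = σ)
    (hQ : 2 * ((Nat.log 2 n + 1) * ((q + 1) * q) + 4) + 1 ≤ Q) (hQV : Q * Q ≤ V)
    (h10 : s.nat 10 0 = i) (h3 : s.nat 3 0 = Q) (h6 : s.nat 6 i = 0 ↔ σ i ≠ ∅)
    (h6V : s.nat 6 i ≤ V) :
    Runs env colourSlot s
      (10 * u + env.W + q +
        Q * (4 * u + ((q + 1) * (2 * u + (u + env.W + q + (q * (7 * u) + 2 * u))) + 2 * u)))
      (10 * u + q + Q * (4 * u + ((q + 1) * (2 * u + (u + q + (q * (7 * u) + 2 * u))) + 2 * u)))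
      fun s' L => L = [] ∧ s'.slot = σ ∧ s'.real = s.real ∧
        (∀ b < 10, b ≠ 7 → s'.nat b = s.nat b) ∧ (∀ j, j ≠ i → s'.nat 7 j = s.nat 7 j) ∧
        (σ i = ∅ → s'.nat 7 i = 0) ∧ (σ i ≠ ∅ → ∃ m, 1 ≤ m ∧ m < Q ∧
          s'.nat 7 i = m * Q + i % m ∧ Separates (env.near σ) i m) := by
  have e0 : Nat.size 0 = 0 := by simp
  have e1 : Nat.size 1 = 1 := by simp
  have hQ1 : 9 ≤ Q := by omega
  have hQV' : Q ≤ V := le_trans (Nat.le_mul_self Q) hQV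
  have c0 := hu.size_le i (by omega)
  have c6 := hu.size_le _ h6V
  have cQ := hu.size_le Q hQV'
  have c1 := hu.size_le 1 (by omega)
  unfold colourSlot
  set l := i :: env.near σ i with hl
  refine Runs.mono (Runs.ite (cb := u) (w := 9 * u + env.W + q +
        Q * (4 * u + ((q + 1) * (2 * u + (u + env.W + q + (q * (7 * u) + 2 * u))) + 2 * u)))
      (t := 9 * u + q + Q * (4 * u + ((q + 1) * (2 * u + (u + q + (q * (7 * u) + 2 * u))) + 2 * u)))
      ?_ ?_ ?_) (by omega) (by omega) fun _ _ h => h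
  · simp only [BExp.cost, NExp.cost, NExp.eval, h10, e0, e1]
    omega
  swap
  · intro hb
    have hσi : σ i = ∅ := by
      by_contra hne
      simp [BExp.Holds, NExp.eval, h10, h6.2 hne] at hb
    refine Runs.setN ?_ ?_ ?_
    · simp only [NExp.cost, NExp.eval, h10, e0]
      omega
    · simp only [NExp.cost, NExp.eval, h10, e0]
      omega
    · simp only [NExp.eval, h10]
      refine ⟨trivial, hσ, trivial, fun b _ hb => write_of_ne _ _ _ hb, fun j hj => ?_, fun _ => ?_,
        fun hne => absurd hσi hne⟩ <;> simp [write_apply, *]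
  intro hb
  have hσi : σ i ≠ ∅ := h6.1 (by simpa [BExp.Holds, NExp.eval, h10] using hb)
  have cl := hu.size_le _ ((hnear.le_n i hσi).trans (by omega))
  have hlq := hnear.le_q i hσi
  refine Runs.mono (w := (u + env.W + q) + (u + (u + (u + (u + ((Q * (u +
      (u + (u + ((q + 1) * (2 * u + (u + env.W + q + (q * (7 * u) + 2 * u))) + 2 * u)))) + u) + u))))))
    (t := (u + q) + (u + (u + (u + (u + ((Q * (u +
      (u + (u + ((q + 1) * (2 * u + (u + q + (q * (7 * u) + 2 * u))) + 2 * u)))) + u) + u))))))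
    (Runs.seq (Runs.nn ?_ ?_ (Runs.seq (Runs.setN ?_ ?_ (Runs.seq (Runs.setN ?_ ?_
      (Runs.seq (Runs.setN ?_ ?_ (Runs.seq (Runs.setN ?_ ?_ (Runs.seq ?_)))))))))))
    ?_ ?_ fun _ _ h => h
  all_goals try
    simp only [NExp.cost, NExp.eval, h10, hσ, e0, e1, write_apply, writeList_zero, writeList_of_ne,
      ne_eq, List.nil_append, Nat.reduceEqDiff, not_false_eq_true, and_true, if_false]
  all_goals first | omega | skip
  rotate_left
  · have : Q * (u + (u + (u + ((q + 1) * (2 * u + (u + env.W + q + (q * (7 * u) + 2 * u))) + 2 * u)))) ≤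
      Q * (4 * u + ((q + 1) * (2 * u + (u + env.W + q + (q * (7 * u) + 2 * u))) + 2 * u)) := by
      exact Nat.mul_le_mul_left _ (by omega)
    omega
  · have : Q * (u + (u + (u + ((q + 1) * (2 * u + (u + q + (q * (7 * u) + 2 * u))) + 2 * u)))) ≤
      Q * (4 * u + ((q + 1) * (2 * u + (u + q + (q * (7 * u) + 2 * u))) + 2 * u)) := by
      exact Nat.mul_le_mul_left _ (by omega)
    omega
  obtain ⟨m₀, hm1, hm2, hm3⟩ := exists_separates hnear hi hσi
  refine Runs.loop (fun j s' L => L = [] ∧ s'.slot = σ ∧ s'.real = s.real ∧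
    (∀ b < 11, s'.nat b = s.nat b) ∧ s'.nat 12 0 = (env.near σ i).length ∧
    (∀ t < l.length, s'.nat 11 t = l.getD t 0) ∧ s'.nat 13 0 = j ∧ s'.nat 17 0 ≤ 1 ∧
    (s'.nat 17 0 = 0 → 1 ≤ j ∧ Separates (env.near σ) i j) ∧
    (s'.nat 17 0 ≠ 0 → j = 0 ∨ ¬ Separates (env.near σ) i j) ∧
    ∀ m, 1 ≤ m → m < j → ¬ Separates (env.near σ) i m) ?_ ?_ ?_ ?_
  · dsimp only
    refine ⟨rfl, rfl, rfl, fun b hb => ?_, ?_, ?_, ?_, ?_, ?_, fun _ => .inl rfl, fun m h1 h2 => ?_⟩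
    · simp only [write_of_ne _ _ _ (show b ≠ 17 by omega), write_of_ne _ _ _ (show b ≠ 13 by omega),
        write_of_ne _ _ _ (show b ≠ 11 by omega), write_of_ne _ _ _ (show b ≠ 12 by omega),
        writeList_of_ne _ _ (show b ≠ 11 by omega)]
    · simp [write_apply]
    · intro t ht
      rw [write_of_ne _ _ _ (by omega), write_of_ne _ _ _ (by omega), write_apply]
      cases t with
      | zero => simp [hl]
      | succ t =>
        rw [if_neg (by omega), write_of_ne _ _ _ (by omega),
          writeList_succ _ _ _ (by simpa [hl] using ht), hl, List.getD_cons_succ]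
    · simp [write_apply]
    · simp [write_apply]
    · simp [write_apply]
    · omega
  · rintro j s' L ⟨-, -, -, -, -, -, -, h17, -, -, -⟩
    have := hu.size_le _ (h17.trans (by omega))
    simp only [BExp.cost, NExp.cost, NExp.eval, e0]
    omega
  · rintro j s' L ⟨rfl, g2, g3, g4, g5, g6, g7, g8, g9, g10, g11⟩ hb
    have hjm : j < m₀ := by
      by_contra hle
      rcases Nat.lt_or_ge m₀ j with h | h
      · exact g11 m₀ hm1 h hm3
      · have : j = m₀ := by omega
        have hb : s'.nat 17 0 ≠ 0 := by simpa [BExp.Holds, NExp.eval, Nat.pos_iff_ne_zero] using hb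
        rcases g10 hb with h | h
        · omega
        · exact h (this ▸ hm3)
    have cj := hu.size_le j (by omega)
    have cj1 := hu.size_le (j + 1) (by omega)
    refine ⟨by omega, Runs.seq (Runs.setN ?_ ?_ (Runs.seq (Runs.setN ?_ ?_ ?_)))⟩
    all_goals try simp only [NExp.cost, NExp.eval, g7, e0, e1]
    all_goals first | omega | skip
    refine (runs_testModulus (m := j + 1) hu hV hnear hi hσi (by omega) ?_ ?_ ?_ ?_ ?_ ?_).mono
      le_rfl le_rfl ?_
    · exact g2
    · dsimp only
      rw [write_of_ne _ _ _ (by omega), write_of_ne _ _ _ (by omega), g4 10 (by omega), h10]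
    · dsimp only
      rw [write_of_ne _ _ _ (by omega), write_of_ne _ _ _ (by omega), g5]
    · simp [write_apply]
    · simp [write_apply]
    · intro t ht
      dsimp only
      rw [write_of_ne _ _ _ (by omega), write_of_ne _ _ _ (by omega), g6 t ht]
    · rintro s'' L' ⟨rfl, f2, f3, f4, f5, f6⟩
      refine ⟨rfl, f2, f3.trans g3, fun b hb => ?_, ?_, fun t ht => ?_, ?_, f5, ?_, ?_, ?_⟩
      · rw [f4 b (by omega)]
        dsimp only
        rw [write_of_ne _ _ _ (by omega), write_of_ne _ _ _ (by omega), g4 b hb]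
      · rw [f4 12 (by omega)]
        dsimp only
        rw [write_of_ne _ _ _ (by omega), write_of_ne _ _ _ (by omega), g5]
      · rw [f4 11 (by omega)]
        dsimp only
        rw [write_of_ne _ _ _ (by omega), write_of_ne _ _ _ (by omega), g6 t ht]
      · rw [f4 13 (by omega)]
        simp [write_apply]
      · exact fun h => ⟨by omega, f6.1 h⟩
      · exact fun h => .inr fun h' => h (f6.2 h')
      · intro m h1 h2
        rcases Nat.lt_succ_iff_lt_or_eq.1 h2 with h2 | rfl
        · exact g11 m h1 h2
        · have hb : s'.nat 17 0 ≠ 0 := by simpa [BExp.Holds, NExp.eval, Nat.pos_iff_ne_zero] using hb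
          exact (g10 hb).resolve_left (by omega)
  · rintro j s' L ⟨rfl, g2, g3, g4, g5, g6, g7, g8, g9, g10, g11⟩ hb
    have hb : s'.nat 17 0 = 0 := by simpa [BExp.Holds, NExp.eval] using hb
    obtain ⟨hj1, hj2⟩ := g9 hb
    have hjm : j ≤ m₀ := by
      by_contra hlt
      exact g11 m₀ hm1 (by omega) hm3
    have hjQ : j < Q := by omega
    have hmod : i % j < j := Nat.mod_lt _ (by omega)
    have hcol : j * Q + i % j ≤ V := by nlinarith
    have k1 := hu.size_le _ hcol
    have k2 := hu.size_le (j * Q) (by omega)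
    have k3 := hu.size_le (i % j) (by omega)
    have k4 := hu.size_le j (by omega)
    have g10' : s'.nat 10 0 = i := by rw [g4 10 (by omega), h10]
    have g3' : s'.nat 3 0 = Q := by rw [g4 3 (by omega), h3]
    refine Runs.setN ?_ ?_ ?_
    all_goals simp only [NExp.cost, NExp.eval, g7, g10', g3', e0]
    all_goals first | omega | skip
    refine ⟨rfl, g2, g3, fun b hb hb7 => ?_, fun a ha => ?_, fun h => absurd h hσi, fun _ =>
      ⟨j, hj1, hjQ, ?_, hj2⟩⟩
    · rw [write_of_ne _ _ _ hb7, g4 b (by omega)]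
    · rw [write_apply, if_neg (by simp [ha]), g4 7 (by omega)]
    · simp [write_apply]

end Colouring

section Growing

variable {k : ℕ}

/-! ### The program that performs a bounce-back path -/

/-- Merge the slot in the variable `10` with its nearest neighbour, if that is nearer than the current
threshold (the real variable `4`), and lower the threshold.  The variable `12` tells whether a merge
has been performed.  Thresholds are multiplied by the real variable `2`. -/
def growStep : Cmd :=
  .seq (.setN 12 (.const 0) (.const 0))
    (.seq (.nn 11 (var 10))
      (.ite (.ltN (.const 0) (var 11))
        (.ite (.ltR (.mul (.link (.slot (var 10)) (.slot (.cell 11 (.const 1)))) (.cell 2 (.const 0)))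
            (.cell 4 (.const 0)))
          (.seq (.setN 6 (.cell 11 (.const 1)) (.const 1))
            (.seq (.setN 7 (.cell 11 (.const 1)) (.const 0))
              (.seq (.setN 7 (var 10) (.const 0))
                (.seq (.merge (var 10) (.cell 11 (.const 1)))
                  (.seq (.setR 4 (.const 0) (.cell 1 (.const 0)))
                    (.setN 12 (.const 0) (.const 1)))))))
          .skip)
        .skip))

/-- If the colour of the slot in the variable `10` is the current one, perform its bounce-back path. -/
def growSlot : Cmd :=
  ifEq (.cell 7 (var 10)) (.add (var 8) (.const 1))
    (.seq (.setR 4 (.const 0) (.cell 3 (.const 0)))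
      (.seq (.setN 12 (.const 0) (.const 1)) (.loop (.ltN (.const 0) (var 12)) growStep)))

variable {d : Linkage k} {near : (ℕ → Cluster k) → ℕ → List ℕ} {W V u n q i z ℓ : ℕ} {ε θ N : ℝ}
  {σ : ℕ → Cluster k} {s : Store k} {p : Fin n → Pt k} {L₀ : Merges k}

theorem nearest_spec (hnear : FindsNearest d q near) (hq : 1 ≤ q) (hs : Slots n σ)
    {π : List ℕ} (hi : σ i ≠ ∅) :
    (near (applyPath σ i π) i).length ≤ q ∧ (near (applyPath σ i π) i).length ≤ n ∧
      (near (applyPath σ i π) i = [] → ∀ j, j ≠ i → j ∉ π → σ j = ∅) ∧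
      ∀ a l, near (applyPath σ i π) i = a :: l → a ≠ i ∧ a ∉ π ∧ σ a ≠ ∅ ∧
        ∀ j, j ≠ i → j ∉ π → σ j ≠ ∅ → d (acc σ i π) (σ a) ≤ d (acc σ i π) (σ j) := by
  set τ := applyPath σ i π with hτ
  have hτi : τ i = acc σ i π := by simp [hτ, applyPath]
  have hτj : ∀ j, j ≠ i → j ∉ π → τ j = σ j := fun j h1 h2 => by simp [hτ, applyPath, h1, h2]
  have hτne : ∀ j, τ j ≠ ∅ → j ≠ i → j ∉ π := fun j h1 h2 h3 => by
    simp [hτ, applyPath, h2, h3] at h1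
  have hin : τ i ≠ ∅ := by
    rw [hτi, ← Finset.nonempty_iff_ne_empty]
    exact (Finset.nonempty_iff_ne_empty.2 hi).mono (subset_acc _ _ _)
  have hlt : ∀ j, τ j ≠ ∅ → j < n := fun j hj => by
    by_cases hji : j = i
    · exact hji ▸ hs.lt hi
    · exact hs.lt (hτj j hji (hτne j hj hji) ▸ hj)
  obtain ⟨h1, h2, h3, h4, h5, h6⟩ := hnear τ i ((Set.finite_lt_nat n).subset hlt) hin
  refine ⟨h5, ?_, ?_, ?_⟩
  · have : (near τ i).toFinset ⊆ Finset.range n := fun b hb =>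
      Finset.mem_range.2 (hlt b (h2 b (List.mem_toFinset.1 hb)).2)
    simpa [List.toFinset_card_of_nodup h1] using Finset.card_le_card this
  · intro he j hj hjπ
    by_contra hne
    have := h6 (by rw [he]; exact hq) j hj (by rwa [hτj j hj hjπ])
    simp [he] at this
  · intro a l he
    obtain ⟨ha, hane⟩ := h2 a (by simp [he])
    have haπ := hτne a hane ha
    refine ⟨ha, haπ, hτj a ha haπ ▸ hane, fun j hj hjπ hjne => ?_⟩
    rw [← hτi, ← hτj a ha haπ, ← hτj j hj hjπ]
    by_cases hjl : j ∈ near τ i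
    · rw [he] at hjl h3
      rcases List.mem_cons.1 hjl with rfl | hjl
      · exact le_rfl
      · exact (List.pairwise_cons.1 h3).1 j hjl
    · exact h4 a (by simp [he]) j hjl hj (by rwa [hτj j hj hjπ])

/-- What one parallel branch of a stage does: it performs the path `π`. -/
structure Grown (d : Linkage k) (θ₁ θ : ℝ) (s : Store k) (i : ℕ) (π : List ℕ) (s' : Store k)
    (L : Merges k) : Prop where
  isPath : IsPath d θ₁ θ s.slot i π
  out : L = pathMerges s.slot i π
  slot : s'.slot = applyPath s.slot i π
  real : ∀ b, b ≠ 4 → s'.real b = s.real b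
  nat : ∀ b < 10, b ≠ 6 → b ≠ 7 → s'.nat b = s.nat b
  dead : ∀ j, s'.nat 6 j = if j ∈ π then 1 else s.nat 6 j
  col : ∀ j, s'.nat 7 j = if π ≠ [] ∧ (j = i ∨ j ∈ π) then 0 else s.nat 7 j

theorem Grown.refl (d : Linkage k) (θ₁ θ : ℝ) (s : Store k) (i : ℕ) :
    Grown d θ₁ θ s i [] s [] := by
  constructor <;> simp [IsPath.nil]

/-- The path cannot be continued. -/
def Stopped (d : Linkage k) (θ₁ θ : ℝ) (σ : ℕ → Cluster k) (i : ℕ) (π : List ℕ) : Prop :=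
  ∀ j, j ≠ i → j ∉ π → σ j ≠ ∅ → (if π.length = 0 then θ₁ else θ) ≤ d (acc σ i π) (σ j)

theorem runs_growStep {s' : Store k} {L : Merges k} {π : List ℕ} (hu : UnitCost V u)
    (hV : n + 1 ≤ V) (hnear : FindsNearest d q near) (hq : 1 ≤ q) (hs : Slots n s.slot) (hN : 0 < N)
    (hi : i < n) (hσi : s.slot i ≠ ∅) (r1 : s.real 1 0 = θ * N) (r2 : s.real 2 0 = N)
    (hg : Grown d ((1 + ε) * θ) θ s i π s' L) (g10 : s'.nat 10 0 = i)
    (g4 : s'.real 4 0 = (if π.length = 0 then (1 + ε) * θ else θ) * N) :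
    Runs ⟨d, near, W⟩ growStep s' (11 * u + 2 * W + q) (11 * u + q) fun s'' L' =>
      ∃ π', Grown d ((1 + ε) * θ) θ s i π' s'' (L ++ L') ∧ (s''.nat 10 0 = i) ∧
        s''.real 4 0 = (if π'.length = 0 then (1 + ε) * θ else θ) * N ∧ s''.nat 12 0 ≤ 1 ∧
        (s''.nat 12 0 ≠ 0 → π'.length = π.length + 1) ∧
        (s''.nat 12 0 = 0 → Stopped d ((1 + ε) * θ) θ s.slot i π') := by
  have e0 : Nat.size 0 = 0 := by simp
  have e1 : Nat.size 1 = 1 := by simp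
  have c0 := hu.size_le 0 (by omega)
  have c1 := hu.size_le i (by omega)
  obtain ⟨n1, n2, n3, n4⟩ := nearest_spec (π := π) hnear hq hs hσi
  have cl := hu.size_le _ (n2.trans (by omega))
  -- The case in which no merge takes place.
  have hstay : ∀ l, Stopped d ((1 + ε) * θ) θ s.slot i π → ∃ π',
      Grown d ((1 + ε) * θ) θ s i π'
        { s' with nat := writeList (write s'.nat 12 0 0) 11 l } L ∧
      writeList (write s'.nat 12 0 0) 11 l 10 0 = i ∧
      s'.real 4 0 = (if π'.length = 0 then (1 + ε) * θ else θ) * N ∧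
      writeList (write s'.nat 12 0 0) 11 l 12 0 ≤ 1 ∧
      (writeList (write s'.nat 12 0 0) 11 l 12 0 ≠ 0 → π'.length = π.length + 1) ∧
      (writeList (write s'.nat 12 0 0) 11 l 12 0 = 0 →
        Stopped d ((1 + ε) * θ) θ s.slot i π') := by
    intro l hst
    refine ⟨π, ⟨hg.isPath, hg.out, hg.slot, hg.real, fun b hb h6 h7 => ?_, fun j => ?_,
      fun j => ?_⟩, ?_, g4, ?_, ?_, fun _ => hst⟩
    · dsimp only
      rw [writeList_of_ne _ _ (by omega), write_of_ne _ _ _ (by omega)]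
      exact hg.nat b hb h6 h7
    · dsimp only
      rw [writeList_of_ne _ _ (by omega), write_of_ne _ _ _ (by omega)]
      exact hg.dead j
    · dsimp only
      rw [writeList_of_ne _ _ (by omega), write_of_ne _ _ _ (by omega)]
      exact hg.col j
    · rw [writeList_of_ne _ _ (by omega), write_of_ne _ _ _ (by omega), g10]
    · rw [writeList_of_ne _ _ (by omega)]
      simp [write_apply]
    · rw [writeList_of_ne _ _ (by omega)]
      simp [write_apply]
  refine Runs.mono (w := u + (u + W + q + (u + (u + (u + (u + (u + (u + W + (u + u)))))))))
    (t := u + (u + q + (u + (u + (u + (u + (u + (u + (u + u)))))))))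
    (Runs.seq (Runs.setN ?_ ?_ (Runs.seq (Runs.nn ?_ ?_ (Runs.ite ?_ (fun hb1 => Runs.ite ?_
      (fun hb2 => ?_) fun hb2 => Runs.skip ?_ ?_ ?_) fun hb1 => Runs.skip ?_ ?_ ?_)))))
    (by omega) (by omega) fun _ _ h => h
  all_goals try simp only [BExp.cost, NExp.cost, RExp.cost, CExp.cost, NExp.eval, write_apply,
    writeList_zero, g10, hg.slot, e0, e1, Nat.reduceEqDiff, if_false, and_true,
    List.nil_append, List.append_nil]
  all_goals first | omega | skip
  all_goals simp only [BExp.Holds, NExp.eval, write_apply, g10, hg.slot, writeList_zero,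
    Nat.reduceEqDiff, false_and, if_false] at hb1
  rotate_right
  · -- No other cluster is left.
    have hnil : near (applyPath s.slot i π) i = [] := by
      rw [← List.length_eq_zero_iff]; omega
    have := hstay (near (applyPath s.slot i π) i) fun j hj hjπ hjne =>
      absurd (n3 hnil j hj hjπ) hjne
    simpa only [hg.slot] using this
  all_goals
    obtain ⟨a, l, hal⟩ : ∃ a l, near (applyPath s.slot i π) i = a :: l := by
      cases h : near (applyPath s.slot i π) i with
      | nil => simp [h] at hb1
      | cons a l => exact ⟨a, l, rfl⟩
    obtain ⟨a1, a2, a3, a4⟩ := n4 a l hal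
    have h11 : writeList (write s'.nat 12 0 0) 11 (near (applyPath s.slot i π) i) 11 1 = a := by
      rw [hal]
      exact writeList_succ _ _ _ (by simp)
    have c11 := hu.size_le a ((hs.lt a3).le.trans (by omega))
  · rw [h11, writeList_of_ne _ _ (by omega), write_of_ne _ _ _ (by omega), g10]
    omega
  all_goals
    simp only [BExp.Holds, RExp.eval, CExp.eval, NExp.eval, write_apply, g10, hg.slot, h11,
      writeList_of_ne, ne_eq, Nat.reduceEqDiff, not_false_eq_true, false_and, if_false] at hb2
    have hri : applyPath s.slot i π i = acc s.slot i π := by simp [applyPath]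
    have hra : applyPath s.slot i π a = s.slot a := by simp [applyPath, a1, a2]
    rw [hri, hra, hg.real 2 (by omega), r2, g4, mul_lt_mul_iff_left₀ hN] at hb2
  · refine Runs.seq (Runs.setN ?_ ?_ (Runs.seq (Runs.setN ?_ ?_ (Runs.seq (Runs.setN ?_ ?_
      (Runs.seq (Runs.merge ?_ ?_ (Runs.seq (Runs.setR ?_ ?_ (Runs.setN ?_ ?_ ?_))))))))))
    all_goals simp only [NExp.cost, RExp.cost, NExp.eval, RExp.eval, g10, h11, e0, e1,
      writeList_of_ne, ne_eq, Nat.reduceEqDiff, not_false_eq_true, List.nil_append,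
      List.append_nil, write_apply, Nat.reduceEqDiff, false_and, if_false]
    all_goals first | omega | skip
    simp only [Store.merge]
    refine ⟨π ++ [a], ⟨hg.isPath.snoc a2 a1 a3 (fun j h1 h2 h3 => a4 j h1 h2 h3) hb2, ?_, ?_, ?_, ?_,
      ?_, ?_⟩, ?_, ?_, ?_, ?_, ?_⟩
    · rw [hg.out, pathMerges_snoc, hri, hra]
    · exact (applyPath_snoc a2 a1).symm
    · intro b hb
      dsimp only
      rw [write_of_ne _ _ _ hb]
      exact hg.real b hb
    · intro b hb h6 h7
      dsimp only
      rw [write_of_ne _ _ _ (by omega), write_of_ne _ _ _ h7, write_of_ne _ _ _ h7,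
        write_of_ne _ _ _ h6, writeList_of_ne _ _ (by omega), write_of_ne _ _ _ (by omega)]
      exact hg.nat b hb h6 h7
    · intro j
      simp only [write_apply, writeList_of_ne, hg.dead, ne_eq, Nat.reduceEqDiff, not_false_eq_true,
        false_and, if_false, true_and, List.mem_append, List.mem_singleton]
      by_cases hja : j = a <;> simp [hja]
    · intro j
      simp only [write_apply, writeList_of_ne, hg.col, ne_eq, Nat.reduceEqDiff, not_false_eq_true,
        false_and, if_false, true_and, List.mem_append, List.mem_singleton]
      by_cases hja : j = a
      · simp [hja]
      · by_cases hji : j = i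
        · simp [hji]
        · by_cases hjπ : j ∈ π
          · simp [hjπ, List.ne_nil_of_mem hjπ]
          · simp [hja, hji, hjπ]
    · simp [write_apply, writeList_of_ne, g10]
    · simp [hg.real, r1]
    · simp
    · simp
    · simp
  · have := hstay (near (applyPath s.slot i π) i) fun j hj hjπ hjne =>
      (not_lt.1 hb2).trans (a4 j hj hjπ hjne)
    simpa only [hg.slot] using this

theorem runs_growSlot (hu : UnitCost V u) (hV : n + 1 ≤ V) (hnear : FindsNearest d q near)
    (hq : 1 ≤ q) (hbb : BounceBackLengthLE d ε p ℓ) (hr : Reach d (1 + ε) p L₀ s.slot) (hθ : 0 < θ)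
    (hsep : Sep d θ s.slot) (hN : 0 < N) (hi : i < n) (h10 : s.nat 10 0 = i) (h8 : s.nat 8 0 = z)
    (hz : z + 1 ≤ V) (hcolV : s.nat 7 i ≤ V) (hcol : s.nat 7 i = z + 1 → s.slot i ≠ ∅)
    (r1 : s.real 1 0 = θ * N) (r2 : s.real 2 0 = N) (r3 : s.real 3 0 = (1 + ε) * θ * N) :
    Runs ⟨d, near, W⟩ growSlot s (6 * u + (ℓ + 1) * (12 * u + 2 * W + q))
      (6 * u + (ℓ + 1) * (12 * u + q)) fun s' L => ∃ π, Grown d ((1 + ε) * θ) θ s i π s' L ∧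
        (π ≠ [] → s.nat 7 i = z + 1) ∧
        (s.nat 7 i = z + 1 → Stopped d ((1 + ε) * θ) θ s.slot i π) := by
  have e0 : Nat.size 0 = 0 := by simp
  have e1 : Nat.size 1 = 1 := by simp
  have c0 := hu.size_le 0 (by omega)
  have c1 := hu.size_le i (by omega)
  have c2 := hu.size_le z (by omega)
  have c3 := hu.size_le (z + 1) hz
  have c4 := hu.size_le _ hcolV
  refine Runs.mono (w := u + (u + (u + (u + ((ℓ + 1) * (u + (11 * u + 2 * W + q)) + u)))))
    (t := u + (u + (u + (u + ((ℓ + 1) * (u + (11 * u + q)) + u)))))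
    (Runs.ifEq ?_ ?_ ?_ (fun he => Runs.seq (Runs.setR ?_ ?_ (Runs.seq (Runs.setN ?_ ?_ ?_))))
      fun hne => ?_) ?_ ?_ fun _ _ h => h
  all_goals try simp only [NExp.cost, RExp.cost, NExp.eval, h10, h8, e0, e1]
  all_goals first | omega | skip
  rotate_left
  · simp only [NExp.eval, h10, h8] at hne
    exact ⟨[], Grown.refl _ _ _ _ _, by simp, fun h => absurd h hne⟩
  · have : (ℓ + 1) * (u + (11 * u + 2 * W + q)) ≤
      (ℓ + 1) * (12 * u + 2 * W + q) := Nat.mul_le_mul_left _ (by omega)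
    omega
  · have : (ℓ + 1) * (u + (11 * u + q)) ≤
      (ℓ + 1) * (12 * u + q) := Nat.mul_le_mul_left _ (by omega)
    omega
  simp only [NExp.eval, h10, h8] at he
  have hσi := hcol he
  have hs := hr.slots
  refine Runs.loop (fun j s' L => ∃ π, Grown d ((1 + ε) * θ) θ s i π s' L ∧ (s'.nat 10 0 = i) ∧
    s'.real 4 0 = (if π.length = 0 then (1 + ε) * θ else θ) * N ∧ s'.nat 12 0 ≤ 1 ∧
    (s'.nat 12 0 ≠ 0 → π.length = j) ∧
    (s'.nat 12 0 = 0 → Stopped d ((1 + ε) * θ) θ s.slot i π)) ?_ ?_ ?_ ?_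
  · refine ⟨[], ⟨IsPath.nil _ _ _ _ _, rfl, by simp, ?_, ?_, ?_, ?_⟩, ?_, ?_, ?_, ?_, ?_⟩
    · intro b hb
      exact write_of_ne _ _ _ hb
    · intro b hb _ _
      exact write_of_ne _ _ _ (by omega)
    · simp [write_apply]
    · simp [write_apply]
    · simpa [write_apply] using h10
    · simp [write_apply, RExp.eval, NExp.eval, r3]
    · simp [write_apply]
    · simp [write_apply]
    · simp [write_apply]
  · rintro j s' L ⟨π, hg, -, -, h12, -, -⟩
    have := hu.size_le _ (h12.trans (by omega))
    simp only [BExp.cost, NExp.cost, NExp.eval, e0]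
    omega
  · rintro j s' L ⟨π, hg, g10, g4, g12, glen, -⟩ hb
    have hb : s'.nat 12 0 ≠ 0 := by simpa [BExp.Holds, NExp.eval, Nat.pos_iff_ne_zero] using hb
    have glen := glen hb
    have hlen : π.length ≤ ℓ := hg.isPath.length_le hbb hr hθ hsep hσi
    refine ⟨by omega, ?_⟩
    refine (runs_growStep (W := W) hu hV hnear hq hs hN hi hσi r1 r2 hg g10 g4).mono (by omega)
      (by omega) ?_
    rintro s'' L' ⟨π', h1, h2, h3, h4, h5, h6⟩
    exact ⟨π', h1, h2, h3, h4, fun h => by rw [h5 h, glen], h6⟩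
  · rintro j s' L ⟨π, hg, g10, g4, g12, glen, gend⟩ hb
    have hb : s'.nat 12 0 = 0 := by simpa [BExp.Holds, NExp.eval] using hb
    exact ⟨π, hg, fun _ => he, fun _ => gend hb⟩

end Growing

section Phases

variable {k n : ℕ}

/-! ### Stages, passes and phases -/

/-- The standing assumptions of the analysis: `q` is the number of neighbours that the subroutine
returns, `Q` a bound for the moduli, `V` one for the numbers that the program handles, `u` one for
the cost of an elementary step, and real thresholds are multiplied by `N`. -/
structure Setting (d : Linkage k) (near : (ℕ → Cluster k) → ℕ → List ℕ) (ε N : ℝ)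
    (p : Fin n → Pt k) (K E ℓ h q Q V u : ℕ) : Prop where
  metricish : Metricish K d
  K_pos : 1 ≤ K
  ε_pos : 0 < ε
  ε_le : 1 + ε ≤ E
  ℓ_pos : 1 ≤ ℓ
  q_pos : 1 ≤ q
  n_pos : 1 ≤ n
  N_pos : 0 < N
  bounce : BounceBackLengthLE d ε p ℓ
  finds : FindsNearest d q near
  height : ∀ L, IsApproxHAC d (1 + ε) p L → dendrogramHeight p L ≤ h
  pack : ∀ θ : ℝ, 0 < θ → ((K * (Nat.log 2 n + 1) ^ K : ℕ) : ℝ) *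
    (2 * (conflictRadius K E ℓ θ / θ)) ^ (K * k) ≤ q
  unit : UnitCost V u
  n_le : n + 1 ≤ V
  le_Q : 2 * ((Nat.log 2 n + 1) * ((q + 1) * q) + 4) + 1 ≤ Q
  Q_le : Q * Q + 1 ≤ V

/-- The part of the memory that does not change during the main loop, and a bound for the marks of
the free slots.  Here `H` is the smaller one of `h` and `n`. -/
structure Mem (n H q Q : ℕ) (ε N : ℝ) (s : Store k) : Prop where
  size : s.nat 0 0 = n
  lists : s.nat 1 0 = q
  height : s.nat 2 0 = H
  modulus : s.nat 3 0 = Q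
  eps : s.real 0 0 = ε
  scale : s.real 2 0 = N
  dead_le : ∀ j, s.nat 6 j ≤ 1

variable {d : Linkage k} {near : (ℕ → Cluster k) → ℕ → List ℕ} {ε N θ : ℝ} {p : Fin n → Pt k}
  {K E ℓ h q Q V u W H : ℕ}

/-- Work of a branch of a colouring step; with `W = 0` this is its depth. -/
def colourCost (u q Q W : ℕ) : ℕ :=
  10 * u + W + q +
    Q * (4 * u + ((q + 1) * (2 * u + (u + W + q + (q * (7 * u) + 2 * u))) + 2 * u))

/-- Work of a branch of a stage; with `W = 0` this is its depth. -/
def growCost (u q ℓ W : ℕ) : ℕ := 6 * u + (ℓ + 1) * (12 * u + 2 * W + q)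

/-- If two slots of the same colour were within two steps in the lists of neighbours, they would be
congruent modulo a modulus that separates them. -/
theorem runs_colour (S : Setting d near ε N p K E ℓ h q Q V u) {s : Store k} {L₀ : Merges k}
    (hm : Mem n H q Q ε N s) (hst : StateInv d ε θ p s.slot (s.nat 6) L₀) (hθ : 0 < θ) :
    Runs ⟨d, near, W⟩ (.par 10 (var 0) colourSlot) s (u + n * (1 + colourCost u q Q W))
      (u + colourCost u q Q 0) fun s' L => L = [] ∧ s'.slot = s.slot ∧ s'.real = s.real ∧
        (∀ b < 10, b ≠ 7 → s'.nat b = s.nat b) ∧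
        PassData d near K E ℓ θ s.slot (s'.nat 7) ∧
        (∀ j < n, s'.nat 7 j ≤ Q * Q) ∧ ∀ j < n, s'.nat 7 j = 0 ↔ s.slot j = ∅ := by
  have e0 : Nat.size 0 = 0 := by simp
  have hs := hst.reach.slots
  have hok := S.finds.nearOK hs
  have hn := S.n_le
  have hQV := S.Q_le
  have cn := S.unit.size_le n (by omega)
  have hev : (var 0).eval s = n := hm.size
  refine Runs.mono (Runs.par (ce := u) (w := colourCost u q Q W) (t := colourCost u q Q 0)
    (fun i s' L => L = [] ∧ s'.slot = s.slot ∧ s'.real = s.real ∧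
        (∀ b < 10, b ≠ 7 → s'.nat b = s.nat b) ∧ (∀ j, j ≠ i → s'.nat 7 j = s.nat 7 j) ∧
        (s.slot i = ∅ → s'.nat 7 i = 0) ∧ (s.slot i ≠ ∅ → ∃ m, 1 ≤ m ∧ m < Q ∧
          s'.nat 7 i = m * Q + i % m ∧ Separates (near s.slot) i m)) ?_ ?_ ?_)
    (by rw [hev]) le_rfl fun _ _ h => h
  · simp only [NExp.cost, NExp.eval, hm.size, e0]
    omega
  · intro i hi
    rw [hev] at hi
    refine (runs_colourSlot (s := { s with nat := write s.nat 10 0 i })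
      (env := ⟨d, near, W⟩) (i := i) (Q := Q) S.unit hn hok hi rfl S.le_Q
      (by omega) (by simp [write_apply]) ?_ ?_ ?_).mono (by simp [colourCost])
      (by simp [colourCost]) ?_
    · simpa [write_apply] using hm.modulus
    · simpa [write_apply] using hst.dead_iff i hi
    · have := hm.dead_le i
      simp only [write_apply, Nat.reduceEqDiff, false_and, if_false]
      omega
    · rintro s' L ⟨rfl, h2, h3, h4, h5, h6, h7⟩
      refine ⟨rfl, h2, h3, fun b hb h7 => ?_, fun j hj => ?_, h6, h7⟩
      · rw [h4 b hb h7]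
        exact write_of_ne _ _ _ (by omega)
      · rw [h5 j hj]
        simp [write_apply]
  · intro s' L hR
    rw [hev] at hR ⊢
    have hcol : ∀ j < n, (s.join n s').nat 7 j = (s' j).nat 7 j := fun j hj =>
      joinCell_of_unique hj fun i hi hij => (hR i hi).2.2.2.2.1 j hij.symm
    have hQ : 9 ≤ Q := by have := S.le_Q; omega
    refine ⟨?_, ?_, ?_, ?_, ⟨?_, ?_⟩, ?_, ?_⟩
    · rw [List.flatMap_eq_nil_iff]
      exact fun i hi => (hR i (List.mem_range.1 hi)).1
    · ext1 j
      exact joinCell_of_forall fun i hi => by rw [(hR i hi).2.1]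
    · ext a j
      exact joinCell_of_forall fun i hi => by rw [(hR i hi).2.2.1]
    · intro b hb h7
      ext1 j
      exact joinCell_of_forall fun i hi => by rw [(hR i hi).2.2.2.1 b hb h7]
    · intro i j hij hi hj hle
      have hP := le_pathRadius (K := K) (E := E) S.ℓ_pos hθ.le
      have hK : (1 : ℝ) ≤ K := by exact_mod_cast S.K_pos
      have hε := S.ε_pos
      have hE := S.ε_le
      refine mem_near S.metricish S.finds hs (fun j => ?_) hst.sep hθ ?_ (S.pack θ hθ) hij hi hj hle
      · refine (Finset.card_le_card (hst.reach.sub j)).trans (Finset.card_image_le.trans ?_)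
        simp
      · have h1 : θ ≤ pathRadius K E ℓ θ := by nlinarith
        have h2 : (1 : ℝ) ≤ 3 * K ^ 2 := by nlinarith
        unfold conflictRadius
        nlinarith
    · intro b b' hbb hb hb' he htwo
      obtain ⟨m, m1, m2, m3, m4⟩ := (hR b (hs.lt hb)).2.2.2.2.2.2 hb
      obtain ⟨m', m1', m2', m3', m4'⟩ := (hR b' (hs.lt hb')).2.2.2.2.2.2 hb'
      rw [hcol b (hs.lt hb), hcol b' (hs.lt hb'), m3, m3'] at he
      have l1 : b % m < Q := (Nat.mod_lt _ m1).trans m2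
      have l2 : b' % m' < Q := (Nat.mod_lt _ m1').trans m2'
      have d1 : (m * Q + b % m) / Q = m := by
        rw [mul_comm, Nat.mul_add_div (by omega), Nat.div_eq_of_lt l1, add_zero]
      have d2 : (m' * Q + b' % m') / Q = m' := by
        rw [mul_comm, Nat.mul_add_div (by omega), Nat.div_eq_of_lt l2, add_zero]
      have hmm : m = m' := by rw [← d1, he, d2]
      subst hmm
      exact hbb (m4 b' htwo (by omega)).symm
    · intro j hj
      rw [hcol j hj]
      by_cases hne : s.slot j = ∅
      · rw [(hR j hj).2.2.2.2.2.1 hne]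
        omega
      · obtain ⟨m, m1, m2, m3, -⟩ := (hR j hj).2.2.2.2.2.2 hne
        have l1 : j % m < Q := (Nat.mod_lt _ m1).trans m2
        rw [m3]
        nlinarith
    · intro j hj
      rw [hcol j hj]
      by_cases hne : s.slot j = ∅
      · simp [(hR j hj).2.2.2.2.2.1 hne, hne]
      · obtain ⟨m, m1, m2, m3, -⟩ := (hR j hj).2.2.2.2.2.2 hne
        simp only [m3, hne, iff_false]
        have : 1 ≤ m * Q := Nat.mul_pos m1 (by omega)
        omega

theorem runs_stage (S : Setting d near ε N p K E ℓ h q Q V u) {s : Store k} {L₀ : Merges k}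
    {t z : ℕ} {σ₀ : ℕ → Cluster k} {col₀ : ℕ → ℕ} (hm : Mem n H q Q ε N s)
    (h0 : PassData d near K E ℓ θ σ₀ col₀) (hθ : 0 < θ)
    (hst : PassInv d ε θ p (pathRadius K E ℓ θ) t σ₀ col₀ z s.slot (s.nat 6) (s.nat 7) L₀)
    (hcol₀ : ∀ j < n, col₀ j ≤ Q * Q) (h8 : s.nat 8 0 = z) (hz : z < Q * Q)
    (r1 : s.real 1 0 = θ * N) (r3 : s.real 3 0 = (1 + ε) * θ * N) :
    Runs ⟨d, near, W⟩ (.par 10 (var 0) growSlot) s (u + n * (1 + growCost u q ℓ W))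
      (u + growCost u q ℓ 0) fun s' L => (∀ b, b ≠ 4 → s'.real b = s.real b) ∧
        (∀ b < 10, b ≠ 6 → b ≠ 7 → s'.nat b = s.nat b) ∧ (∀ j, s'.nat 6 j ≤ 1) ∧
        PassInv d ε θ p (pathRadius K E ℓ θ) t σ₀ col₀ (z + 1) s'.slot (s'.nat 6) (s'.nat 7)
          (L₀ ++ L) := by
  have e0 : Nat.size 0 = 0 := by simp
  have hn := S.n_le
  have hQV := S.Q_le
  have cn := S.unit.size_le n (by omega)
  have hev : (var 0).eval s = n := hm.size
  refine Runs.mono (Runs.par (ce := u) (w := growCost u q ℓ W) (t := growCost u q ℓ 0)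
    (fun i s' L => ∃ π, Grown d ((1 + ε) * θ) θ { s with nat := write s.nat 10 0 i } i π s' L ∧
        (π ≠ [] → s.nat 7 i = z + 1) ∧
        (s.nat 7 i = z + 1 → Stopped d ((1 + ε) * θ) θ s.slot i π)) ?_ ?_ ?_)
    (by rw [hev]) le_rfl fun _ _ h => h
  · simp only [NExp.cost, NExp.eval, hm.size, e0]
    omega
  · intro i hi
    rw [hev] at hi
    have w7 : (write s.nat 10 0 i) 7 = s.nat 7 := write_of_ne _ _ _ (by omega)
    have hcolV : s.nat 7 i ≤ Q * Q := by
      by_cases hc : s.nat 7 i = 0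
      · omega
      · rw [(hst.unchanged i hi hc).1]
        exact hcol₀ i hi
    refine (runs_growSlot (s := { s with nat := write s.nat 10 0 i }) (W := W) (z := z) S.unit hn
      S.finds S.q_pos S.bounce hst.reach hθ hst.sep S.N_pos hi (by simp [write_apply])
      (by simpa [write_apply] using h8) (by omega) (by simp only [w7]; omega) ?_ r1 hm.scale
      r3).mono (by simp [growCost]) (by simp [growCost]) ?_
    · simp only [w7]
      exact fun he => (hst.unchanged i hi (by omega)).2.2
    · simp only [w7]
      exact fun _ _ h => h
  · intro s' L hR
    rw [hev] at hR ⊢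
    choose! π hG hcol hend using hR
    set π' : ℕ → List ℕ := fun b => if b < n then π b else [] with hπ'
    have hlt : ∀ b, π' b ≠ [] → b < n ∧ π' b = π b := by
      intro b hb
      by_cases hbn : b < n
      · exact ⟨hbn, by simp [hπ', hbn]⟩
      · simp [hπ', hbn] at hb
    have heq : ∀ b < n, π' b = π b := fun b hb => by simp [hπ', hb]
    have key := hst.stage (π := π') S.metricish S.K_pos S.ε_pos S.ε_le S.ℓ_pos hθ S.bounce h0
      (fun b hb => (hlt b hb).1) (fun b hb => by
        obtain ⟨hbn, he⟩ := hlt b hb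
        rw [he] at hb ⊢
        refine ⟨hcol b hbn hb, (hG b hbn).isPath, ?_⟩
        have := hend b hbn (hcol b hbn hb)
        unfold Stopped at this
        rwa [if_neg (by simpa using hb)] at this)
      (fun b hbn hc hnil j hj hjne => by
        rw [heq b hbn] at hnil
        have := hend b hbn hc j hj (by simp [hnil]) hjne
        simpa [hnil] using this)
    have hslot : (s.join n s').slot = joinSlots s.slot π' n := by
      ext1 j
      exact joinCell_congr fun b hb => by rw [(hG b hb).slot, heq b hb]
    have hdead : (s.join n s').nat 6 =
        fun j => joinCell n (s.nat 6 j) fun b => if j ∈ π' b then 1 else s.nat 6 j := by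
      ext1 j
      refine joinCell_congr fun b hb => ?_
      rw [(hG b hb).dead, heq b hb]
      simp [write_apply]
    have hcols : (s.join n s').nat 7 =
        fun j => joinCell n (s.nat 7 j) fun b => if Touches π' b j then 0 else s.nat 7 j := by
      ext1 j
      refine joinCell_congr fun b hb => ?_
      rw [(hG b hb).col, Touches, heq b hb]
      simp [write_apply]
    have hout : (List.range n).flatMap L =
        (List.range n).flatMap fun b => pathMerges s.slot b (π' b) := by
      refine List.flatMap_congr fun b hb => ?_
      rw [(hG b (List.mem_range.1 hb)).out, heq b (List.mem_range.1 hb)]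
    refine ⟨fun b hb => ?_, fun b hb h6 h7 => ?_, fun j => ?_, ?_⟩
    · ext1 j
      exact joinCell_of_forall fun i hi => by rw [(hG i hi).real b hb]
    · ext1 j
      refine joinCell_of_forall fun i hi => ?_
      rw [(hG i hi).nat b hb h6 h7]
      exact congrFun (write_of_ne _ _ _ (by omega)) j
    · have hd := hm.dead_le j
      rw [hdead]
      rcases joinCell_mem n (s.nat 6 j) fun b => if j ∈ π' b then 1 else s.nat 6 j
        with he | ⟨i, _, he⟩
      · simp only [he]; exact hd
      · simp only [he]; split_ifs <;> omega
    · rw [hslot, hdead, hcols, hout]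
      exact key

/-- Colour the clusters, and treat the colours one after the other. -/
def passCmd : Cmd :=
  .seq (.par 10 (var 0) colourSlot) (forLoop 8 (.mul (var 3) (var 3)) (.par 10 (var 0) growSlot))

/-- Work of a pass; with `m = 1` and `W = 0` this bounds its depth. -/
def passCost (u q Q ℓ W m : ℕ) : ℕ :=
  (u + m * (1 + colourCost u q Q W)) +
    (Q * Q * (2 * u + (u + m * (1 + growCost u q ℓ W))) + 2 * u)

theorem Mem.of_eq {s s' : Store k} (hm : Mem n H q Q ε N s) (h1 : ∀ b < 4, s'.nat b = s.nat b)
    (h2 : s'.real 0 = s.real 0) (h3 : s'.real 2 = s.real 2) (h4 : ∀ j, s'.nat 6 j ≤ 1) :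
    Mem n H q Q ε N s' where
  size := by rw [h1 0 (by omega), hm.size]
  lists := by rw [h1 1 (by omega), hm.lists]
  height := by rw [h1 2 (by omega), hm.height]
  modulus := by rw [h1 3 (by omega), hm.modulus]
  eps := by rw [h2, hm.eps]
  scale := by rw [h3, hm.scale]
  dead_le := h4

/-- A pass adds one to the number of merges that some point of every close pair has taken part in. -/
theorem runs_pass (S : Setting d near ε N p K E ℓ h q Q V u) {s : Store k} {L₀ : Merges k}
    {t : ℕ} (hm : Mem n H q Q ε N s) (hst : StateInv d ε θ p s.slot (s.nat 6) L₀) (hθ : 0 < θ)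
    (hdeep : CloseDeep d ((1 + ε) * θ) t s.slot L₀)
    (r1 : s.real 1 0 = θ * N) (r3 : s.real 3 0 = (1 + ε) * θ * N) :
    Runs ⟨d, near, W⟩ passCmd s (passCost u q Q ℓ W n) (passCost u q Q ℓ 0 1) fun s' L =>
      (∀ b, b ≠ 4 → s'.real b = s.real b) ∧ (∀ b < 6, s'.nat b = s.nat b) ∧
        Mem n H q Q ε N s' ∧ StateInv d ε θ p s'.slot (s'.nat 6) (L₀ ++ L) ∧
        CloseDeep d ((1 + ε) * θ) (t + 1) s'.slot (L₀ ++ L) := by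
  have e0 : Nat.size 0 = 0 := by simp
  have hQV := S.Q_le
  have hQ : 9 ≤ Q := by have := S.le_Q; omega
  have hQ1 : Q ≤ V := by nlinarith
  have c3 := S.unit.size_le Q hQ1
  have cQ := S.unit.size_le (Q * Q) (by omega)
  refine Runs.mono (w := passCost u q Q ℓ W n) (t := (u + colourCost u q Q 0) +
      (Q * Q * (2 * u + (u + 1 * (1 + growCost u q ℓ 0))) + 2 * u))
    (Runs.seq ((runs_colour (W := W) S hm hst hθ).mono le_rfl le_rfl ?_)) le_rfl
    (by unfold passCost; omega) fun _ _ h => h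
  rintro s₁ L₁ ⟨rfl, g2, g3, g4, hdata, gQ, gz⟩
  rw [← g2] at hst hdeep gz hdata
  rw [← g4 6 (by omega) (by omega)] at hst
  have hm₁ : Mem n H q Q ε N s₁ := hm.of_eq (fun b hb => g4 b (by omega) (by omega)) (by rw [g3])
    (by rw [g3]) (fun j => by rw [g4 6 (by omega) (by omega)]; exact hm.dead_le j)
  have hinv : PassInv d ε θ p (pathRadius K E ℓ θ) t s₁.slot (s₁.nat 7) 0 s₁.slot (s₁.nat 6)
      (s₁.nat 7) L₀ := by
    refine ⟨hst, fun j hj hc => ⟨rfl, rfl, fun he => hc ((gz j hj).2 he)⟩,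
      fun j hj hc hne => absurd ((gz j hj).1 hc) hne, fun j hj => ⟨subset_rfl, hj, .inl rfl⟩, hdeep,
      fun i _ j _ _ hi _ _ => Nat.pos_of_ne_zero hi⟩
  refine Runs.mono (Runs.forLoop (N := Q * Q) (cu := u)
    (w := u + n * (1 + growCost u q ℓ W)) (t := u + growCost u q ℓ 0) (fun j s' L =>
    (∀ b, b ≠ 4 → s'.real b = s.real b) ∧ (∀ b < 6, s'.nat b = s.nat b) ∧ s'.nat 8 0 = j ∧
    Mem n H q Q ε N s' ∧ PassInv d ε θ p (pathRadius K E ℓ θ) t s₁.slot (s₁.nat 7) j s'.slot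
      (s'.nat 6) (s'.nat 7) (L₀ ++ L)) ?_ ?_ ?_ ?_ ?_) le_rfl ?_ fun _ _ h => h
  · refine ⟨fun b _ => by rw [g3], fun b hb => ?_, by simp [write_apply], ?_, ?_⟩
    · dsimp only
      rw [write_of_ne _ _ _ (by omega), g4 b (by omega) (by omega)]
    · refine hm₁.of_eq (fun b hb => ?_) rfl rfl fun j => ?_
      · exact write_of_ne _ _ _ (by omega)
      · dsimp only
        rw [write_of_ne _ _ _ (by omega)]
        exact hm₁.dead_le j
    · simpa only [write_of_ne _ _ _ (show 6 ≠ 8 by omega), write_of_ne _ _ _ (show 7 ≠ 8 by omega),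
        List.append_nil] using hinv
  · intro j hj
    have := S.unit.size_le j (by omega)
    omega
  · rintro j hj s' L ⟨-, -, h8, hm', -⟩
    refine ⟨h8, by simp only [NExp.eval, hm'.modulus], ?_⟩
    simp only [NExp.cost, NExp.eval, hm'.modulus, e0]
    have := S.unit.size_le j (by omega)
    omega
  · rintro j s' L hj ⟨f1, f2, f8, hm', hinv'⟩
    refine (runs_stage (W := W) S hm' hdata hθ hinv' gQ f8 hj (by rw [f1 1 (by omega), r1])
      (by rw [f1 3 (by omega), r3])).mono le_rfl le_rfl ?_
    rintro s'' L' ⟨k1, k2, k3, k4⟩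
    have hnat : ∀ b, b ≠ 8 → write s''.nat 8 0 (j + 1) b = s''.nat b := fun b hb =>
      write_of_ne _ _ _ hb
    refine ⟨by rw [k2 8 (by omega) (by omega) (by omega), f8], fun b hb => (k1 b hb).trans (f1 b hb),
      fun b hb => ?_, by simp [write_apply], ?_, ?_⟩
    · dsimp only
      rw [hnat b (by omega), k2 b (by omega) (by omega) (by omega), f2 b hb]
    · refine hm'.of_eq (fun b hb => ?_) (k1 0 (by omega)) (k1 2 (by omega)) fun j => ?_
      · dsimp only
        rw [hnat b (by omega), k2 b (by omega) (by omega) (by omega)]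
      · dsimp only
        rw [hnat 6 (by omega)]
        exact k3 j
    · dsimp only
      rw [hnat 6 (by omega), hnat 7 (by omega), ← List.append_assoc]
      exact k4
  · rintro s' L ⟨f1, f2, f8, hm', hinv'⟩
    exact ⟨f1, f2, hm', hinv'.toStateInv, hinv'.closeDeep gQ⟩
  · have : Q * Q * (2 * u + (u + growCost u q ℓ 0)) ≤
        Q * Q * (2 * u + (u + 1 * (1 + growCost u q ℓ 0))) := Nat.mul_le_mul_left _ (by omega)
    omega

/-- One phase: passes with a fixed threshold (the real variable `1`), which is then raised by the
factor `1 + ε`. -/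
def phaseCmd : Cmd :=
  .seq (.setR 3 (.const 0)
      (.add (.cell 1 (.const 0)) (.mul (.cell 0 (.const 0)) (.cell 1 (.const 0)))))
    (.seq (forLoop 5 (.add (var 2) (.const 1)) passCmd) (.setR 1 (.const 0) (.cell 3 (.const 0))))

/-- Work of a phase; with `m = 1` and `W = 0` this bounds its depth. -/
def phaseCost (u q Q ℓ W m H : ℕ) : ℕ :=
  u + (((H + 1) * (2 * u + passCost u q Q ℓ W m) + 2 * u) + u)

/-- A phase raises the lower bound for the linkage values from `θ` to `(1 + ε) θ`. -/
theorem runs_phase (S : Setting d near ε N p K E ℓ h q Q V u) {s : Store k} {L₀ : Merges k}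
    (hH : H = min h n) (hm : Mem n H q Q ε N s) (hst : StateInv d ε θ p s.slot (s.nat 6) L₀)
    (hθ : 0 < θ) (r1 : s.real 1 0 = θ * N) :
    Runs ⟨d, near, W⟩ phaseCmd s (phaseCost u q Q ℓ W n H) (phaseCost u q Q ℓ 0 1 H) fun s' L =>
      s'.real 1 0 = (1 + ε) * θ * N ∧ (∀ b < 5, s'.nat b = s.nat b) ∧ Mem n H q Q ε N s' ∧
        StateInv d ε ((1 + ε) * θ) p s'.slot (s'.nat 6) (L₀ ++ L) := by
  have e0 : Nat.size 0 = 0 := by simp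
  have e1 : Nat.size 1 = 1 := by simp
  have hnV := S.n_le
  have hHn : H ≤ n := hH ▸ min_le_right _ _
  have c0 := S.unit.size_le 0 (by omega)
  have cH := S.unit.size_le H (by omega)
  have cH1 := S.unit.size_le (H + 1) (by omega)
  unfold phaseCmd phaseCost
  refine Runs.seq (w := u) (t := u) (Runs.setR ?_ ?_ (Runs.seq
    (w := (H + 1) * (2 * u + passCost u q Q ℓ W n) + 2 * u)
    (t := (H + 1) * (2 * u + passCost u q Q ℓ 0 1) + 2 * u) (w' := u) (t' := u)
    (Runs.mono (Runs.forLoop (N := H + 1) (cu := u)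
    (w := passCost u q Q ℓ W n) (t := passCost u q Q ℓ 0 1) (fun j s' L =>
      s'.real 3 0 = (1 + ε) * θ * N ∧ s'.real 1 0 = θ * N ∧ (∀ b < 5, s'.nat b = s.nat b) ∧
      s'.nat 5 0 = j ∧ Mem n H q Q ε N s' ∧ StateInv d ε θ p s'.slot (s'.nat 6) (L₀ ++ L) ∧
      CloseDeep d ((1 + ε) * θ) j s'.slot (L₀ ++ L)) ?_ ?_ ?_ ?_ fun s' L h => h)
      le_rfl le_rfl ?_)))
  · simp only [NExp.cost, RExp.cost, e0]
    omega
  · simp only [NExp.cost, RExp.cost, e0]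
    omega
  · refine ⟨?_, ?_, fun b hb => ?_, by simp [write_apply], ?_, ?_, ?_⟩
    · simp only [write_apply, NExp.eval, RExp.eval, r1, hm.eps, and_self, if_true]
      ring
    · simp [write_apply, r1, NExp.eval]
    · exact write_of_ne _ _ _ (by omega)
    · refine hm.of_eq (fun b hb => ?_) (by dsimp only; rw [write_of_ne _ _ _ (by decide)])
        (by dsimp only; rw [write_of_ne _ _ _ (by decide)]) fun j => ?_
      · exact write_of_ne _ _ _ (by omega)
      · dsimp only
        rw [write_of_ne _ _ _ (by omega)]
        exact hm.dead_le j
    · simpa only [write_of_ne _ _ _ (show 6 ≠ 5 by omega), List.append_nil] using hst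
    · intro i j _ hi _ _
      obtain ⟨x, hx⟩ := Finset.nonempty_iff_ne_empty.2 hi
      exact ⟨x, Finset.mem_union_left _ hx, Nat.zero_le _⟩
  · intro j hj
    have := S.unit.size_le j (by omega)
    omega
  · rintro j hj s' L ⟨-, -, -, h5, hm', -, -⟩
    refine ⟨h5, by simp only [NExp.eval, hm'.height], ?_⟩
    simp only [NExp.cost, NExp.eval, hm'.height, e0, e1]
    have := S.unit.size_le j (by omega)
    omega
  · rintro j s' L hj ⟨f3, f1, f2, f5, hm', hst', hdeep⟩
    refine (runs_pass (W := W) S hm' hst' hθ hdeep f1 f3).mono le_rfl le_rfl ?_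
    rintro s'' L' ⟨k1, k2, k3, k4, k5⟩
    have hnat : ∀ b, b ≠ 5 → write s''.nat 5 0 (j + 1) b = s''.nat b := fun b hb =>
      write_of_ne _ _ _ hb
    refine ⟨by rw [k2 5 (by omega), f5], by rw [k1 3 (by omega), f3], by rw [k1 1 (by omega), f1],
      fun b hb => ?_, by simp [write_apply], ?_, ?_, ?_⟩
    · dsimp only
      rw [hnat b (by omega), k2 b (by omega), f2 b hb]
    · refine k3.of_eq (fun b hb => hnat b (by omega)) rfl rfl fun j => ?_
      dsimp only
      rw [hnat 6 (by omega)]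
      exact k3.dead_le j
    · dsimp only
      rw [hnat 6 (by omega), ← List.append_assoc]
      exact k4
    · rw [← List.append_assoc]
      exact k5
  · rintro s' L ⟨f3, f1, f2, f5, hm', hst', hdeep⟩
    refine Runs.setR ?_ ?_ ?_
    · simp only [NExp.cost, RExp.cost, e0]
      omega
    · simp only [NExp.cost, RExp.cost, e0]
      omega
    · refine ⟨by simp [write_apply, NExp.eval, RExp.eval, f3], f2, hm'.of_eq (fun _ _ => rfl)
        (by dsimp only; rw [write_of_ne _ _ _ (by decide)])
        (by dsimp only; rw [write_of_ne _ _ _ (by decide)]) hm'.dead_le, ?_⟩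
      simp only [List.append_nil, List.nil_append]
      refine ⟨hst'.reach, fun i j hij hi hj => ?_, hst'.dead_iff⟩
      -- A closer pair would contain a point that took part in too many merges.
      by_contra hlt
      obtain ⟨x, hx, hxd⟩ := hdeep i j hij hi hj (not_le.1 hlt)
      have hε := S.ε_pos
      have : leafDepth (L₀ ++ L) x ≤ min h n := by
        rcases Finset.mem_union.1 hx with hx | hx
        · exact hst'.reach.leafDepth_le S.metricish (by linarith) S.n_pos S.height hx
        · exact hst'.reach.leafDepth_le S.metricish (by linarith) S.n_pos S.height hx
      omega

end Phases

section Prelude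

variable {k : ℕ}

/-! ### Preparing the memory -/

/-- The expression `e ^ m`, with a constant exponent. -/
def powN (e : NExp) : ℕ → NExp
  | 0 => .const 1
  | m + 1 => .mul (powN e m) e

theorem powN_eval (e : NExp) (s : Store k) (m : ℕ) : (powN e m).eval s = e.eval s ^ m := by
  induction m with
  | zero => rfl
  | succ m ih => simp only [powN, NExp.eval, ih, pow_succ]

theorem powN_cost {e : NExp} {s : Store k} {V v m : ℕ} (hv : ∀ x ≤ V, 1 + x.size + e.cost s ≤ v)
    (h1 : 1 ≤ e.eval s) (hm : e.eval s ^ m ≤ V) : (powN e m).cost s ≤ (m + 1) * v := by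
  induction m with
  | zero =>
    have := hv 1 (by simpa using hm)
    simp only [powN, NExp.cost]
    omega
  | succ m ih =>
    have h2 := ih ((Nat.pow_le_pow_right h1 (Nat.le_succ m)).trans hm)
    have h3 := hv _ hm
    simp only [powN, NExp.cost, powN_eval]
    rw [← pow_succ, add_mul (m + 1) 1 v]
    omega

/-- Entry `i` of the input array: `n`, `k`, `h`, `ℓ` for `i = 0, 1, 2, 3`. -/
abbrev inp (i : ℕ) : NExp := .cell 0 (.const i)

/-- Computes `⌊log₂ n⌋` by repeated halving. -/
def logCmd : Cmd :=
  .seq (.setN 11 (.const 0) (inp 0)) (.seq (.setN 12 (.const 0) (.const 0))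
    (.loop (.ltN (.const 1) (var 11))
      (.seq (.setN 11 (.const 0) (.div (var 11) (.const 2)))
        (.setN 12 (.const 0) (.add (var 12) (.const 1))))))

/-- Computes `(2ℓ)^(ck)`. -/
def powCmd (c : ℕ) : Cmd :=
  .seq (.setN 14 (.const 0) (.const 1))
    (forLoop 13 (inp 1) (.setN 14 (.const 0) (.mul (var 14) (powN (.mul (.const 2) (inp 3)) c))))

/-- The smaller one of `h` and `n`. -/
def minCmd : Cmd :=
  .ite (.ltN (inp 0) (inp 2)) (.setN 2 (.const 0) (inp 0)) (.setN 2 (.const 0) (inp 2))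

/-- Computes the number of neighbours `q`, from `⌊log₂ n⌋` and `(2ℓ)^(ck)`, and the bound `17 q³`
for the moduli. -/
def listsCmd (c : ℕ) : Cmd :=
  .seq (.setN 1 (.const 0) (.mul (.mul (.const c) (var 14)) (powN (var 12) c)))
    (.setN 3 (.const 0) (.mul (.const 17) (powN (var 1) 3)))

/-- Sets the scale `n ^ κ` and the first threshold, a linkage value of two points. -/
def scaleCmd (κ : ℕ) : Cmd :=
  .seq (.setR 2 (.const 0) (.ofNat (powN (inp 0) κ)))
    (.setR 1 (.const 0) (.link (.slot (.const 0)) (.slot (.const 1))))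

/-- Sets up the part of the memory that the main loop only reads, and the first threshold. -/
def preludeCmd (c κ : ℕ) : Cmd :=
  .seq logCmd (.seq (powCmd c) (.seq minCmd (.seq (listsCmd c) (scaleCmd κ))))

variable {M : Env k} {V v : ℕ}

theorem runs_logCmd (hv : UnitCost V v) {s : Store k} {n : ℕ} (hn : 2 ≤ n) (hnV : n ≤ V)
    (h0 : s.nat 0 0 = n) :
    Runs M logCmd s (v * (2 * Nat.log 2 n + 3)) (v * (2 * Nat.log 2 n + 3)) fun s' L => L = [] ∧
      s'.slot = s.slot ∧ s'.real = s.real ∧ (∀ b < 11, s'.nat b = s.nat b) ∧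
      s'.nat 12 0 = Nat.log 2 n := by
  have e0 : Nat.size 0 = 0 := by simp
  have e1 : Nat.size 1 = 1 := by simp
  have e2 : Nat.size 2 = 2 := by decide
  have cn := hv.size_le n hnV
  have hlog : ∀ y, 1 < y → Nat.log 2 y = Nat.log 2 (y / 2) + 1 := fun y hy =>
    Nat.log_of_one_lt_of_le (by norm_num) hy
  have hlt : Nat.log 2 n < n := Nat.log_lt_self 2 (by omega)
  refine Runs.mono (w := v + (v + (Nat.log 2 n * (v + v) + v)))
    (t := v + (v + (Nat.log 2 n * (v + v) + v))) (Runs.seq (Runs.setN ?_ ?_ (Runs.seq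
    (Runs.setN ?_ ?_ (Runs.loop (N := Nat.log 2 n) (cb := v) (w := v) (t := v)
      (fun j s' L => L = [] ∧
        s'.slot = s.slot ∧ s'.real = s.real ∧ (∀ b < 11, s'.nat b = s.nat b) ∧
        s'.nat 12 0 = j ∧ 1 ≤ s'.nat 11 0 ∧ s'.nat 11 0 ≤ n ∧
          j + Nat.log 2 (s'.nat 11 0) = Nat.log 2 n) ?_ ?_ ?_ ?_)))))
    (by nlinarith) (by nlinarith) fun _ _ h => h
  · simp only [NExp.cost, e0, h0, NExp.eval]; omega
  · simp only [NExp.cost, e0, h0, NExp.eval]; omega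
  · simp only [NExp.cost, e0]; omega
  · simp only [NExp.cost, e0]; omega
  · refine ⟨rfl, rfl, rfl, fun b hb => ?_, ?_, ?_, ?_, ?_⟩
    · dsimp only
      rw [write_of_ne _ _ _ (by omega), write_of_ne _ _ _ (by omega)]
    all_goals simp [write_apply, NExp.eval, h0]
    omega
  · rintro j s' L ⟨-, -, -, -, -, h5, h6, -⟩
    have := hv.size_le _ (h6.trans hnV)
    simp only [BExp.cost, NExp.cost, NExp.eval, e0, e1]
    omega
  · rintro j s' L ⟨rfl, h2, h3, h4, h5, h6, h7, h8⟩ hb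
    have hy : 1 < s'.nat 11 0 := by simpa [BExp.Holds, NExp.eval] using hb
    have hl := hlog _ hy
    have cy := hv.size_le _ ((Nat.div_le_self (s'.nat 11 0) 2).trans (h7.trans hnV))
    have cy' := hv.size_le _ (h7.trans hnV)
    have cj := hv.size_le j (by omega)
    have cj' := hv.size_le (j + 1) (by omega)
    refine ⟨by omega, Runs.mono (w := v / 2 + v / 2) (t := v / 2 + v / 2) (Runs.seq
      (Runs.setN ?_ ?_ (Runs.setN ?_ ?_ ?_))) (by omega) (by omega) fun _ _ h => h⟩
    · simp only [NExp.cost, NExp.eval, e0, e2]; omega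
    · simp only [NExp.cost, NExp.eval, e0, e2]; omega
    · simp [NExp.cost, NExp.eval, e1, write_apply, h5]; omega
    · simp [NExp.cost, NExp.eval, e1, write_apply, h5]; omega
    · refine ⟨rfl, h2, h3, fun b hb => ?_, ?_, ?_, ?_, ?_⟩
      · dsimp only
        rw [write_of_ne _ _ _ (by omega), write_of_ne _ _ _ (by omega), h4 b hb]
      all_goals simp [write_apply, NExp.eval, h5]
      all_goals omega
  · rintro j s' L ⟨rfl, h2, h3, h4, h5, h6, h7, h8⟩ hb
    have hy : s'.nat 11 0 = 1 := by
      have : ¬ 1 < s'.nat 11 0 := by simpa [BExp.Holds, NExp.eval] using hb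
      omega
    rw [hy] at h8
    exact ⟨rfl, h2, h3, h4, by simpa [h5] using h8⟩

theorem runs_powCmd (hv : UnitCost V v) {s : Store k} {c ℓ u : ℕ} (hℓ : 1 ≤ ℓ)
    (h1 : s.nat 0 1 = k) (h3 : s.nat 0 3 = ℓ) (hkV : k ≤ V) (hℓV : 2 * ℓ ≤ V)
    (hcV : (2 * ℓ) ^ c ≤ V) (hV : (2 * ℓ) ^ (c * k) ≤ V) (hu : (c + 2) * v ≤ u) :
    Runs M (powCmd c) s (u * (3 * k + 3)) (u * (3 * k + 3)) fun s' L => L = [] ∧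
      s'.slot = s.slot ∧ s'.real = s.real ∧ (∀ b < 13, s'.nat b = s.nat b) ∧
      s'.nat 14 0 = (2 * ℓ) ^ (c * k) := by
  have e0 : Nat.size 0 = 0 := by simp
  have e1 : Nat.size 1 = 1 := by simp
  have e2 : Nat.size 2 = 2 := by decide
  have e3 : Nat.size 3 = 2 := by decide
  have ck := hv.size_le k hkV
  have cℓ := hv.size_le ℓ (by omega)
  have cℓ' := hv.size_le _ hℓV
  have hu' : (c + 1) * v + v ≤ u := by
    have : (c + 2) * v = (c + 1) * v + v := by ring
    omega
  have hpw : ∀ j ≤ k, (2 * ℓ) ^ (c * j) ≤ V := fun j hj =>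
    (Nat.pow_le_pow_right (by omega) (Nat.mul_le_mul_left c hj)).trans hV
  refine Runs.mono (w := u + (k * (2 * u + u) + 2 * u)) (t := u + (k * (2 * u + u) + 2 * u))
    (Runs.seq (Runs.setN ?_ ?_ (Runs.forLoop (N := k) (cu := u)
      (fun j s' L => L = [] ∧
        s'.slot = s.slot ∧ s'.real = s.real ∧ (∀ b < 13, s'.nat b = s.nat b) ∧
        s'.nat 13 0 = j ∧ s'.nat 14 0 = (2 * ℓ) ^ (c * j)) ?_ ?_ ?_ ?_ ?_)))
    (by nlinarith) (by nlinarith) fun _ _ h => h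
  · simp only [NExp.cost, e0, e1]; omega
  · simp only [NExp.cost, e0, e1]; omega
  · refine ⟨rfl, rfl, rfl, fun b hb => ?_, ?_, ?_⟩
    · dsimp only
      rw [write_of_ne _ _ _ (by omega), write_of_ne _ _ _ (by omega)]
    all_goals simp [write_apply, NExp.eval]
  · intro j hj
    have := hv.size_le j (by omega)
    omega
  · rintro j hj s' L ⟨-, -, -, h4, h5, -⟩
    have cj := hv.size_le j (by omega)
    have : s'.nat 0 1 = k := by rw [h4 0 (by norm_num), h1]
    refine ⟨h5, by simp [NExp.eval, this], ?_⟩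
    simp only [NExp.cost, NExp.eval, this, e1]
    omega
  · rintro j s' L hj ⟨rfl, g2, g3, h4, h5, h6⟩
    have hl : s'.nat 0 3 = ℓ := by rw [h4 0 (by norm_num), h3]
    have cp := hv.size_le _ (hpw j hj.le)
    have cp' := hv.size_le _ (hpw (j + 1) hj)
    have hmul : (2 * ℓ) ^ (c * j) * (2 * ℓ) ^ c = (2 * ℓ) ^ (c * (j + 1)) := by
      rw [← pow_add, mul_add_one]
    have hev : (NExp.mul (.const 2) (inp 3)).eval s' = 2 * ℓ := by simp [NExp.eval, hl]
    have hc : (powN (.mul (.const 2) (inp 3)) c).cost s' ≤ (c + 1) * v := by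
      refine powN_cost (V := V) (fun x hx => ?_) (by rw [hev]; omega) (by rw [hev]; exact hcV)
      have := hv.size_le x hx
      simp only [NExp.cost, NExp.eval, hl, e2, e3]
      omega
    refine Runs.setN ?_ ?_ ?_
    · simp only [NExp.cost, NExp.eval, powN_eval, hl, h6, hmul, e0]
      omega
    · simp only [NExp.cost, NExp.eval, powN_eval, hl, h6, hmul, e0]
      omega
    · refine ⟨?_, rfl, g2, g3, fun b hb => ?_, ?_, ?_⟩
      · simp [write_apply, h5]
      · dsimp only
        rw [write_of_ne _ _ _ (by omega), write_of_ne _ _ _ (by omega), h4 b hb]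
      · simp [write_apply]
      · simp [write_apply, NExp.eval, powN_eval, hl, h6, hmul]
  · rintro s' L ⟨rfl, g2, g3, h4, h5, h6⟩
    exact ⟨rfl, g2, g3, h4, h6⟩

theorem runs_minCmd (hv : UnitCost V v) {s : Store k} {n h : ℕ} (hnV : n ≤ V)
    (h0 : s.nat 0 0 = n) (h2 : s.nat 0 2 = h) :
    Runs M minCmd s (2 * v + h) (2 * v + h) fun s' L => L = [] ∧
      s'.slot = s.slot ∧ s'.real = s.real ∧ (∀ b, b ≠ 2 → s'.nat b = s.nat b) ∧
      s'.nat 2 0 = min h n := by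
  have e0 : Nat.size 0 = 0 := by simp
  have e2 : Nat.size 2 = 2 := by decide
  have cn := hv.size_le n hnV
  have hh : h.size ≤ h := Nat.size_le.2 Nat.lt_two_pow_self
  refine Runs.mono (w := (v + h) + v) (t := (v + h) + v)
    (Runs.ite (cb := v + h) ?_ (fun hb => Runs.setN ?_ ?_ ?_) (fun hb => Runs.setN ?_ ?_ ?_))
    (by omega) (by omega) fun _ _ h => h
  · simp only [BExp.cost, NExp.cost, NExp.eval, h0, h2, e0, e2]; omega
  · simp only [NExp.cost, NExp.eval, h0, e0]; omega
  · simp only [NExp.cost, NExp.eval, h0, e0]; omega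
  · have : n < h := by simpa [BExp.Holds, NExp.eval, h0, h2] using hb
    refine ⟨rfl, rfl, rfl, fun b hb => by dsimp only; rw [write_of_ne _ _ _ (by omega)], ?_⟩
    simp [write_apply, NExp.eval, h0]
    omega
  all_goals have hn : h ≤ n := by simpa [BExp.Holds, NExp.eval, h0, h2] using hb
  all_goals have ch := hv.size_le h (hn.trans hnV)
  · simp only [NExp.cost, NExp.eval, h2, e0, e2]; omega
  · simp only [NExp.cost, NExp.eval, h2, e0, e2]; omega
  · refine ⟨rfl, rfl, rfl, fun b hb => by dsimp only; rw [write_of_ne _ _ _ (by omega)], ?_⟩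
    simp [write_apply, NExp.eval, h2]
    omega

theorem runs_listsCmd (hv : UnitCost V v) {s : Store k} {c lg r q u : ℕ} (hc : 1 ≤ c)
    (h12 : s.nat 12 0 = lg) (h14 : s.nat 14 0 = r) (hlg : 1 ≤ lg) (hr : 1 ≤ r)
    (hq : q = c * r * lg ^ c) (hlV : lg ≤ V) (hqV : 17 * q ^ 3 ≤ V) (hu : (c + 6) * v ≤ u) :
    Runs M (listsCmd c) s (u + u) (u + u) fun s' L => L = [] ∧
      s'.slot = s.slot ∧ s'.real = s.real ∧ (∀ b, b ≠ 1 → b ≠ 3 → s'.nat b = s.nat b) ∧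
      s'.nat 1 0 = q ∧ s'.nat 3 0 = 17 * q ^ 3 := by
  have e0 : Nat.size 0 = 0 := by simp
  have e17 : Nat.size 17 = 5 := by decide
  have hl1 : 1 ≤ lg ^ c := Nat.one_le_pow _ _ hlg
  have hcp : c * r ≤ q := by rw [hq]; exact Nat.le_mul_of_pos_right _ hl1
  have hpq : r ≤ q := (Nat.le_mul_of_pos_left _ hc).trans hcp
  have hcq : c ≤ q := (Nat.le_mul_of_pos_right _ hr).trans hcp
  have hlq : lg ^ c ≤ q := by rw [hq]; exact Nat.le_mul_of_pos_left _ (Nat.mul_pos hc hr)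
  have hq3 : q ≤ q ^ 3 := Nat.le_self_pow (by norm_num) q
  have hu1 : (c + 1) * v + 5 * v ≤ u := le_trans (by nlinarith) hu
  have hu2 : (3 + 1) * v + 2 * v ≤ u := le_trans (by nlinarith) hu
  have z1 := hv.size_le lg hlV
  have z2 := hv.size_le r (by omega)
  have z3 := hv.size_le _ (show c * r ≤ V by omega)
  have z4 := hv.size_le c (by omega)
  have z5 := hv.size_le q (by omega)
  have z6 := hv.size_le _ hqV
  have pc : (powN (var 12) c).cost s ≤ (c + 1) * v := by
    refine powN_cost (V := V) (fun x hx => ?_) ?_ ?_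
    · have := hv.size_le x hx
      simp only [NExp.cost, NExp.eval, h12, e0]
      omega
    · simpa [NExp.eval, h12] using hlg
    · simp only [NExp.eval, h12]
      omega
  refine Runs.seq ?_
  refine Runs.setN (w := u) (t := u) ?_ ?_ ?_
  · simp only [NExp.cost, NExp.eval, powN_eval, h12, h14, e0, ← hq]
    omega
  · simp only [NExp.cost, NExp.eval, powN_eval, h12, h14, e0, ← hq]
    omega
  have hev : (NExp.mul (.mul (.const c) (var 14)) (powN (var 12) c)).eval s = q := by
    simp only [NExp.eval, powN_eval, h12, h14, ← hq]
  rw [hev, show (NExp.const 0).eval s = 0 from rfl]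
  set s₁ : Store k := { s with nat := write s.nat 1 0 q } with hs₁
  have k1 : s₁.nat 1 0 = q := by simp [hs₁, write_apply]
  have pc' : (powN (var 1) 3).cost s₁ ≤ (3 + 1) * v := by
    refine powN_cost (V := V) (fun x hx => ?_) ?_ ?_
    · have := hv.size_le x hx
      simp only [NExp.cost, NExp.eval, k1, e0]
      omega
    · simp only [NExp.eval, k1]
      omega
    · simp only [NExp.eval, k1]
      omega
  refine Runs.setN ?_ ?_ ⟨rfl, rfl, rfl, fun b hb hb' => ?_, ?_, ?_⟩
  · simp only [NExp.cost, NExp.eval, powN_eval, k1, e0, e17]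
    omega
  · simp only [NExp.cost, NExp.eval, powN_eval, k1, e0, e17]
    omega
  · dsimp only
    rw [write_of_ne _ _ _ hb', hs₁]
    exact write_of_ne _ _ _ hb
  · simp [write_apply, NExp.eval, k1]
  · simp [write_apply, NExp.eval, powN_eval, k1]

theorem runs_scaleCmd (hv : UnitCost V v) {s : Store k} {n κ u : ℕ} (hn : 1 ≤ n)
    (h0 : s.nat 0 0 = n) (hnV : n ≤ V) (hκ : n ^ κ ≤ V) (hu : (κ + 6) * v ≤ u) :
    Runs M (scaleCmd κ) s (u + u) (u + u) fun s' L => L = [] ∧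
      s'.slot = s.slot ∧ s'.nat = s.nat ∧ s'.real 0 0 = s.real 0 0 ∧
      s'.real 1 0 = M.link (s.slot 0) (s.slot 1) ∧ s'.real 2 0 = (n : ℝ) ^ κ := by
  have e0 : Nat.size 0 = 0 := by simp
  have e1 : Nat.size 1 = 1 := by simp
  have hu1 : (κ + 1) * v + 5 * v ≤ u := le_trans (by nlinarith) hu
  have z1 := hv.size_le n hnV
  have pc : (powN (inp 0) κ).cost s ≤ (κ + 1) * v := by
    refine powN_cost (V := V) (fun x hx => ?_) ?_ ?_
    · have := hv.size_le x hx
      simp only [NExp.cost, NExp.eval, h0, e0]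
      omega
    · simpa [NExp.eval, h0] using hn
    · simpa only [NExp.eval, h0] using hκ
  refine Runs.seq (Runs.setR ?_ ?_ (Runs.setR ?_ ?_ ⟨rfl, rfl, rfl, ?_, ?_, ?_⟩))
  · simp only [NExp.cost, RExp.cost, e0]
    omega
  · simp only [NExp.cost, RExp.cost, e0]
    omega
  · simp only [NExp.cost, RExp.cost, CExp.cost, e0, e1]
    omega
  · simp only [NExp.cost, RExp.cost, CExp.cost, e0, e1]
    omega
  · simp [write_apply, NExp.eval]
  · simp [write_apply, NExp.eval, RExp.eval, CExp.eval]
  · simp [write_apply, NExp.eval, RExp.eval, powN_eval, h0]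

theorem runs_preludeCmd (hv : UnitCost V v) {s : Store k} {n h c κ ℓ q u : ℕ} (hn : 2 ≤ n)
    (hℓ : 1 ≤ ℓ) (h0 : s.nat 0 0 = n) (h1 : s.nat 0 1 = k) (h2 : s.nat 0 2 = h)
    (h3 : s.nat 0 3 = ℓ) (hc : 1 ≤ c)
    (hq : q = c * (2 * ℓ) ^ (c * k) * Nat.log 2 n ^ c) (hnV : n ≤ V) (hkV : k ≤ V)
    (hℓV : 2 * ℓ ≤ V) (hcV : (2 * ℓ) ^ c ≤ V) (hqV : 17 * q ^ 3 ≤ V) (hκ : n ^ κ ≤ V)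
    (hu : (c + κ + 6) * v ≤ u) :
    Runs M (preludeCmd c κ) s (u * (2 * Nat.log 2 n + 3 * k + 12) + h)
      (u * (2 * Nat.log 2 n + 3 * k + 12) + h) fun s' L => L = [] ∧
        s'.slot = s.slot ∧ (∀ b, 4 ≤ b → b < 10 → s'.nat b = s.nat b) ∧
        s'.nat 1 0 = q ∧ s'.nat 2 0 = min h n ∧ s'.nat 3 0 = 17 * q ^ 3 ∧ s'.nat 0 = s.nat 0 ∧
        s'.real 0 0 = s.real 0 0 ∧ s'.real 1 0 = M.link (s.slot 0) (s.slot 1) ∧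
        s'.real 2 0 = (n : ℝ) ^ κ := by
  set lg := Nat.log 2 n with hlg
  have hlg1 : 1 ≤ lg := Nat.log_pos (by norm_num) hn
  have hp1 : 1 ≤ (2 * ℓ) ^ (c * k) := Nat.one_le_pow _ _ (by omega)
  have hl1 : 1 ≤ lg ^ c := Nat.one_le_pow _ _ hlg1
  have hpq : (2 * ℓ) ^ (c * k) ≤ q := by
    rw [hq]
    exact (Nat.le_mul_of_pos_left _ hc).trans (Nat.le_mul_of_pos_right _ hl1)
  have hq3 : q ≤ q ^ 3 := Nat.le_self_pow (by norm_num) q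
  have hlV : lg ≤ V := (Nat.log_le_self 2 n).trans hnV
  have ha : (c + 6) * v ≤ u := le_trans (Nat.mul_le_mul_right v (by omega)) hu
  have hb : (κ + 6) * v ≤ u := le_trans (Nat.mul_le_mul_right v (by omega)) hu
  have hd : (c + 2) * v ≤ u := le_trans (Nat.mul_le_mul_right v (by omega)) hu
  have hvu : 6 * v ≤ u := le_trans (Nat.mul_le_mul_right v (by omega)) hu
  have hle : v * (2 * lg + 3) + (u * (3 * k + 3) + ((2 * v + h) + ((u + u) + (u + u)))) ≤
      u * (2 * lg + 3 * k + 12) + h := by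
    have : v * (2 * lg + 3) ≤ u * (2 * lg + 3) := Nat.mul_le_mul_right _ (by omega)
    have e : u * (2 * lg + 3 * k + 12) = u * (2 * lg + 3) + u * (3 * k + 3) + 6 * u := by ring
    omega
  refine Runs.mono
    (w := v * (2 * lg + 3) + (u * (3 * k + 3) + ((2 * v + h) + ((u + u) + (u + u)))))
    (t := v * (2 * lg + 3) + (u * (3 * k + 3) + ((2 * v + h) + ((u + u) + (u + u)))))
    (Runs.seq ((runs_logCmd hv hn hnV h0).mono le_rfl le_rfl ?_)) hle hle fun _ _ h => h
  rintro s₁ _ ⟨rfl, a1, a2, a3, a4⟩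
  refine Runs.seq ((runs_powCmd (c := c) (ℓ := ℓ) hv hℓ (by rw [a3 0 (by norm_num), h1])
    (by rw [a3 0 (by norm_num), h3]) hkV hℓV hcV (by omega) hd).mono le_rfl le_rfl ?_)
  rintro s₂ _ ⟨rfl, b1, b2, b3, b4⟩
  refine Runs.seq ((runs_minCmd (n := n) (h := h) hv hnV
    (by rw [b3 0 (by norm_num), a3 0 (by norm_num), h0])
    (by rw [b3 0 (by norm_num), a3 0 (by norm_num), h2])).mono le_rfl le_rfl ?_)
  rintro s₃ _ ⟨rfl, c1, c2, c3, c4⟩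
  refine Runs.seq ((runs_listsCmd hv hc
    (by rw [c3 12 (by norm_num), b3 12 (by norm_num), a4]) (by rw [c3 14 (by norm_num), b4])
    hlg1 hp1 hq hlV hqV ha).mono le_rfl le_rfl ?_)
  rintro s₄ _ ⟨rfl, d1, d2, d3, d4, d5⟩
  have k0 : s₄.nat 0 = s.nat 0 := by
    rw [d3 0 (by norm_num) (by norm_num), c3 0 (by norm_num), b3 0 (by norm_num),
      a3 0 (by norm_num)]
  refine (runs_scaleCmd (n := n) hv (by omega) (by rw [k0, h0]) hnV hκ hb).mono le_rfl le_rfl ?_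
  rintro s₅ _ ⟨rfl, g1, g2, g3, g4, g5⟩
  have hslot : s₄.slot = s.slot := by rw [d1, c1, b1, a1]
  refine ⟨rfl, by rw [g1, hslot], fun b hb hb' => ?_, by rw [g2, d4], ?_, by rw [g2, d5],
    by rw [g2, k0], ?_, by rw [g4, hslot], g5⟩
  · rw [g2, d3 b (by omega) (by omega), c3 b (by omega), b3 b (by omega), a3 b (by omega)]
  · rw [g2, d3 2 (by norm_num) (by norm_num), c4]
  · rw [g3, d2, c2, b2, a2]

end Prelude

section Assembly

variable {k n : ℕ} {d : Linkage k} {p : Fin n → Pt k} {δ ε : ℝ} {K κ : ℕ}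

/-! ### Consequences of the hypotheses for points -/

theorem WellBehaved.one_le (hδ : 0 < δ) (h : WellBehaved K fun A B => d A B / δ) {x y : Pt k}
    (hxy : δ ≤ d {x} {y}) : 1 ≤ K := by
  by_contra hK
  obtain rfl : K = 0 := by omega
  have := (h.metricish hδ).tri {x} {y} {y} (by simp) (by simp) (by simp) (by simp)
  simp only [Nat.cast_zero, zero_mul] at this
  linarith

theorem one_le_dim (hn : 2 ≤ n) (hp : Function.Injective p) : 1 ≤ k := by
  by_contra hk
  obtain rfl : k = 0 := by omega
  have := congrArg Fin.val (hp (Subsingleton.elim (p ⟨0, by omega⟩) (p ⟨1, by omega⟩)))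
  simp at this

/-- A closest pair of points is a bounce-back path. -/
theorem BounceBackLengthLE.one_le {ℓ : ℕ} (hε : 0 < ε) (hn : 2 ≤ n) (hδ : 0 < δ)
    (hp : Function.Injective p) (hd : ∀ i j, i ≠ j → δ ≤ d {p i} {p j})
    (h : BounceBackLengthLE d ε p ℓ) : 1 ≤ ℓ := by
  let S : Finset (Fin n × Fin n) := Finset.univ.filter fun a => a.1 ≠ a.2
  have hS : S.Nonempty := ⟨(⟨0, by omega⟩, ⟨1, by omega⟩), by simp [S]⟩
  obtain ⟨⟨i, j⟩, hij, hmin⟩ := S.exists_min_image (fun a => d {p a.1} {p a.2}) hS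
  have hij : i ≠ j := by simpa [S] using hij
  have hpos : 0 < d {p i} {p j} := hδ.trans_le (hd i j hij)
  have hle : ∀ X ∈ singletons p, ∀ Y ∈ singletons p, X ≠ Y → d {p i} {p j} ≤ d X Y := by
    intro X hX Y hY hne
    obtain ⟨a, -, rfl⟩ := Finset.mem_image.1 hX
    obtain ⟨b, -, rfl⟩ := Finset.mem_image.1 hY
    exact hmin (a, b) (by
      simp only [S, Finset.mem_filter, Finset.mem_univ, true_and]
      rintro rfl
      exact hne rfl)
  have hmem : ∀ a, ({p a} : Cluster k) ∈ singletons p := fun a =>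
    Finset.mem_image_of_mem _ (Finset.mem_univ a)
  have hne : ({p j} : Cluster k) ≠ {p i} := fun he =>
    hij (hp (Finset.singleton_injective he)).symm
  exact h [] trivial _ hpos hle {p i} [{p j}] ⟨hmem i, ⟨Finset.mem_erase.2 ⟨hne, hmem j⟩,
    fun X hX => hle _ (hmem i) X (Finset.mem_of_mem_erase hX) (Finset.ne_of_mem_erase hX).symm,
    trivial⟩, by nlinarith, trivial⟩

theorem one_le_height {h : ℕ} (hd : Metricish K d) (hε : 0 < ε) (hn : 2 ≤ n)
    (hp : Function.Injective p)
    (hh : ∀ L, IsApproxHAC d (1 + ε) p L → dendrogramHeight p L ≤ h) : 1 ≤ h := by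
  obtain ⟨L, hL⟩ := (Reach.init d (1 + ε) hp).exists_hac hd (by linarith) (by omega)
  rw [List.nil_append] at hL
  refine le_trans ?_ (hh L hL)
  match L, hL with
  | [], hL => have := hL.2; simp at this; omega
  | (A, B) :: L, hL =>
    obtain ⟨i, -, rfl⟩ := Finset.mem_image.1 hL.1.1.1
    refine le_trans ?_ (Finset.le_sup (f := fun i => leafDepth _ (p i)) (Finset.mem_univ i))
    simp [leafDepth]

theorem diameter_le (hδ : 0 < δ) (h : WellBehaved K fun A B => d A B / δ) (hn : 2 ≤ n)
    (hd : ∀ i j, i ≠ j → δ ≤ d {p i} {p j} ∧ d {p i} {p j} ≤ δ * (n : ℝ) ^ κ)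
    {A B : Cluster k} (hA : A ⊆ Finset.univ.image p) (hB : B ⊆ Finset.univ.image p)
    (hA' : A.Nonempty) (hB' : B.Nonempty) (hAB : Disjoint A B) :
    d A B ≤ δ * (K * (1 + 2 * K * (n : ℝ) ^ κ * n) ^ K) := by
  have hm := h.metricish hδ
  have h01 : (⟨0, by omega⟩ : Fin n) ≠ ⟨1, by omega⟩ := by simp
  have hK : (1 : ℝ) ≤ K := by exact_mod_cast h.one_le hδ (hd _ _ h01).1
  have hκ : (0 : ℝ) ≤ (n : ℝ) ^ κ := by positivity
  have key := h.polyBoundedDiameter (Finset.univ.image p) (2 * K * (n : ℝ) ^ κ) (by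
    intro u hu v hv
    obtain ⟨i, -, rfl⟩ := Finset.mem_image.1 hu
    obtain ⟨j, -, rfl⟩ := Finset.mem_image.1 hv
    rw [div_le_iff₀ hδ]
    rcases ne_or_eq i j with hij | rfl
    · have := (hd i j hij).2
      nlinarith [mul_nonneg hδ.le hκ]
    · -- The distance of a point to itself is compared with the way through another point.
      obtain ⟨w, hw⟩ : ∃ w : Fin n, i ≠ w := by
        by_cases hi : i = ⟨0, by omega⟩
        · exact ⟨⟨1, by omega⟩, hi ▸ h01⟩
        · exact ⟨_, hi⟩
      have h1 := hm.tri {p i} {p w} {p i} (by simp) (by simp) (by simp) (by simp)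
      rw [hm.symm {p w} {p i} (by simp) (by simp)] at h1
      have h2 := (hd i w hw).2
      nlinarith) A B hA hB hA' hB' hAB
  rw [div_le_iff₀ hδ, mul_comm] at key
  refine key.trans (mul_le_mul_of_nonneg_left ?_ hδ.le)
  have hc : ((Finset.univ.image p).card : ℝ) ≤ n := by
    exact_mod_cast Finset.card_image_le.trans (by simp)
  gcongr

/-- The number of phases: after `m q` of them the threshold has grown by more than the aspect
ratio of all linkage values. -/
theorem exists_phases (hε : 0 < ε) (K κ : ℕ) : ∃ m : ℕ, ∀ n q : ℕ, 2 ≤ n → Nat.log 2 n ≤ q →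
    (K * (1 + 2 * K * (n : ℝ) ^ κ * n) ^ K) * (n : ℝ) ^ κ < (1 + ε) ^ (m * q) := by
  obtain ⟨m, hm⟩ := pow_unbounded_of_one_lt ((2 : ℝ) ^ (K + (2 * K + 2 * (κ + 1)) * K + 2 * κ))
    (show 1 < 1 + ε by linarith)
  refine ⟨m, fun n q hn hq => ?_⟩
  have hlg : 1 ≤ Nat.log 2 n := Nat.log_pos one_lt_two hn
  have h2n : n ≤ 2 ^ (2 * q) :=
    (Nat.lt_pow_succ_log_self one_lt_two n).le.trans (Nat.pow_le_pow_right (by norm_num) (by omega))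
  have hK : ∀ j, j ≤ 2 ^ (j * q) := fun j =>
    Nat.lt_two_pow_self.le.trans (Nat.pow_le_pow_right (by norm_num)
      (Nat.le_mul_of_pos_right _ (by omega)))
  have hκ : ∀ j, n ^ j ≤ 2 ^ (2 * j * q) := fun j => by
    refine (Nat.pow_le_pow_left h2n j).trans_eq ?_
    rw [← pow_mul]
    congr 1
    ring
  have h1 : 1 + 2 * K * n ^ κ * n ≤ 2 ^ ((2 * K + 2 * (κ + 1)) * q) := calc
    1 + 2 * K * n ^ κ * n = 1 + 2 * K * n ^ (κ + 1) := by ring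
    _ ≤ (1 + 2 * K) * n ^ (κ + 1) := by
      have : 1 ≤ n ^ (κ + 1) := Nat.one_le_pow _ _ (by omega)
      nlinarith
    _ ≤ 2 ^ (2 * K * q) * 2 ^ (2 * (κ + 1) * q) := by
      refine Nat.mul_le_mul ?_ (hκ _)
      refine le_trans ?_ (Nat.pow_le_pow_right (by norm_num)
        (Nat.le_mul_of_pos_right (2 * K) (show 0 < q by omega)))
      have : 2 * K < 2 ^ (2 * K) := Nat.lt_two_pow_self
      omega
    _ = _ := by rw [← pow_add]; ring_nf
  have h2 : K * (1 + 2 * K * n ^ κ * n) ^ K * n ^ κ ≤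
      (2 ^ (K + (2 * K + 2 * (κ + 1)) * K + 2 * κ)) ^ q := calc
    _ ≤ 2 ^ (K * q) * (2 ^ ((2 * K + 2 * (κ + 1)) * q)) ^ K * 2 ^ (2 * κ * q) :=
      Nat.mul_le_mul (Nat.mul_le_mul (hK K) (Nat.pow_le_pow_left h1 K)) (hκ κ)
    _ = _ := by rw [← pow_mul, ← pow_mul, ← pow_add, ← pow_add]; ring_nf
  have h3 : ((K * (1 + 2 * K * n ^ κ * n) ^ K * n ^ κ : ℕ) : ℝ) ≤
      (2 ^ (K + (2 * K + 2 * (κ + 1)) * K + 2 * κ)) ^ q := by exact_mod_cast h2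
  push_cast at h3
  refine h3.trans_lt ?_
  rw [pow_mul]
  exact pow_lt_pow_left₀ hm (by positivity) (by omega)

/-- If the threshold exceeds all linkage values, only one cluster is left. -/
theorem StateInv.isApproxHAC {θ : ℝ} {σ : ℕ → Cluster k} {dead : ℕ → ℕ} {L : Merges k}
    (h : StateInv d ε θ p σ dead L) (hd : Metricish K d) (hε : 0 < ε) (hn : 1 ≤ n)
    (hθ : ∀ A B : Cluster k, A ⊆ Finset.univ.image p → B ⊆ Finset.univ.image p → A.Nonempty →
      B.Nonempty → Disjoint A B → d A B < θ) : IsApproxHAC d (1 + ε) p L := by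
  have hle : (cl n σ).card ≤ 1 := by
    refine Finset.card_le_one.2 fun X hX Y hY => ?_
    obtain ⟨i, rfl, hi⟩ := h.reach.slots.mem_cl.1 hX
    obtain ⟨j, rfl, hj⟩ := h.reach.slots.mem_cl.1 hY
    by_contra hne
    have hij : i ≠ j := fun he => hne (he ▸ rfl)
    exact absurd (h.sep i j hij hi hj) (not_le.2 (hθ _ _ (h.reach.sub i) (h.reach.sub j)
      (Finset.nonempty_iff_ne_empty.2 hi) (Finset.nonempty_iff_ne_empty.2 hj)
      (h.reach.slots.disj i j hij)))
  obtain ⟨L', hL'⟩ := h.reach.exists_hac hd (by linarith) hn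
  have h1 := hL'.2
  have h2 := h.reach.card
  rw [List.length_append] at h1
  exact ⟨h.reach.legal, by omega⟩

/-! ### The program -/

/-- The program: the prelude, then `m q` phases. -/
def hacCmd (c κ m : ℕ) : Cmd :=
  .seq (preludeCmd c κ) (forLoop 4 (.mul (.const m) (var 1)) phaseCmd)

theorem runs_phases {near : (ℕ → Cluster k) → ℕ → List ℕ} {N θ : ℝ}
    {E ℓ h q Q V u W H m : ℕ} (S : Setting d near ε N p K E ℓ h q Q V u)
    (hmq : m ≤ V ∧ q ≤ V ∧ m * q ≤ V) {s : Store k}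
    (hH : H = min h n) (hm : Mem n H q Q ε N s) (hst : StateInv d ε θ p s.slot (s.nat 6) [])
    (hθ : 0 < θ) (r1 : s.real 1 0 = θ * N) :
    Runs ⟨d, near, W⟩ (forLoop 4 (.mul (.const m) (var 1)) phaseCmd) s
      (m * q * (2 * u + phaseCost u q Q ℓ W n H) + 2 * u)
      (m * q * (2 * u + phaseCost u q Q ℓ 0 1 H) + 2 * u) fun s' L =>
        StateInv d ε ((1 + ε) ^ (m * q) * θ) p s'.slot (s'.nat 6) L := by
  have hε := S.ε_pos
  have e0 : Nat.size 0 = 0 := by simp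
  have e1 : Nat.size 1 = 1 := by simp
  have z1 := S.unit.size_le m hmq.1
  have z2 := S.unit.size_le q hmq.2.1
  have z3 := S.unit.size_le (m * q) hmq.2.2
  refine Runs.forLoop (fun j s' L => s'.nat 4 0 = j ∧ s'.real 1 0 = (1 + ε) ^ j * θ * N ∧
    Mem n H q Q ε N s' ∧ StateInv d ε ((1 + ε) ^ j * θ) p s'.slot (s'.nat 6) L) ?_ ?_ ?_ ?_ ?_
  · refine ⟨by simp [write_apply], by simpa using r1, ?_, ?_⟩
    · refine hm.of_eq (fun b hb => write_of_ne _ _ _ (by omega)) rfl rfl fun j => ?_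
      dsimp only
      rw [write_of_ne _ _ _ (by decide)]
      exact hm.dead_le j
    · dsimp only
      rw [write_of_ne _ _ _ (by decide), pow_zero, one_mul]
      exact hst
  · intro j hj
    have := S.unit.size_le j (hj.trans hmq.2.2)
    omega
  · rintro j hj s' L ⟨h4, -, hm', -⟩
    have := S.unit.size_le j (hj.trans hmq.2.2)
    have hq := hm'.lists
    refine ⟨h4, by simp only [NExp.eval, hq], ?_⟩
    simp only [NExp.cost, NExp.eval, hq, e0]
    omega
  · rintro j s' L hj ⟨h4, h1, hm', hst'⟩
    refine (runs_phase S hH hm' hst' (by positivity) h1).mono le_rfl le_rfl ?_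
    rintro s'' L' ⟨g1, g2, g3, g4⟩
    have he : (1 + ε) * ((1 + ε) ^ j * θ) = (1 + ε) ^ (j + 1) * θ := by ring
    rw [he] at g1 g4
    refine ⟨by rw [g2 4 (by norm_num), h4], by simp [write_apply], g1, ?_, ?_⟩
    · refine g3.of_eq (fun b hb => write_of_ne _ _ _ (by omega)) rfl rfl fun i => ?_
      dsimp only
      rw [write_of_ne _ _ _ (by decide)]
      exact g3.dead_le i
    · dsimp only
      rw [write_of_ne _ _ _ (by decide)]
      exact g4
  · rintro s' L ⟨-, -, -, h⟩
    exact h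

theorem StateInv.init {θ : ℝ} {dead : ℕ → ℕ} (hp : Function.Injective p) (hdead : ∀ j, dead j = 0)
    (hd : ∀ i j, i ≠ j → θ ≤ d {p i} {p j}) :
    StateInv d ε θ p (initSlots p) dead [] where
  reach := Reach.init d (1 + ε) hp
  sep i j hij hi hj := by
    unfold initSlots at hi hj ⊢
    split_ifs at hi hj ⊢ with h1 h2
    · exact hd _ _ fun he => hij (congrArg Fin.val he)
    all_goals simp at hi hj
  dead_iff j hj := by simp [hdead, initSlots, hj]

/-! ### Polynomial bounds for the costs -/

/-- The constants here and in the following bounds come from expanding the costs, and are rounded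
up. -/
theorem colourCost_le {D q W : ℕ} (hD : 1 ≤ D) (hq : 1 ≤ q) :
    colourCost (D * q) q (17 * q ^ 3) W ≤ 600 * (D * (W + 1) * q ^ 6) := by
  obtain ⟨D, rfl⟩ := Nat.exists_eq_add_of_le hD
  obtain ⟨q, rfl⟩ := Nat.exists_eq_add_of_le hq
  unfold colourCost
  ring_nf
  omega

theorem growCost_le {D q ℓ W : ℕ} (hD : 1 ≤ D) (hq : 1 ≤ q) (hℓ : ℓ ≤ q) :
    growCost (D * q) q ℓ W ≤ 36 * (D * (W + 1) * q ^ 2) := by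
  have : growCost (D * q) q ℓ W ≤ growCost (D * q) q q W := by unfold growCost; gcongr
  refine this.trans ?_
  obtain ⟨D, rfl⟩ := Nat.exists_eq_add_of_le hD
  obtain ⟨q, rfl⟩ := Nat.exists_eq_add_of_le hq
  unfold growCost
  ring_nf
  omega

theorem passCost_le {D q ℓ W m : ℕ} (hD : 1 ≤ D) (hq : 1 ≤ q) (hℓ : ℓ ≤ q) (hm : 1 ≤ m) :
    passCost (D * q) q (17 * q ^ 3) ℓ W m ≤ 13000 * (D * (W + 1) * m * q ^ 8) := by
  have h1 := colourCost_le (W := W) hD hq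
  have h2 := growCost_le (W := W) hD hq hℓ
  have : passCost (D * q) q (17 * q ^ 3) ℓ W m ≤
      (D * q + m * (1 + 600 * (D * (W + 1) * q ^ 6))) + (17 * q ^ 3 * (17 * q ^ 3) *
        (2 * (D * q) + (D * q + m * (1 + 36 * (D * (W + 1) * q ^ 2)))) + 2 * (D * q)) := by
    unfold passCost
    gcongr
  refine this.trans ?_
  obtain ⟨D, rfl⟩ := Nat.exists_eq_add_of_le hD
  obtain ⟨q, rfl⟩ := Nat.exists_eq_add_of_le hq
  obtain ⟨m, rfl⟩ := Nat.exists_eq_add_of_le hm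
  ring_nf
  omega

theorem phaseCost_le {D q ℓ W m h H : ℕ} (hD : 1 ≤ D) (hq : 1 ≤ q) (hℓ : ℓ ≤ q) (hm : 1 ≤ m)
    (hh : 1 ≤ h) (hH : H ≤ h) :
    phaseCost (D * q) q (17 * q ^ 3) ℓ W m H ≤ 27000 * (h * (D * (W + 1) * m * q ^ 8)) := by
  have h1 := passCost_le (W := W) hD hq hℓ hm
  have h2 : D * q ≤ D * (W + 1) * m * q ^ 8 := calc
    D * q = D * 1 * 1 * q ^ 1 := by ring
    _ ≤ _ := by gcongr <;> omega
  set X := D * (W + 1) * m * q ^ 8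
  have h3 : X ≤ h * X := Nat.le_mul_of_pos_left _ hh
  have h4 : (H + 1) * (2 * (D * q) + passCost (D * q) q (17 * q ^ 3) ℓ W m) ≤
      (2 * h) * (13002 * X) := Nat.mul_le_mul (by omega) (by omega)
  have h5 : (2 * h) * (13002 * X) = 26004 * (h * X) := by ring
  unfold phaseCost
  omega

/-- The bound for the whole program, where `a` and `b` stand for `⌊log₂ n⌋` and the dimension. -/
theorem totalCost_le {D q ℓ W m h H t a b : ℕ} (hD : 1 ≤ D) (hq : 1 ≤ q) (hℓ : ℓ ≤ q) (hm : 1 ≤ m)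
    (hh : 1 ≤ h) (hH : H ≤ h) (ha : a ≤ q) (hb : b ≤ q) :
    (D * q * (2 * a + 3 * b + 12) + h) +
        (t * q * (2 * (D * q) + phaseCost (D * q) q (17 * q ^ 3) ℓ W m H) + 2 * (D * q)) ≤
      (28000 * t + 20) * D * (h * (W + 1) * m * q ^ 9) := by
  have h1 := phaseCost_le (W := W) hD hq hℓ hm hh hH
  set Y := h * (D * (W + 1) * m * q ^ 8) with hY
  have h2 : D * q ≤ Y := calc
    D * q = 1 * (D * 1 * 1 * q ^ 1) := by ring
    _ ≤ _ := by rw [hY]; gcongr <;> omega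
  have h3 : h ≤ Y := calc
    h = h * (1 * 1 * 1 * 1 ^ 8) := by ring
    _ ≤ _ := by rw [hY]; gcongr; omega
  have h4 : D * q * (2 * a + 3 * b + 12) ≤ Y * (17 * q) := Nat.mul_le_mul h2 (by omega)
  have h5 : t * q * (2 * (D * q) + phaseCost (D * q) q (17 * q ^ 3) ℓ W m H) ≤
      t * q * (28000 * Y) := Nat.mul_le_mul_left _ (by omega)
  have h6 : Y ≤ Y * q := Nat.le_mul_of_pos_right _ hq
  calc _ ≤ (Y * (17 * q) + Y * q) + (t * q * (28000 * Y) + 2 * (Y * q)) := by omega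
    _ = (28000 * t + 20) * (Y * q) := by ring
    _ = _ := by rw [hY]; ring

/-- Powers of `q` have the form of the resource bounds. -/
theorem mul_pow_le {A c k ℓ lg X C : ℕ} (hℓ : 1 ≤ ℓ) (hlg : 1 ≤ lg)
    (hC : A * c ^ 9 + 9 * c ≤ C) :
    A * (X * (c * (2 * ℓ) ^ (c * k) * lg ^ c) ^ 9) ≤ C * (X * (2 * ℓ) ^ (C * k)) * lg ^ C := calc
  _ = A * c ^ 9 * (X * (2 * ℓ) ^ (9 * c * k)) * lg ^ (9 * c) := by
    rw [mul_pow, mul_pow, ← pow_mul, ← pow_mul]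
    ring_nf
  _ ≤ _ := by
    have h9 : 9 * c ≤ C := by omega
    have h10 : A * c ^ 9 ≤ C := by omega
    gcongr
    omega

end Assembly

section Total

variable {k n : ℕ} {d : Linkage k} {p : Fin n → Pt k} {δ ε : ℝ} {K κ : ℕ}

/-! ### The size of the numbers -/

/-- `q` bounds all of the parameters but `n` and `h`. -/
theorem le_lists {c k ℓ lg q : ℕ} (hc : 1 ≤ c) (hk : 1 ≤ k) (hℓ : 1 ≤ ℓ) (hlg : 1 ≤ lg)
    (hq : q = c * (2 * ℓ) ^ (c * k) * lg ^ c) :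
    lg ≤ q ∧ k ≤ q ∧ 2 * ℓ ≤ q ∧ (2 * ℓ) ^ c ≤ q := by
  have h1 : 1 ≤ (2 * ℓ) ^ (c * k) := Nat.one_le_pow _ _ (by omega)
  have h2 : 1 ≤ lg ^ c := Nat.one_le_pow _ _ hlg
  have h3 : (2 * ℓ) ^ (c * k) ≤ q := by
    rw [hq]
    exact (Nat.le_mul_of_pos_left _ hc).trans (Nat.le_mul_of_pos_right _ h2)
  have h4 : lg ^ c ≤ q := by
    rw [hq]
    exact Nat.le_mul_of_pos_left _ (Nat.mul_pos hc h1)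
  refine ⟨(Nat.le_self_pow (by omega) lg).trans h4, ?_,
    (Nat.le_self_pow (Nat.mul_pos hc hk).ne' _).trans h3,
    (Nat.pow_le_pow_right (by omega) (Nat.le_mul_of_pos_right c hk)).trans h3⟩
  calc k ≤ 2 ^ k := Nat.lt_two_pow_self.le
    _ ≤ 2 ^ (c * k) := Nat.pow_le_pow_right (by norm_num) (Nat.le_mul_of_pos_left k hc)
    _ ≤ (2 * ℓ) ^ (c * k) := Nat.pow_le_pow_left (by omega) _
    _ ≤ q := h3

theorem unitCost_two_pow {a q : ℕ} (hq : 1 ≤ q) : UnitCost (2 ^ (a * q)) ((50 * a + 250) * q) where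
  size_le x hx := by
    have h : x.size ≤ a * q + 1 := Nat.size_le.2 (hx.trans_lt (by
      rw [pow_succ]
      have : 0 < 2 ^ (a * q) := by positivity
      omega))
    nlinarith

theorem numbers_le {n q m : ℕ} (κ : ℕ) (hn : 2 ≤ n) (hq : 1 ≤ q) (hlg : Nat.log 2 n ≤ q) :
    let V := 2 ^ ((2 * κ + m + 20) * q)
    n + 1 ≤ V ∧ n ^ κ ≤ V ∧ 17 * q ^ 3 ≤ V ∧ 17 * q ^ 3 * (17 * q ^ 3) + 1 ≤ V ∧ m ≤ V ∧ q ≤ V ∧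
      m * q ≤ V := by
  intro V
  have hV : ∀ {x}, x ≤ (2 * κ + m + 20) * q → 2 ^ x ≤ V := fun h =>
    Nat.pow_le_pow_right (by norm_num) h
  have hlt : n < 2 ^ (2 * q) := (Nat.lt_pow_succ_log_self one_lt_two n).trans_le
    (Nat.pow_le_pow_right (by norm_num) (by have := Nat.log_pos one_lt_two hn; omega))
  have hq2 : q ≤ 2 ^ q := Nat.lt_two_pow_self.le
  have hm2 : m ≤ 2 ^ m := Nat.lt_two_pow_self.le
  have hmV : m ≤ (2 * κ + m + 20) * q := by nlinarith
  have hQ : 17 * q ^ 3 * (17 * q ^ 3) + 1 ≤ V := calc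
    _ = 289 * q ^ 6 + 1 := by ring
    _ ≤ 290 * q ^ 6 := by
      have : 1 ≤ q ^ 6 := Nat.one_le_pow _ _ hq
      omega
    _ ≤ 2 ^ 9 * (2 ^ q) ^ 6 := by gcongr; norm_num
    _ = 2 ^ (9 + 6 * q) := by ring
    _ ≤ V := hV (by nlinarith)
  have hQ' : 17 * q ^ 3 ≤ 17 * q ^ 3 * (17 * q ^ 3) :=
    Nat.le_mul_of_pos_right _ (by positivity)
  refine ⟨?_, ?_, by omega, hQ, hm2.trans (hV hmV), hq2.trans (hV (by nlinarith)), ?_⟩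
  · exact (Nat.succ_le_of_lt hlt).trans (hV (by nlinarith))
  · calc n ^ κ ≤ (2 ^ (2 * q)) ^ κ := Nat.pow_le_pow_left hlt.le κ
      _ = 2 ^ (2 * κ * q) := by rw [← pow_mul]; ring_nf
      _ ≤ V := hV (by nlinarith)
  · calc m * q ≤ 2 ^ m * 2 ^ q := Nat.mul_le_mul hm2 hq2
      _ = 2 ^ (m + q) := by rw [pow_add]
      _ ≤ V := hV (by nlinarith)

theorem moduli_le {lg q : ℕ} (hq : 1 ≤ q) (hlg : lg ≤ q) :
    2 * ((lg + 1) * ((q + 1) * q) + 4) + 1 ≤ 17 * q ^ 3 := by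
  have h : (lg + 1) * ((q + 1) * q) ≤ (q + 1) * ((q + 1) * q) :=
    Nat.mul_le_mul_right _ (by omega)
  have : 2 * ((q + 1) * ((q + 1) * q) + 4) + 1 ≤ 17 * q ^ 3 := by
    obtain ⟨q, rfl⟩ := Nat.exists_eq_add_of_le hq
    ring_nf
    omega
  omega

/-- The packing bound at the conflict radius is at most the length of the lists. -/
theorem pack_le {E ℓ q : ℕ} {θ : ℝ} (hθ : 0 < θ)
    (h : K * (Nat.log 2 n + 1) ^ K * (2 * (3 * K ^ 2 * ((2 * ℓ) ^ (2 * K) * E))) ^ (K * k) ≤ q) :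
    ((K * (Nat.log 2 n + 1) ^ K : ℕ) : ℝ) * (2 * (conflictRadius K E ℓ θ / θ)) ^ (K * k) ≤ q := by
  have he : conflictRadius K E ℓ θ / θ = 3 * K ^ 2 * ((2 * ℓ) ^ (2 * K) * E) := by
    unfold conflictRadius pathRadius
    field_simp
  rw [he]
  exact_mod_cast h

/-- The program is correct, with resource bounds polynomial in `q`; the numbers that it handles are
at most `2 ^ ((2κ + m + 20) q)`, so that elementary steps cost at most a multiple of `q`. -/
theorem runs_hacCmd {near : (ℕ → Cluster k) → ℕ → List ℕ} {E h ℓ W c m q D : ℕ} (hε : 0 < ε)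
    (hE : 1 + ε ≤ E) (hc : 1 ≤ c)
    (hpack : ∀ k n ℓ : ℕ, 1 ≤ k → 2 ≤ n → 1 ≤ ℓ →
      K * (Nat.log 2 n + 1) ^ K * (2 * (3 * K ^ 2 * ((2 * ℓ) ^ (2 * K) * E))) ^ (K * k) ≤
        c * (2 * ℓ) ^ (c * k) * Nat.log 2 n ^ c)
    (hm : ∀ n q : ℕ, 2 ≤ n → Nat.log 2 n ≤ q →
      (K * (1 + 2 * K * (n : ℝ) ^ κ * n) ^ K) * (n : ℝ) ^ κ < (1 + ε) ^ (m * q))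
    (hD : D = (c + κ + 6) * (50 * (2 * κ + m + 20) + 250))
    (hn : 2 ≤ n) (hp : Function.Injective p) (hδ : 0 < δ)
    (hwb : WellBehaved K fun A B => d A B / δ)
    (hd : ∀ i j, i ≠ j → δ ≤ d {p i} {p j} ∧ d {p i} {p j} ≤ δ * (n : ℝ) ^ κ)
    (hh : ∀ L, IsApproxHAC d (1 + ε) p L → dendrogramHeight p L ≤ h)
    (hℓ : BounceBackLengthLE d ε p ℓ)
    (hq : q = c * (2 * ℓ) ^ (c * k) * Nat.log 2 n ^ c) (hnear : FindsNearest d q near) :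
    Runs ⟨d, near, W⟩ (hacCmd c κ m) (initStore p h ℓ ε)
      ((28000 * m + 20) * D * (h * (W + 1) * n * q ^ 9))
      ((28000 * m + 20) * D * (h * q ^ 9)) fun _ L => IsApproxHAC d (1 + ε) p L := by
  have hmet := hwb.metricish hδ
  have hd1 : ∀ i j, i ≠ j → δ ≤ d {p i} {p j} := fun i j hij => (hd i j hij).1
  have h01 : (⟨0, by omega⟩ : Fin n) ≠ ⟨1, by omega⟩ := by simp
  have hK := hwb.one_le hδ (hd1 _ _ h01)
  have hk := one_le_dim hn hp
  have hℓ1 := hℓ.one_le hε hn hδ hp hd1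
  have hh1 := one_le_height hmet hε hn hp hh
  have hlg1 : 1 ≤ Nat.log 2 n := Nat.log_pos one_lt_two hn
  obtain ⟨hlq, hkq, hℓq, hcq⟩ := le_lists hc hk hℓ1 hlg1 hq
  have hq1 : 1 ≤ q := by omega
  set V := 2 ^ ((2 * κ + m + 20) * q) with hV
  obtain ⟨v1, v2, v3, v4, v5, v6, v7⟩ := numbers_le (m := m) κ hn hq1 hlq
  rw [← hV] at v1 v2 v3 v4 v5 v6 v7
  have hv : UnitCost V ((50 * (2 * κ + m + 20) + 250) * q) := unitCost_two_pow hq1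
  have hu : (c + κ + 6) * ((50 * (2 * κ + m + 20) + 250) * q) = D * q := by rw [hD]; ring
  have hD1 : 1 ≤ D := by rw [hD]; exact Nat.mul_pos (by omega) (by omega)
  have hn0 : (0 : ℝ) < n := by exact_mod_cast (show 0 < n by omega)
  have hN : (0 : ℝ) < (n : ℝ) ^ κ := by positivity
  have S : Setting d near ε ((n : ℝ) ^ κ) p K E ℓ h q (17 * q ^ 3) V (D * q) :=
    { metricish := hmet
      K_pos := hK
      ε_pos := hε
      ε_le := hE
      ℓ_pos := hℓ1
      q_pos := hq1
      n_pos := by omega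
      N_pos := hN
      bounce := hℓ
      finds := hnear
      height := hh
      pack := fun θ hθ => pack_le hθ (by rw [hq]; exact hpack k n ℓ hk hn hℓ1)
      unit := ⟨fun x hx => (hv.size_le x hx).trans
        (hu ▸ Nat.le_mul_of_pos_left _ (by omega))⟩
      n_le := v1
      le_Q := moduli_le hq1 hlq
      Q_le := v4 }
  have cost := fun W' m' (hm' : 1 ≤ m') => totalCost_le (W := W') (t := m) hD1 hq1
    (show ℓ ≤ q by omega) hm' hh1 (min_le_left h n) hlq hkq
  refine Runs.mono (Runs.seq ((runs_preludeCmd (M := ⟨d, near, W⟩) (h := h) hv hn hℓ1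
    (by simp [initStore]) (by simp [initStore]) (by simp [initStore]) (by simp [initStore]) hc hq (by omega)
    (by omega) (by omega) (by omega) v3 v2 hu.le).mono le_rfl le_rfl ?_)) (cost W n (by omega))
    ((cost 0 1 le_rfl).trans_eq (by ring)) fun _ _ h => h
  rintro s _ ⟨rfl, s1, s2, s3, s4, s5, s6, s7, s8, s9⟩
  have hs0 : (initStore p h ℓ ε).slot = initSlots p := rfl
  have h6 : s.nat 6 = fun _ => 0 := by
    rw [s2 6 (by norm_num) (by norm_num)]
    rfl
  set D₀ := d {p ⟨0, by omega⟩} {p ⟨1, by omega⟩} with hD₀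
  have hD0 : δ ≤ D₀ := hd1 _ _ h01
  have hlink : s.real 1 0 = D₀ := by
    rw [s8, hs0]
    simp [initSlots, show 0 < n by omega, show 1 < n by omega, hD₀]
  have hθ : 0 < D₀ / (n : ℝ) ^ κ := div_pos (hδ.trans_le hD0) hN
  have hst : StateInv d ε (D₀ / (n : ℝ) ^ κ) p s.slot (s.nat 6) [] := by
    rw [s1, hs0]
    refine StateInv.init hp (fun j => by rw [h6]) fun i j hij => le_trans ?_ (hd1 i j hij)
    rw [div_le_iff₀ hN]
    exact (hd _ _ h01).2
  have hmem : Mem n (min h n) q (17 * q ^ 3) ε ((n : ℝ) ^ κ) s :=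
    { size := by rw [s6]; simp [initStore]
      lists := s3
      height := s4
      modulus := s5
      eps := by rw [s7]; simp [initStore]
      scale := s9
      dead_le := fun j => by rw [h6]; exact Nat.zero_le 1 }
  refine (runs_phases S ⟨v5, v6, v7⟩ rfl hmem hst hθ
    (by rw [hlink]; field_simp)).mono le_rfl le_rfl fun s' L hfin => ?_
  refine hfin.isApproxHAC hmet hε (by omega) fun A B hA hB hA' hB' hAB => ?_
  refine (diameter_le hδ hwb hn hd hA hB hA' hB' hAB).trans_lt ?_
  have hbig := hm n q hn hlq
  rw [← mul_div_assoc, lt_div_iff₀ hN, mul_assoc]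
  calc δ * (K * (1 + 2 * K * (n : ℝ) ^ κ * n) ^ K * (n : ℝ) ^ κ)
      < δ * (1 + ε) ^ (m * q) := mul_lt_mul_of_pos_left hbig hδ
    _ ≤ D₀ * (1 + ε) ^ (m * q) := by
      have : 0 ≤ 1 + ε := by linarith
      gcongr
    _ = _ := mul_comm _ _

end Total

end HAC

end

theorem mainTheorem4 (ε : ℝ) (hε : 0 < ε) (K κ : ℕ) :
    ∃ (prog : HAC.Cmd) (c C : ℕ),
      ∀ (k n h ℓ W : ℕ) (p : Fin n → HAC.Pt k) (d : HAC.Linkage k) (δ : ℝ)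
        (near : (ℕ → HAC.Cluster k) → ℕ → List ℕ),
        2 ≤ n → Function.Injective p →
        0 < δ → HAC.WellBehaved K (fun A B => d A B / δ) →
        (∀ i j, i ≠ j → δ ≤ d {p i} {p j} ∧ d {p i} {p j} ≤ δ * (n : ℝ) ^ κ) →
        (∀ L, HAC.IsApproxHAC d (1 + ε) p L → HAC.dendrogramHeight p L ≤ h) →
        HAC.BounceBackLengthLE d ε p ℓ →
        1 ≤ W →
        HAC.FindsNearest d (c * (2 * ℓ) ^ (c * k) * Nat.log 2 n ^ c) near →
        ∃ (s' : HAC.Store k) (L : HAC.Merges k) (work depth : ℕ),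
          HAC.Exec ⟨d, near, W⟩ prog (HAC.initStore p h ℓ ε) s' L work depth ∧
          HAC.IsApproxHAC d (1 + ε) p L ∧
          work ≤ C * (W * n * h * (2 * ℓ) ^ (C * k)) * Nat.log 2 n ^ C ∧
          depth ≤ C * (h * (2 * ℓ) ^ (C * k)) * Nat.log 2 n ^ C := by
  obtain ⟨E, hE⟩ := exists_nat_ge (1 + ε)
  obtain ⟨c, hc, hpack⟩ := HAC.packing_le (K := K) (E := E)
  obtain ⟨m, hm⟩ := HAC.exists_phases hε K κ
  let D := (c + κ + 6) * (50 * (2 * κ + m + 20) + 250)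
  let A := 2 * ((28000 * m + 20) * D)
  refine ⟨HAC.hacCmd c κ m, c, A * c ^ 9 + 9 * c, ?_⟩
  intro k n h ℓ W p d δ near hn hp hδ hwb hd hh hℓ hW hnear
  obtain ⟨s', L, work, depth, hexec, hwork, hdepth, hL⟩ :=
    HAC.runs_hacCmd (W := W) (D := D) hε hE hc (hpack c le_rfl) hm rfl hn hp hδ hwb hd hh hℓ rfl
      hnear
  have hℓ1 := hℓ.one_le hε hn hδ hp fun i j hij => (hd i j hij).1
  have hlg1 : 1 ≤ Nat.log 2 n := Nat.log_pos one_lt_two hn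
  refine ⟨s', L, work, depth, hexec, hL, ?_, ?_⟩
  · refine le_trans (hwork.trans ?_)
      (HAC.mul_pow_le (A := A) (c := c) (k := k) (X := W * n * h) hℓ1 hlg1 le_rfl)
    have : h * (W + 1) * n ≤ 2 * (W * n * h) := by
      calc h * (W + 1) * n ≤ h * (2 * W) * n := by gcongr; omega
        _ = _ := by ring
    calc _ ≤ (28000 * m + 20) * D *
          (2 * (W * n * h) * (c * (2 * ℓ) ^ (c * k) * Nat.log 2 n ^ c) ^ 9) := by gcongr
      _ = _ := by simp only [A]; ring
  · refine le_trans (hdepth.trans ?_)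
      (HAC.mul_pow_le (A := A) (c := c) (k := k) (X := h) hℓ1 hlg1 le_rfl)
    exact Nat.mul_le_mul_right _ (by simp only [A]; omega)
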